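/- Notation. Let $k\ge 2$ be an integer, $\tau\in\mathbb H$, $q^a=e^{2\pi i a\tau}$, $y_z^a=e^{2\pi i a z}$. Put $$\theta_{11}(\tau;z)=\sum_{n\in\mathbb Z}q^{(n+1/2)^2/2}e^{2\pi i(z+1/2)(n+1/2)},\qquad \vartheta_{k,r}(\tau;z)=\sum_{n\equiv r\,(2k)}q^{n^2/4k}y_z^n,\qquad \widehat\vartheta_{k,r}=\vartheta_{k,r}-\vartheta_{k,-r},$$ $$\widehat{\mathcal S}^{(k)}_{l,l'}=\sqrt{2/k}\,\sin\frac{\pi ll'}{k},\qquad \chi^{(k-2)}_{l-1}(\tau;z)=\frac{\widehat\vartheta_{k,l}(\tau;z/2)}{\widehat\vartheta_{2,1}(\tau;z/2)},$$ the latter understood as an entire function of $z$ (its singularities are removable). For $K\ge1$ the string functions $c^{(K)}_{l,r}(\tau)$, $r\in\mathbb Z/2K$, are defined by $\chi^{(K)}_l(\tau;z)=\sum_{r\in\mathbb Z/2K}c^{(K)}_{l,r}(\tau)\,\vartheta_{K,r}(\tau;z/2)$. Put $$\chi^{l,s,k}_r(\tau;z)=\sum_{n\in\mathbb Z/(k-2)}c^{(k-2)}_{l,r-s+4n}(\tau)\,\vartheta_{2k(k-2),\,2r+k(4n-s)}(\tau;z/2k)\quad(k\ge3),\qquad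 \chi^{0,s,2}_r=\delta_{r\equiv s\,(4)},$$ and $C^{l,k}_r=i\,(\chi^{l,1,k}_r-\chi^{l,3,k}_r)$. For $v,u\in\mathbb C\setminus(\mathbb Z\tau+\mathbb Z)$ and $w\in\mathbb C$ let $$\mu^{k,j,j'}(\tau;v,u,w)=\frac{y_v^{j'/k}}{\theta_{11}(\tau;u)}\sum_{n\in\mathbb Z}\frac{q^{n^2/k}q^{j'n/k}}{1-y_vq^n}\left(\frac{y_u\,y_w^{1-2/k}}{y_v^{1-2/k}}\right)^{n}C^{j-1,k}_{2n+j'}(\tau;w-v),$$ $\mu^{k,j,j'}_{\rm sym}=\tfrac12\left[\mu^{k,j,j'}+\mu^{k,k-j,k-j'}\right]$. Finally define the generalized Mordell integrals $$h_{k,r}(\tau;u)=i\int_{\mathbb R}\frac{e^{2\pi i k\tau x^2-4\pi kux}}{1-e^{2\pi x-\pi i r/k}}\,dx,\qquad \widehat h_{k,r}(\tau;u)=2\left[h_{k,r}(\tau;u/2)-h_{k,-r}(\tau;u/2)\right].$$ Proposition. Let $j,j'\in\{1,\dots,k-1\}$ with $j\equiv j'\pmod 2$. Then for all $\tau\in\mathbb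 H$, $w\in\mathbb C$ and $v,u\in\mathbb C\setminus(\mathbb Z\tau+\mathbb Z)$, with the principal branch of the square root, $$\mu_{\rm sym}^{k,j,j'}(\tau;v,u,w)+\frac{e^{\pi i(u-v)^2/\tau}e^{-\pi i w^2(1-2/k)/\tau}}{\sqrt{-i\tau}}\sum_{p,p'=1}^{k-1}\widehat{\mathcal S}^{(k)}_{j,p}\widehat{\mathcal S}^{(k)}_{j',p'}\,\mu^{k,p,p'}\Big(-\frac1\tau;\frac v\tau,\frac u\tau,\frac w\tau\Big)$$ $$=\frac14\Big[\chi^{(k-2)}_{j-1}(\tau;u-v+w)\,\widehat h_{k,j'}\big(\tau;u-v+w(1-\tfrac2k)\big)+\chi^{(k-2)}_{k-j-1}(\tau;u-v+w)\,\widehat h_{k,k-j'}\big(\tau;u-v+w(1-\tfrac2k)\big)\Big],$$ and the same identity holds with $\mu^{k,p,p'}$ replaced by $\mu_{\rm sym}^{k,p,p'}$ inside the sum. -/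

import Mathlib

open Complex Filter Topology

namespace AppellLerch

/-- `e(x) = exp(2πi x)`, so that `q ^ a = e(a τ)` and `y_z ^ a = e(a z)`. -/
noncomputable def e (x : ℂ) : ℂ := exp (2 * Real.pi * I * x)

/-- The Jacobi theta function
`θ₁₁(τ;z) = ∑_{n ∈ ℤ} q^{(n+1/2)²/2} exp(2πi (z+1/2)(n+1/2))`. -/
noncomputable def theta11 (τ z : ℂ) : ℂ :=
  ∑' n : ℤ, e (((n : ℂ) + 1 / 2) ^ 2 / 2 * τ) * e ((z + 1 / 2) * ((n : ℂ) + 1 / 2))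

/-- The Jacobi theta function of level `k`,
`ϑ_{k,r}(τ;z) = ∑_{n ≡ r mod 2k} q^{n²/4k} y^n`, written with `n = 2 k m + r`. -/
noncomputable def vartheta (k : ℕ) (r : ℤ) (τ z : ℂ) : ℂ :=
  ∑' m : ℤ, e ((2 * k * m + r : ℂ) ^ 2 / (4 * k) * τ) * e ((2 * k * m + r : ℂ) * z)

/-- `ϑ̂_{k,r} = ϑ_{k,r} - ϑ_{k,-r}`. -/
noncomputable def varthetaHat (k : ℕ) (r : ℤ) (τ z : ℂ) : ℂ :=
  vartheta k r τ z - vartheta k (-r) τ z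

/-- The affine `SU(2)` character at level `K`,
`χ_l^{(K)}(τ;z) = ϑ̂_{K+2,l+1}(τ;z/2) / ϑ̂_{2,1}(τ;z/2)`.
The quotient is an entire function of `z` after removing its removable singularities at the
zeros `z ∈ ℤτ + ℤ` of the denominator; taking the limit at every point gives that function. -/
noncomputable def affineChar (K : ℕ) (l : ℤ) (τ z : ℂ) : ℂ :=
  limUnder (𝓝[≠] z) fun ζ : ℂ => varthetaHat (K + 2) (l + 1) τ (ζ / 2) / varthetaHat 2 1 τ (ζ / 2)

/-- `c : ℤ/2K → ℂ` is the family of coefficients in the theta decomposition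
`χ_l^{(K)}(τ;z) = ∑_{r ∈ ℤ/2K} c_r ϑ_{K,r}(τ;z/2)`. -/
def IsThetaDecomposition (K : ℕ) (l : ℤ) (τ : ℂ) (c : ZMod (2 * K) → ℂ) : Prop :=
  ∀ z : ℂ, affineChar K l τ z =
    ∑ r ∈ Finset.range (2 * K), c (r : ZMod (2 * K)) * vartheta K (r : ℤ) τ (z / 2)

open Classical in
/-- The string functions `c^{(K)}_{l,r}(τ)`: the coefficients of the theta decomposition of
`χ_l^{(K)}(τ;·)`. For `K ≥ 1` and `Im τ > 0` they exist and are unique. -/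
noncomputable def stringFunction (K : ℕ) (l r : ℤ) (τ : ℂ) : ℂ :=
  if h : ∃ c : ZMod (2 * K) → ℂ, IsThetaDecomposition K l τ c
  then h.choose (r : ZMod (2 * K)) else 0

/-- The characters `χ_r^{l,s,k}(τ;z)` of the supersymmetric coset `SU(2)_k/U(1)`:
`∑_{n ∈ ℤ/(k-2)} c^{(k-2)}_{l,r-s+4n}(τ) ϑ_{2k(k-2),2r+k(4n-s)}(τ;z/2k)` for `k ≥ 3`,
and `δ_{r ≡ s mod 4}` for `k = 2`, where `l = 0` is the only label. -/
noncomputable def cosetChar (k : ℕ) (l s r : ℤ) (τ z : ℂ) : ℂ :=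
  if k = 2 then (if l = 0 ∧ (4 : ℤ) ∣ r - s then 1 else 0)
  else ∑ n ∈ Finset.range (k - 2),
    stringFunction (k - 2) l (r - s + 4 * n) τ *
      vartheta (2 * k * (k - 2)) (2 * r + k * (4 * n - s)) τ (z / (2 * k))

/-- The supersymmetric characters with characteristics `a, b`,
`C^{l,k}_r[a;b](τ;z) = e^{πi ab/2} (χ_r^{l,a,k}(τ;z) + (-1)^b χ_r^{l,a+2,k}(τ;z))`. -/
noncomputable def susyChar (k a b : ℕ) (l r : ℤ) (τ z : ℂ) : ℂ :=
  exp (Real.pi * I * a * b / 2) *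
    (cosetChar k l a r τ z + (-1) ^ b * cosetChar k l (a + 2) r τ z)

/-- The Appell-Lerch sum
`μ^{k,j,j'}(τ;v,u,w) = y_v^{j'/k} / θ₁₁(τ;u) · ∑_{n ∈ ℤ} q^{n²/k} q^{j'n/k} / (1 - y_v q^n)
  · (y_u y_w^{1-2/k} / y_v^{1-2/k})^n · C^{j-1,k}_{2n+j'}[1;1](τ;w-v)`. -/
noncomputable def mu (k : ℕ) (j j' : ℤ) (τ v u w : ℂ) : ℂ :=
  e (j' / k * v) / theta11 τ u *
    ∑' n : ℤ, e ((n : ℂ) ^ 2 / k * τ) * e (j' * n / k * τ) / (1 - e v * e (n * τ)) *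
      (e u * e ((1 - 2 / k) * w) / e ((1 - 2 / k) * v)) ^ n *
      susyChar k 1 1 (j - 1) (2 * n + j') τ (w - v)

/-- `μ_sym^{k,j,j'} = (μ^{k,j,j'} + μ^{k,k-j,k-j'}) / 2`. -/
noncomputable def muSym (k : ℕ) (j j' : ℤ) (τ v u w : ℂ) : ℂ :=
  (1 / 2) * (mu k j j' τ v u w + mu k (k - j) (k - j') τ v u w)

/-- `Ŝ^{(k)}_{l,l'} = √(2/k) sin(π l l' / k)`. -/
noncomputable def SHat (k : ℕ) (l l' : ℤ) : ℂ :=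
  ((Real.sqrt (2 / k) * Real.sin (Real.pi * l * l' / k) : ℝ) : ℂ)

/-- The generalized Mordell integral
`h_{k,r}(τ;u) = i ∫_ℝ exp(2πi k τ x² - 4π k u x) / (1 - exp(2πx - πi r/k)) dx`. -/
noncomputable def mordell (k : ℕ) (r : ℤ) (τ u : ℂ) : ℂ :=
  I * ∫ x : ℝ, exp (2 * Real.pi * I * k * τ * (x : ℂ) ^ 2 - 4 * Real.pi * k * u * x) /
    (1 - exp (2 * Real.pi * x - Real.pi * I * r / k))

/-- `ĥ_{k,r}(τ;u) = 2 (h_{k,r}(τ;u/2) - h_{k,-r}(τ;u/2))`. -/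
noncomputable def mordellHat (k : ℕ) (r : ℤ) (τ u : ℂ) : ℂ :=
  2 * (mordell k r τ (u / 2) - mordell k (-r) τ (u / 2))

end AppellLerch

open AppellLerch

namespace AppellLerch

/-! ### The exponential `e` -/

/-! Fix `τ`, `v`, `w` and regard everything as a function of `u`. After multiplication by θ₁₁(τ;u)
no poles are left: the numerators `muNum` are entire in `u`, and `theta11_S` trades θ₁₁(-1/τ;u/τ)
for θ₁₁(τ;u) up to a Gaussian. The difference of the two sides becomes an entire function
`muDefect`, which has period 1 and is multiplied by e(-v) under u ↦ u + τ. Its Fourier coefficients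
therefore satisfy d_n e(nτ) = e(-v) d_n, and a nonzero one would put `v` on the lattice; so it
vanishes (`eq_zero_of_quasiperiodic`, `muDefect_eq_zero`).

The quasi-periodicity is where the content lies. In N(u) - y_v N(u+τ) the denominators 1 - y_v qⁿ
cancel (`appell_sub_period`), and the remaining Fourier series is summed by the branching rule
`hasSum_susyChar`, which writes an affine character times θ₁₁ as level-k theta terms weighted by
coset characters. Hence a numerator fails to be quasi-periodic by an explicit exponential times
χ·θ₁₁ (`muNum_sub_period`). The translation by τ disturbs only the numerators at τ, the translation
by 1 only those at -1/τ.

The Mordell side has exactly the compensating defects. Under u ↦ u + 1 a finite geometric sum turns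
the integrals into Gaussians, which together with the S-transformation of the affine characters
reproduce the defects at -1/τ (`mordellSide_add_one`). Under u ↦ u + τ the contour moves by i/2 and
crosses one pole; its residue is the defect at τ (`mordellSide_add_period`). The contour shift and
the period shift of the characters both reflect labels, j ↦ k - j and j' ↦ k - j', so the argument
closes only for the symmetrised sum. Inside the double sum symmetrising is harmless, because the two
signs produced by reflecting the S-matrix entries agree when j ≡ j' mod 2 (`sum_SHat_reflect`); this
gives the second identity. -/

lemma e_add (x y : ℂ) : e (x + y) = e x * e y := by
  simp only [e, mul_add, Complex.exp_add]

@[simp] lemma e_zero : e 0 = 1 := by simp [e]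

lemma e_neg (x : ℂ) : e (-x) = (e x)⁻¹ := by
  simp only [e, mul_neg, Complex.exp_neg]

lemma e_sub (x y : ℂ) : e (x - y) = e x / e y := by
  rw [sub_eq_add_neg, e_add, e_neg, div_eq_mul_inv]

@[simp] lemma e_ne_zero (x : ℂ) : e x ≠ 0 := Complex.exp_ne_zero _

lemma e_zpow (x : ℂ) (n : ℤ) : e x ^ n = e (n * x) := by
  rw [e, e, ← Complex.exp_int_mul]
  congr 1
  ring

lemma e_pow (x : ℂ) (n : ℕ) : e x ^ n = e (n * x) := by
  simpa using e_zpow x n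

@[simp] lemma e_intCast (n : ℤ) : e n = 1 := by
  rw [e, mul_comm]
  exact Complex.exp_int_mul_two_pi_mul_I n

lemma e_eq_one_iff {x : ℂ} : e x = 1 ↔ ∃ n : ℤ, x = n := by
  rw [e, Complex.exp_eq_one_iff]
  refine exists_congr fun n => ?_
  rw [mul_comm, mul_eq_mul_right_iff, or_iff_left Complex.two_pi_I_ne_zero]

/-- Two arguments of `e` that differ by an integer give the same value. -/
lemma e_eq_of_eq_add_int {x y : ℂ} (n : ℤ) (h : x = y + n) : e x = e y := by
  rw [h, e_add, e_intCast, mul_one]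

lemma e_half : e (1 / 2) = -1 := by
  rw [e, ← Complex.exp_pi_mul_I]
  congr 1
  ring

lemma e_int_half (n : ℤ) : e (n / 2) = (-1) ^ n := by
  rw [← e_half, e_zpow]
  congr 1
  ring

lemma norm_e (x : ℂ) : ‖e x‖ = Real.exp (-(2 * Real.pi * x.im)) := by
  rw [e, Complex.norm_exp]
  congr 1
  simp

@[fun_prop]
lemma differentiable_e : Differentiable ℂ e := by
  unfold e
  fun_prop

@[fun_prop]
lemma Differentiable.e_comp {f : ℂ → ℂ} (hf : Differentiable ℂ f) :
    Differentiable ℂ fun z => e (f z) := differentiable_e.comp hf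

@[fun_prop]
lemma continuous_e : Continuous e := differentiable_e.continuous

/-! ### Sums over residue classes -/

lemma tsum_int_eq_sum_range {f : ℤ → ℂ} (hf : Summable f) {N : ℕ} (hN : N ≠ 0) :
    ∑' n : ℤ, f n = ∑ r ∈ Finset.range N, ∑' m : ℤ, f (N * m + r) := by
  have : NeZero N := ⟨hN⟩
  have h1 : Summable fun p : ℤ × Fin N => f ((Int.divModEquiv N).symm p) :=
    (Int.divModEquiv N).symm.summable_iff.mpr hf
  rw [← (Int.divModEquiv N).symm.tsum_eq f, ← (Equiv.prodComm (Fin N) ℤ).tsum_eq]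
  rw [Summable.tsum_prod (f := fun p : Fin N × ℤ => f ((Int.divModEquiv N).symm
    ((Equiv.prodComm (Fin N) ℤ) p)))
    ((Equiv.prodComm (Fin N) ℤ).summable_iff.mpr h1), tsum_fintype, Finset.sum_range]
  refine Finset.sum_congr rfl fun r _ => tsum_congr fun m => ?_
  simp [Int.divModEquiv_symm_apply, mul_comm]

/-! ### Theta functions of level `k` -/

/-- The summand `q^{t²/4k} y^t` of the theta functions of level `k`. -/
noncomputable def thetaTerm (k : ℕ) (t : ℤ) (τ z : ℂ) : ℂ :=
  e ((t : ℂ) ^ 2 / (4 * k) * τ + t * z)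

lemma thetaTerm_eq {k : ℕ} (hk : k ≠ 0) (t : ℤ) (τ z : ℂ) :
    thetaTerm k t τ z = jacobiTheta₂_term t z (τ / (2 * k)) := by
  have : (k : ℂ) ≠ 0 := by exact_mod_cast hk
  rw [thetaTerm, e, jacobiTheta₂_term]
  congr 1
  field_simp
  ring

lemma summable_thetaTerm {k : ℕ} (hk : k ≠ 0) {τ : ℂ} (hτ : 0 < τ.im) (z : ℂ) :
    Summable fun t : ℤ => thetaTerm k t τ z := by
  simp only [thetaTerm_eq hk]
  rw [summable_jacobiTheta₂_term_iff]
  have : τ / (2 * k) = τ * ((1 / (2 * k) : ℝ) : ℂ) := by push_cast; ring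
  rw [this, Complex.im_mul_ofReal]
  have : (0 : ℝ) < k := by exact_mod_cast Nat.pos_of_ne_zero hk
  positivity

lemma vartheta_eq_tsum (k : ℕ) (r : ℤ) (τ z : ℂ) :
    vartheta k r τ z = ∑' m : ℤ, thetaTerm k (2 * k * m + r) τ z := by
  refine tsum_congr fun m => ?_
  rw [thetaTerm, e_add]
  push_cast
  rfl

/-- Expanding the square of 2km + r isolates the m-independent factor. Differentiability and the
modular transformation are then inherited from `jacobiTheta₂`. -/
lemma vartheta_eq_jacobi {k : ℕ} (hk : k ≠ 0) (r : ℤ) (τ z : ℂ) :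
    vartheta k r τ z = e ((r : ℂ) ^ 2 / (4 * k) * τ + r * z) *
      jacobiTheta₂ (r * τ + 2 * k * z) (2 * k * τ) := by
  have : (k : ℂ) ≠ 0 := by exact_mod_cast hk
  rw [vartheta_eq_tsum, jacobiTheta₂, ← tsum_mul_left]
  refine tsum_congr fun m => ?_
  have : jacobiTheta₂_term m (r * τ + 2 * k * z) (2 * k * τ) =
      e (m * (r * τ + 2 * k * z) + m ^ 2 * (k * τ)) := by
    rw [jacobiTheta₂_term, e]
    congr 1
    ring
  rw [this, thetaTerm, ← e_add]
  congr 1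
  push_cast
  field_simp
  ring

lemma im_two_mul_nat_mul {k : ℕ} (hk : k ≠ 0) {τ : ℂ} (hτ : 0 < τ.im) :
    0 < (2 * k * τ).im := by
  have h : (2 * k * τ) = ((2 * k : ℝ) : ℂ) * τ := by push_cast; ring
  have : (0 : ℝ) < k := by exact_mod_cast Nat.pos_of_ne_zero hk
  rw [h, Complex.im_ofReal_mul]
  positivity

lemma differentiable_vartheta {k : ℕ} (hk : k ≠ 0) (r : ℤ) {τ : ℂ} (hτ : 0 < τ.im) :
    Differentiable ℂ (vartheta k r τ) := by
  have h1 : vartheta k r τ = fun z => e ((r : ℂ) ^ 2 / (4 * k) * τ + r * z) *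
      jacobiTheta₂ (r * τ + 2 * k * z) (2 * k * τ) := funext fun z => vartheta_eq_jacobi hk r τ z
  have h2 : Differentiable ℂ fun z => jacobiTheta₂ z (2 * k * τ) := fun z =>
    differentiableAt_jacobiTheta₂_fst z (im_two_mul_nat_mul hk hτ)
  rw [h1]
  refine Differentiable.mul (by fun_prop) ?_
  exact h2.comp (f := fun z => r * τ + 2 * k * z) (by fun_prop)

lemma vartheta_congr {k : ℕ} {r s : ℤ} (n : ℤ) (h : r = s + 2 * k * n) (τ z : ℂ) :
    vartheta k r τ z = vartheta k s τ z := by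
  rw [vartheta_eq_tsum, vartheta_eq_tsum, ← (Equiv.addRight n).tsum_eq (fun m : ℤ =>
    thetaTerm k (2 * k * m + s) τ z)]
  refine tsum_congr fun m => ?_
  congr 1
  simp only [Equiv.coe_addRight, h]
  ring

lemma vartheta_neg (k : ℕ) (r : ℤ) (τ z : ℂ) :
    vartheta k r τ (-z) = vartheta k (-r) τ z := by
  rw [vartheta_eq_tsum, vartheta_eq_tsum, ← (Equiv.neg ℤ).tsum_eq]
  refine tsum_congr fun m => ?_
  simp only [thetaTerm, Equiv.neg_apply]
  congr 1
  push_cast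
  ring

lemma vartheta_add_half {k : ℕ} (r : ℤ) (τ z : ℂ) :
    vartheta k r τ (z + 1 / 2) = (-1) ^ r * vartheta k r τ z := by
  rw [vartheta_eq_tsum, vartheta_eq_tsum, ← tsum_mul_left]
  refine tsum_congr fun m => ?_
  rw [thetaTerm, thetaTerm, ← e_int_half, ← e_add]
  refine e_eq_of_eq_add_int (k * m) ?_
  push_cast
  ring

/-- Completing the square in t²/4k + t/2 replaces t by t + k, hence the residue r by r + k. -/
lemma vartheta_add_half_period {k : ℕ} (hk : k ≠ 0) (r : ℤ) (τ z : ℂ) :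
    vartheta k r τ (z + τ / 2) = e (-(k / 4 * τ) - k * z) * vartheta k (r + k) τ z := by
  have : (k : ℂ) ≠ 0 := by exact_mod_cast hk
  rw [vartheta_eq_tsum, vartheta_eq_tsum, ← tsum_mul_left]
  refine tsum_congr fun m => ?_
  rw [thetaTerm, thetaTerm, ← e_add]
  congr 1
  push_cast
  field_simp
  ring

lemma varthetaHat_neg (k : ℕ) (r : ℤ) (τ z : ℂ) :
    varthetaHat k r τ (-z) = -varthetaHat k r τ z := by
  simp [varthetaHat, vartheta_neg]

lemma varthetaHat_add_half (k : ℕ) (r : ℤ) (τ z : ℂ) :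
    varthetaHat k r τ (z + 1 / 2) = (-1) ^ r * varthetaHat k r τ z := by
  simp only [varthetaHat, vartheta_add_half, zpow_neg, ← inv_zpow, inv_neg_one]
  ring

/-- Modulo 2k one has r + k ≡ -(k - r). This is the origin of the reflection of labels in the period
shifts of the affine characters. -/
lemma varthetaHat_add_half_period {k : ℕ} (hk : k ≠ 0) (r : ℤ) (τ z : ℂ) :
    varthetaHat k r τ (z + τ / 2) =
      -e (-(k / 4 * τ) - k * z) * varthetaHat k (k - r) τ z := by
  rw [varthetaHat, varthetaHat, vartheta_add_half_period hk, vartheta_add_half_period hk,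
    vartheta_congr (k := k) (r := r + k) (s := -(k - r)) 1 (by ring),
    show -r + (k : ℤ) = k - r by ring]
  ring

lemma differentiable_varthetaHat {k : ℕ} (hk : k ≠ 0) (r : ℤ) {τ : ℂ} (hτ : 0 < τ.im) :
    Differentiable ℂ (varthetaHat k r τ) :=
  (differentiable_vartheta hk r hτ).sub (differentiable_vartheta hk (-r) hτ)

/-- A theta function with coefficients periodic modulo `2k`, as a combination of the `ϑ_{k,r}`. -/
lemma sum_mul_vartheta {k : ℕ} (hk : k ≠ 0) {τ : ℂ} (hτ : 0 < τ.im) (c : ZMod (2 * k) → ℂ)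
    (z : ℂ) :
    (∑ r ∈ Finset.range (2 * k), c (r : ZMod (2 * k)) * vartheta k (r : ℤ) τ z) =
      ∑' t : ℤ, c (t : ZMod (2 * k)) * thetaTerm k t τ z := by
  have : NeZero (2 * k) := ⟨by positivity⟩
  obtain ⟨M, hM⟩ : ∃ M, ∀ a, ‖c a‖ ≤ M :=
    ⟨∑ a, ‖c a‖, fun a => Finset.single_le_sum (f := fun a => ‖c a‖)
      (fun _ _ => norm_nonneg _) (Finset.mem_univ a)⟩
  have hs : Summable fun t : ℤ => c (t : ZMod (2 * k)) * thetaTerm k t τ z := by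
    refine Summable.of_norm_bounded ((summable_thetaTerm hk hτ z).norm.mul_left M) fun t => ?_
    rw [norm_mul]
    gcongr
    exact hM _
  rw [tsum_int_eq_sum_range hs (N := 2 * k) (by positivity)]
  refine Finset.sum_congr rfl fun r _ => ?_
  rw [vartheta_eq_tsum, ← tsum_mul_left]
  refine tsum_congr fun m => ?_
  have : (((2 * k : ℕ) * m + r : ℤ) : ZMod (2 * k)) = (r : ZMod (2 * k)) := by
    push_cast
    have h0 : (2 * k : ZMod (2 * k)) = 0 := by exact_mod_cast ZMod.natCast_self (2 * k)
    rw [h0]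
    ring
  rw [this]
  push_cast
  rfl

/-! ### The function `θ₁₁` -/

lemma theta11_eq_tsum (τ z : ℂ) :
    theta11 τ z = ∑' n : ℤ, e (1 / 4 + n / 2) * thetaTerm 2 (2 * n + 1) τ (z / 2) := by
  rw [theta11]
  refine tsum_congr fun n => ?_
  rw [thetaTerm, ← e_add, ← e_add]
  congr 1
  push_cast
  ring

lemma summable_theta11 {τ : ℂ} (hτ : 0 < τ.im) (z : ℂ) :
    Summable fun n : ℤ => e (1 / 4 + n / 2) * thetaTerm 2 (2 * n + 1) τ (z / 2) := by
  have hs : Summable fun n : ℤ => ‖thetaTerm 2 (2 * n + 1) τ (z / 2)‖ := by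
    refine (summable_thetaTerm two_ne_zero hτ (z / 2)).norm.comp_injective
      (i := fun n : ℤ => 2 * n + 1) fun a b h => ?_
    simpa using h
  refine Summable.of_norm_bounded hs fun n => ?_
  have : ‖e (1 / 4 + n / 2)‖ = 1 := by
    rw [norm_e, show (1 / 4 + n / 2 : ℂ) = ((1 / 4 + n / 2 : ℝ) : ℂ) by push_cast; ring,
      Complex.ofReal_im]
    simp
  rw [norm_mul, this, one_mul]

lemma e_quarter : e (1 / 4) = I := by
  rw [e, show 2 * Real.pi * I * (1 / 4) = Real.pi / 2 * I by ring, Complex.exp_pi_div_two_mul_I]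

/-- The phase e(1/4 + n/2) is i for even n and -i for odd n, while 2n + 1 is then 1 or 3 ≡ -1 modulo
4. -/
lemma theta11_eq_varthetaHat {τ : ℂ} (hτ : 0 < τ.im) (z : ℂ) :
    theta11 τ z = I * varthetaHat 2 1 τ (z / 2) := by
  have h3 : vartheta 2 (-1) τ (z / 2) = vartheta 2 3 τ (z / 2) :=
    vartheta_congr (-1) (by norm_num) _ _
  rw [theta11_eq_tsum, tsum_int_eq_sum_range (summable_theta11 hτ z) two_ne_zero, varthetaHat, h3,
    vartheta_eq_tsum, vartheta_eq_tsum, mul_sub, ← tsum_mul_left, ← tsum_mul_left,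
    Finset.sum_range_succ, Finset.sum_range_one, sub_eq_add_neg, ← tsum_neg]
  congr 1
  · refine tsum_congr fun m => ?_
    congr 1
    · rw [← e_quarter]
      refine e_eq_of_eq_add_int m ?_
      push_cast
      ring
    · congr 1
      push_cast
      ring
  · refine tsum_congr fun m => ?_
    rw [← neg_mul]
    congr 1
    · rw [← e_quarter, ← neg_one_mul, ← e_half, ← e_add]
      refine e_eq_of_eq_add_int m ?_
      push_cast
      ring
    · congr 1
      push_cast
      ring

lemma theta11_eq_jacobi (τ z : ℂ) :
    theta11 τ z = e (τ / 8 + z / 2 + 1 / 4) * jacobiTheta₂ (z + τ / 2 + 1 / 2) τ := by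
  rw [theta11, jacobiTheta₂, ← tsum_mul_left]
  refine tsum_congr fun m => ?_
  have : jacobiTheta₂_term m (z + τ / 2 + 1 / 2) τ =
      e (m * (z + τ / 2 + 1 / 2) + m ^ 2 * τ / 2) := by
    rw [jacobiTheta₂_term, e]
    congr 1
    ring
  rw [this, ← e_add, ← e_add]
  congr 1
  ring

lemma differentiable_theta11 {τ : ℂ} (hτ : 0 < τ.im) : Differentiable ℂ (theta11 τ) := by
  rw [show theta11 τ = fun z => I * varthetaHat 2 1 τ (z / 2) from
    funext (theta11_eq_varthetaHat hτ)]
  exact ((differentiable_varthetaHat two_ne_zero 1 hτ).comp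
    (f := fun z : ℂ => z / 2) (by fun_prop)).const_mul I

lemma theta11_add_one {τ : ℂ} (hτ : 0 < τ.im) (z : ℂ) : theta11 τ (z + 1) = -theta11 τ z := by
  rw [theta11_eq_varthetaHat hτ, theta11_eq_varthetaHat hτ, add_div, varthetaHat_add_half]
  ring

lemma theta11_add_period {τ : ℂ} (hτ : 0 < τ.im) (z : ℂ) :
    theta11 τ (z + τ) = -e (-(τ / 2) - z) * theta11 τ z := by
  rw [theta11_eq_varthetaHat hτ, theta11_eq_varthetaHat hτ, add_div,
    varthetaHat_add_half_period two_ne_zero]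
  rw [show ((2 : ℕ) : ℤ) - 1 = 1 by norm_num, show (-((2 : ℕ) / 4 * τ) - (2 : ℕ) * (z / 2) : ℂ) =
    -(τ / 2) - z by push_cast; ring]
  ring

lemma theta11_neg {τ : ℂ} (hτ : 0 < τ.im) (z : ℂ) : theta11 τ (-z) = -theta11 τ z := by
  rw [theta11_eq_varthetaHat hτ, theta11_eq_varthetaHat hτ, neg_div, varthetaHat_neg]
  ring

lemma theta11_zero {τ : ℂ} (hτ : 0 < τ.im) : theta11 τ 0 = 0 := by
  have := theta11_neg hτ 0
  rw [neg_zero] at this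
  exact self_eq_neg.mp this

/-! ### Behaviour under `τ ↦ -1/τ` -/

lemma im_neg_one_div_pos {τ : ℂ} (hτ : 0 < τ.im) : 0 < (-1 / τ).im := by
  rw [neg_div, neg_im, one_div, inv_im, neg_div, neg_neg]
  exact div_pos hτ (normSq_pos.mpr fun h => by simp [h] at hτ)

/-- A positive real factor leaves the argument unchanged, so it can be taken out of the principal
square root. -/
lemma sqrt_neg_I_mul {k : ℕ} (hk : k ≠ 0) (τ : ℂ) :
    (-I * (2 * k * τ)) ^ (1 / 2 : ℂ) = ((Real.sqrt (2 * k) : ℝ) : ℂ) * (-I * τ) ^ (1 / 2 : ℂ) := by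
  have h : -I * (2 * k * τ) = ((2 * k : ℝ) : ℂ) * (-I * τ) := by push_cast; ring
  rcases eq_or_ne τ 0 with rfl | hτ
  · simp
  have hk' : (0 : ℝ) < 2 * k := by
    have : (0 : ℝ) < k := by exact_mod_cast Nat.pos_of_ne_zero hk
    positivity
  have h2 : -I * τ ≠ 0 := mul_ne_zero (neg_ne_zero.mpr I_ne_zero) hτ
  rw [h, cpow_def_of_ne_zero (mul_ne_zero (by exact_mod_cast hk'.ne') h2),
    cpow_def_of_ne_zero h2, Complex.log_ofReal_mul hk' h2, add_mul, Complex.exp_add,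
    Real.sqrt_eq_rpow, Complex.ofReal_cpow hk'.le, cpow_def_of_ne_zero (by exact_mod_cast hk'.ne'),
    Complex.ofReal_log hk'.le]
  norm_num

/-- The modular `S`-transformation of the theta functions of level `k`. -/
lemma vartheta_S {k : ℕ} (hk : k ≠ 0) (r : ℤ) {τ : ℂ} (hτ : 0 < τ.im) (z : ℂ) :
    vartheta k r τ z = 1 / (-I * (2 * k * τ)) ^ (1 / 2 : ℂ) * e (-(k * z ^ 2 / τ)) *
      ∑ s ∈ Finset.range (2 * k), e (r * s / (2 * k)) * vartheta k (s : ℤ) (-1 / τ) (z / τ) := by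
  have hk' : (k : ℂ) ≠ 0 := by exact_mod_cast hk
  have hτ0 : τ ≠ 0 := fun h => by simp [h] at hτ
  have hτ' := im_neg_one_div_pos hτ
  rw [vartheta_eq_jacobi hk, jacobiTheta₂_functional_equation]
  -- The dual summand of index t is a level-k term at -1/τ with phase e(rt/2k); this phase depends
  -- only on t modulo 2k.
  have h1 : jacobiTheta₂ ((r * τ + 2 * k * z) / (2 * k * τ)) (-1 / (2 * k * τ)) =
      ∑' t : ℤ, e (r * t / (2 * k)) * thetaTerm k t (-1 / τ) (z / τ) := by
    rw [jacobiTheta₂]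
    refine tsum_congr fun t => ?_
    rw [thetaTerm, ← e_add, jacobiTheta₂_term, e]
    congr 1
    field_simp
    ring
  have hs : Summable fun t : ℤ => e (r * t / (2 * k)) * thetaTerm k t (-1 / τ) (z / τ) := by
    refine Summable.of_norm ?_
    simp only [norm_mul]
    have : ∀ t : ℤ, ‖e (r * t / (2 * k))‖ = 1 := fun t => by
      rw [norm_e, show (r * t / (2 * k) : ℂ) = ((r * t / (2 * k) : ℝ) : ℂ) by push_cast; ring,
        Complex.ofReal_im]
      simp
    simpa only [this, one_mul] using (summable_thetaTerm hk hτ' (z / τ)).norm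
  rw [h1, tsum_int_eq_sum_range hs (N := 2 * k) (by positivity)]
  have h2 : ∀ s ∈ Finset.range (2 * k), (∑' m : ℤ, e (r * ((2 * k : ℕ) * m + s : ℤ) / (2 * k)) *
      thetaTerm k ((2 * k : ℕ) * m + s) (-1 / τ) (z / τ)) =
      e (r * s / (2 * k)) * vartheta k (s : ℤ) (-1 / τ) (z / τ) := by
    intro s _
    rw [vartheta_eq_tsum, ← tsum_mul_left]
    refine tsum_congr fun m => ?_
    congr 1
    refine e_eq_of_eq_add_int (r * m) ?_
    push_cast
    field_simp
    ring
  rw [Finset.sum_congr rfl h2]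
  have h3 : e ((r : ℂ) ^ 2 / (4 * k) * τ + r * z) *
      cexp (-Real.pi * I * (r * τ + 2 * k * z) ^ 2 / (2 * k * τ)) = e (-(k * z ^ 2 / τ)) := by
    rw [show cexp (-Real.pi * I * (r * τ + 2 * k * z) ^ 2 / (2 * k * τ)) =
      e (-((r * τ + 2 * k * z) ^ 2 / (4 * k * τ))) by
        rw [e]; congr 1; field_simp; ring, ← e_add]
    congr 1
    field_simp
    ring
  rw [← h3]
  ring

lemma sum_Icc_int_eq_sum_range {M : Type*} [AddCommMonoid M] (n : ℕ) (f : ℤ → M) :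
    ∑ s ∈ Finset.Icc (1 : ℤ) n, f s = ∑ i ∈ Finset.range n, f (i + 1) := by
  induction n with
  | zero => simp
  | succ n ih =>
    rw [Finset.sum_range_succ, ← ih]
    have : Finset.Icc (1 : ℤ) ((n + 1 : ℕ) : ℤ) = insert ((n : ℤ) + 1) (Finset.Icc (1 : ℤ) n) := by
      ext x
      simp only [Finset.mem_Icc, Finset.mem_insert]
      push_cast
      omega
    rw [this, Finset.sum_insert (by simp), add_comm]

/-- The involution s ↦ 2k - s on ℤ/2k fixes only 0 and k. In the application the sine vanishes at
both. -/
lemma sum_range_two_mul_eq_sum_pairs {M : Type*} [AddCommMonoid M] {k : ℕ} (hk : k ≠ 0)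
    (g : ℤ → M) (h0 : g 0 = 0) (h1 : g k = 0) :
    ∑ s ∈ Finset.range (2 * k), g (s : ℤ) =
      ∑ s ∈ Finset.Icc (1 : ℤ) (k - 1), (g s + g (2 * k - s)) := by
  obtain ⟨n, rfl⟩ := Nat.exists_eq_succ_of_ne_zero hk
  rw [show ((n.succ : ℕ) : ℤ) - 1 = n by push_cast; ring, sum_Icc_int_eq_sum_range, two_mul,
    Finset.sum_range_add, Nat.succ_eq_add_one, Finset.sum_range_succ', Finset.sum_range_succ',
    Finset.sum_add_distrib]
  have h2 : g ((0 : ℕ) : ℤ) = 0 := by simpa using h0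
  have h3 : g ((n + 1 + 0 : ℕ) : ℤ) = 0 := by simpa using h1
  rw [h2, h3, add_zero, add_zero]
  congr 1
  rw [← Finset.sum_range_reflect]
  refine Finset.sum_congr rfl fun i hi => ?_
  rw [Finset.mem_range] at hi
  congr 1
  omega

lemma e_sub_e_neg (x : ℝ) : e (x / 2) - e (-(x / 2)) = 2 * I * (Real.sin (Real.pi * x) : ℝ) := by
  rw [Complex.ofReal_sin, Complex.sin, e, e,
    show 2 * Real.pi * I * ((x : ℂ) / 2) = ((Real.pi * x : ℝ) : ℂ) * I by push_cast; ring,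
    show 2 * Real.pi * I * (-((x : ℂ) / 2)) = -((Real.pi * x : ℝ) : ℂ) * I by push_cast; ring]
  linear_combination (-(cexp (-((Real.pi * x : ℝ) : ℂ) * I) - cexp (((Real.pi * x : ℝ) : ℂ) * I)))
    * I_sq

/-- The modular `S`-transformation of the antisymmetrised theta functions. -/
lemma varthetaHat_S {k : ℕ} (hk : k ≠ 0) (r : ℤ) {τ : ℂ} (hτ : 0 < τ.im) (z : ℂ) :
    varthetaHat k r τ z = 2 * I / (-I * (2 * k * τ)) ^ (1 / 2 : ℂ) * e (-(k * z ^ 2 / τ)) *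
      ∑ s ∈ Finset.Icc (1 : ℤ) (k - 1), (Real.sin (Real.pi * r * s / k) : ℝ) *
        varthetaHat k s (-1 / τ) (z / τ) := by
  have hk' : (k : ℂ) ≠ 0 := by exact_mod_cast hk
  have hkr : (k : ℝ) ≠ 0 := by exact_mod_cast hk
  have key : (∑ s ∈ Finset.range (2 * k), e (r * s / (2 * k)) * vartheta k (s : ℤ) (-1 / τ) (z / τ))
      - (∑ s ∈ Finset.range (2 * k), e ((-r : ℤ) * s / (2 * k)) *
        vartheta k (s : ℤ) (-1 / τ) (z / τ)) = 2 * I *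
      ∑ s ∈ Finset.Icc (1 : ℤ) (k - 1), (Real.sin (Real.pi * r * s / k) : ℝ) *
        varthetaHat k s (-1 / τ) (z / τ) := by
    set g : ℤ → ℂ := fun s => 2 * I * ((Real.sin (Real.pi * r * s / k) : ℝ) *
      vartheta k s (-1 / τ) (z / τ)) with hgdef
    have hg : ∀ s : ℕ, e (r * s / (2 * k)) * vartheta k (s : ℤ) (-1 / τ) (z / τ) -
        e ((-r : ℤ) * s / (2 * k)) * vartheta k (s : ℤ) (-1 / τ) (z / τ) =
        g s := by
      intro s
      have := e_sub_e_neg (r * s / k)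
      rw [show Real.pi * (r * s / k) = Real.pi * r * s / k by ring] at this
      simp only [hgdef, Int.cast_natCast]
      rw [← mul_assoc, ← this, ← sub_mul]
      congr 2
      · congr 1
        push_cast
        field_simp
      · congr 1
        push_cast
        field_simp
    rw [← Finset.sum_sub_distrib, Finset.sum_congr rfl fun s _ => hg s,
      sum_range_two_mul_eq_sum_pairs hk g (by simp [hgdef]) ?_, Finset.mul_sum]
    · refine Finset.sum_congr rfl fun s _ => ?_
      have h1 : Real.sin (Real.pi * r * ((2 * k - s : ℤ) : ℝ) / k) =
          -Real.sin (Real.pi * r * s / k) := by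
        rw [show Real.pi * r * ((2 * k - s : ℤ) : ℝ) / k =
          r * (2 * Real.pi) - Real.pi * r * s / k by push_cast; field_simp, Real.sin_int_mul_two_pi_sub]
      have h2 : vartheta k (2 * k - s) (-1 / τ) (z / τ) = vartheta k (-s) (-1 / τ) (z / τ) :=
        vartheta_congr 1 (by ring) _ _
      simp only [hgdef]
      rw [h1, h2, varthetaHat]
      push_cast
      ring
    · have : Real.sin (Real.pi * r * ((k : ℤ) : ℝ) / k) = 0 := by
        rw [show Real.pi * r * ((k : ℤ) : ℝ) / k = r * Real.pi by push_cast; field_simp,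
          Real.sin_int_mul_pi]
      simp only [hgdef, this, Complex.ofReal_zero, zero_mul, mul_zero]
  rw [varthetaHat, vartheta_S hk r hτ, vartheta_S hk (-r) hτ, ← mul_sub, key]
  ring

/-! ### Fourier expansion of entire periodic functions -/

/-- A Fourier series that converges absolutely at every point of the plane is entire. -/
lemma differentiable_tsum_mul_e {a : ℤ → ℂ} (ha : ∀ z, Summable fun n : ℤ => a n * e (n * z)) :
    Differentiable ℂ fun z => ∑' n : ℤ, a n * e (n * z) := by
  intro z₀
  -- On the strip |Im z| < M, |e(nz)| is monotone in Im z, hence at most the sum of its values at iM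
  -- and -iM.
  set M : ℝ := |z₀.im| + 1
  have hb : Summable fun n : ℤ => ‖a n * e (n * (M * I))‖ + ‖a n * e (n * (-M * I))‖ :=
    (ha _).norm.add (ha _).norm
  have hopen : IsOpen {z : ℂ | |z.im| < M} :=
    isOpen_lt (Complex.continuous_im.abs) continuous_const
  have := differentiableOn_tsum_of_summable_norm (F := fun (n : ℤ) z => a n * e (n * z)) hb
    (U := {z : ℂ | |z.im| < M}) (fun n => by fun_prop) hopen ?_
  · exact this.differentiableAt (hopen.mem_nhds (by simp [M]))
  · intro n z hz
    simp only [Set.mem_ofPred_eq, abs_lt] at hz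
    simp only [norm_mul, norm_e]
    rw [← mul_add]
    refine mul_le_mul_of_nonneg_left ?_ (norm_nonneg _)
    have hp := Real.pi_pos
    have him : ((n : ℂ) * z).im = n * z.im := by simp
    have him1 : ((n : ℂ) * (M * I)).im = n * M := by simp
    have him2 : ((n : ℂ) * (-M * I)).im = -(n * M) := by simp
    rw [him, him1, him2]
    rcases le_total 0 (n : ℝ) with hn | hn
    · have : Real.exp (-(2 * Real.pi * (n * z.im))) ≤ Real.exp (-(2 * Real.pi * -(n * M))) := by
        rw [Real.exp_le_exp]
        linarith [mul_le_mul_of_nonneg_left (mul_le_mul_of_nonneg_left hz.1.le hn) hp.le]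
      linarith [Real.exp_pos (-(2 * Real.pi * (n * M)))]
    · have : Real.exp (-(2 * Real.pi * (n * z.im))) ≤ Real.exp (-(2 * Real.pi * (n * M))) := by
        rw [Real.exp_le_exp]
        linarith [mul_le_mul_of_nonneg_left (mul_le_mul_of_nonpos_left hz.2.le hn) hp.le]
      linarith [Real.exp_pos (-(2 * Real.pi * -(n * M)))]

/-- Entire functions that agree on the real line are equal. -/
lemma eq_of_eq_on_real {F G : ℂ → ℂ} (hF : Differentiable ℂ F) (hG : Differentiable ℂ G)
    (h : ∀ x : ℝ, F x = G x) : F = G := by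
  refine AnalyticOnNhd.eq_of_frequently_eq (𝕜 := ℂ) (z₀ := 0)
    (fun z _ => hF.analyticAt z) (fun z _ => hG.analyticAt z) ?_
  have h1 : Tendsto (fun n : ℕ => ((1 / ((n : ℝ) + 1) : ℝ) : ℂ)) atTop (𝓝[≠] 0) := by
    refine tendsto_nhdsWithin_iff.mpr ⟨?_, Eventually.of_forall fun n => ?_⟩
    · simpa [Function.comp_def] using (Complex.continuous_ofReal.tendsto 0).comp
        (tendsto_one_div_add_atTop_nhds_zero_nat (𝕜 := ℝ))
    · have : (1 / ((n : ℝ) + 1)) ≠ 0 := by positivity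
      exact Complex.ofReal_ne_zero.mpr this
  exact h1.frequently (Frequently.of_forall fun n => h _)

/-- The `n`-th Fourier coefficient of a function of period `1`. -/
noncomputable def fourierInt (F : ℂ → ℂ) (n : ℤ) : ℂ :=
  ∫ x in (0 : ℝ)..1, F x * e (-(n * x))

/-- Cauchy's theorem on a rectangle of width 1: the vertical sides cancel by periodicity. The real
part of σ is absorbed by periodicity on the line. -/
lemma integral_shift_eq {G : ℂ → ℂ} (hG : Differentiable ℂ G) (hper : ∀ z, G (z + 1) = G z)
    (σ : ℂ) : ∫ x in (0 : ℝ)..1, G (x + σ) = ∫ x in (0 : ℝ)..1, G x := by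
  have h1 := Complex.integral_boundary_rect_eq_zero_of_differentiableOn G (σ.re : ℂ) (1 + σ)
    hG.differentiableOn
  simp only [Complex.ofReal_re, Complex.ofReal_im, Complex.add_re, Complex.one_re, Complex.add_im,
    Complex.one_im, zero_add, Complex.ofReal_zero, zero_mul, add_zero] at h1
  have h2 : ∀ y : ℝ, G (((1 + σ.re : ℝ) : ℂ) + y * I) = G (σ.re + y * I) := by
    intro y
    rw [← hper (σ.re + y * I)]
    congr 1
    push_cast
    ring
  simp only [h2, add_sub_cancel_right] at h1
  have hp : Function.Periodic (fun x : ℝ => G x) 1 := fun x => by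
    simpa using hper x
  have h3 : ∫ x in σ.re..(1 + σ.re), G x = ∫ x in (0 : ℝ)..1, G x := by
    have := hp.intervalIntegral_add_eq σ.re 0
    rw [zero_add, add_comm] at this
    exact this
  have h4 : ∫ x in σ.re..(1 + σ.re), G (x + σ.im * I) = ∫ x in (0 : ℝ)..1, G (x + σ) := by
    have := intervalIntegral.integral_comp_add_right (a := 0) (b := 1)
      (fun x : ℝ => G (x + σ.im * I)) σ.re
    rw [zero_add] at this
    rw [← this]
    refine intervalIntegral.integral_congr fun x _ => ?_
    congr 1
    apply Complex.ext <;> simp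
  rw [← h3, ← h4]
  exact (sub_eq_zero.mp h1).symm

/-- Allows a transformation law under a non-real translation to be read off on Fourier coefficients.
-/
lemma fourierInt_shift {F : ℂ → ℂ} (hF : Differentiable ℂ F) (hper : ∀ z, F (z + 1) = F z)
    (σ : ℂ) (n : ℤ) :
    ∫ x in (0 : ℝ)..1, F (x + σ) * e (-(n * (x + σ))) = fourierInt F n := by
  refine integral_shift_eq (G := fun z => F z * e (-(n * z))) (by fun_prop) (fun z => ?_) σ
  rw [hper, show -(n * (z + 1)) = -(n * z) + ((-n : ℤ) : ℂ) by push_cast; ring, e_add, e_intCast,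
    mul_one]

lemma eq_tsum_fourierInt_real {F : ℂ → ℂ} (hF : Differentiable ℂ F)
    (hper : ∀ z, F (z + 1) = F z) (hs : Summable (fourierInt F)) (x : ℝ) :
    F x = ∑' n : ℤ, fourierInt F n * e (n * x) := by
  have : Fact ((0 : ℝ) < 1) := ⟨one_pos⟩
  have hp : Function.Periodic (fun x : ℝ => F x) 1 := fun x => by simpa using hper x
  let f : C(AddCircle (1 : ℝ), ℂ) := ⟨hp.lift, continuous_coinduced_dom.mpr
    (hF.continuous.comp Complex.continuous_ofReal)⟩
  have hf : ∀ x : ℝ, f (x : AddCircle (1 : ℝ)) = F x := fun x => rfl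
  have hc : ∀ n, fourierCoeff f n = fourierInt F n := by
    intro n
    rw [fourierCoeff_eq_intervalIntegral _ _ 0, fourierInt, zero_add, div_one, one_smul]
    refine intervalIntegral.integral_congr fun x _ => ?_
    simp only [hf]
    rw [fourier_coe_apply, smul_eq_mul, mul_comm, e]
    congr 2
    push_cast
    ring
  have h := has_pointwise_sum_fourier_series_of_summable (f := f)
    (by simpa only [show fourierCoeff f = fourierInt F from funext hc] using hs) x
  rw [hf] at h
  rw [← h.tsum_eq]
  refine tsum_congr fun n => ?_
  rw [hc, fourier_coe_apply, smul_eq_mul, e]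
  congr 2
  push_cast
  ring

lemma integral_e_int (n : ℤ) : ∫ x in (0 : ℝ)..1, e (n * x) = if n = 0 then 1 else 0 := by
  split_ifs with h
  · simp [h]
  · have hn : (2 * Real.pi * I * n : ℂ) ≠ 0 :=
      mul_ne_zero Complex.two_pi_I_ne_zero (by exact_mod_cast h)
    have : ∀ x : ℝ, e (n * x) = cexp (2 * Real.pi * I * n * x) := fun x => by
      rw [e]; congr 1; ring
    simp only [this]
    rw [integral_exp_mul_complex hn, Complex.ofReal_one, Complex.ofReal_zero, mul_one, mul_zero,
      Complex.exp_zero, mul_comm, Complex.exp_int_mul_two_pi_mul_I, sub_self, zero_div]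

/-- Fourier coefficients are determined by the function. -/
lemma fourierInt_tsum {a : ℤ → ℂ} (ha : Summable a) (n : ℤ) :
    fourierInt (fun z => ∑' m : ℤ, a m * e (m * z)) n = a n := by
  have hnorm : ∀ (m : ℤ) (x : ℝ), ‖e (m * x)‖ = 1 := fun m x => by
    rw [norm_e, show (m * x : ℂ) = ((m * x : ℝ) : ℂ) by push_cast; ring, Complex.ofReal_im]
    simp
  let f : ℤ → C(ℝ, ℂ) := fun m => ⟨fun x => a m * e (m * x) * e (-(n * x)), by fun_prop⟩
  have h := intervalIntegral.hasSum_intervalIntegral_of_summable_norm (a := 0) (b := 1) (f := f) ?_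
  · have hI : ∀ m, ∫ x in (0 : ℝ)..1, f m x = if m = n then a n else 0 := by
      intro m
      have : ∀ x : ℝ, f m x = a m * e ((m - n : ℤ) * x) := fun x => by
        change a m * e (m * x) * e (-(n * x)) = _
        rw [mul_assoc, ← e_add]
        congr 2
        push_cast
        ring
      simp only [this]
      rw [intervalIntegral.integral_const_mul, integral_e_int]
      simp only [sub_eq_zero]
      split_ifs with hmn
      · rw [hmn, mul_one]
      · rw [mul_zero]
    simp only [hI] at h
    have h2 := h.unique (hasSum_ite_eq n (a n))
    rw [fourierInt, ← h2]
    refine intervalIntegral.integral_congr fun x _ => ?_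
    rw [← tsum_mul_right]
    rfl
  · refine Summable.of_nonneg_of_le (fun _ => norm_nonneg _) (fun m => ?_) ha.norm
    rw [ContinuousMap.norm_le _ (norm_nonneg _)]
    rintro ⟨x, hx⟩
    simp only [f, ContinuousMap.restrict_apply, ContinuousMap.coe_mk, norm_mul]
    have : ‖e (-(n * x))‖ = 1 := by
      have := hnorm (-n) x
      rw [← this]
      congr 2
      push_cast
      ring
    rw [hnorm, this, mul_one, mul_one]

/-- An entire function of period `1` that is multiplied by a constant `β` under `z ↦ z + σ`
vanishes, unless `β` is an integral power of `e(σ)`. -/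
lemma eq_zero_of_quasiperiodic {F : ℂ → ℂ} (hF : Differentiable ℂ F)
    (hper : ∀ z, F (z + 1) = F z) {σ β : ℂ} (hσ : ∀ z, F (z + σ) = β * F z)
    (hβ : ∀ n : ℤ, β ≠ e (n * σ)) (z : ℂ) : F z = 0 := by
  have h0 : ∀ n, fourierInt F n = 0 := by
    intro n
    have h1 := fourierInt_shift hF hper σ n
    have h2 : ∀ x : ℝ, F (x + σ) * e (-(n * (x + σ))) =
        β * e (-(n * σ)) * (F x * e (-(n * x))) := fun x => by
      rw [hσ, show -(n * (x + σ)) = -(n * σ) + -(n * x) by ring, e_add]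
      ring
    simp only [h2] at h1
    rw [intervalIntegral.integral_const_mul, ← fourierInt] at h1
    by_contra h3
    have h4 : β * e (-(n * σ)) = 1 := mul_right_cancel₀ h3 (by rw [h1, one_mul])
    refine hβ n ?_
    rw [e_neg, ← div_eq_mul_inv, div_eq_one_iff_eq (e_ne_zero _)] at h4
    exact h4
  have h1 : F = fun _ => 0 := by
    refine eq_of_eq_on_real hF (differentiable_const 0) fun x => ?_
    rw [eq_tsum_fourierInt_real hF hper (by
      rw [show fourierInt F = fun _ => 0 from funext h0]
      exact summable_zero)]
    simp [h0]
  rw [h1]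

/-- Expansion of the entire functions with the quasi-periodicity of a theta function of index
`m / 2`. -/
lemma exists_theta_expansion {F : ℂ → ℂ} (hF : Differentiable ℂ F)
    (hper : ∀ z, F (z + 1) = F z) {m : ℕ} (hm : m ≠ 0) {τ : ℂ} (hτ : 0 < τ.im)
    (hq : ∀ z, F (z + τ) = e (-(m / 2 * τ) - m * z) * F z) :
    ∃ c : ZMod m → ℂ, ∀ z, F z = ∑' n : ℤ, c n * e ((n : ℂ) ^ 2 / (2 * m) * τ + n * z) := by
  have hm' : (m : ℂ) ≠ 0 := by exact_mod_cast hm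
  have : NeZero m := ⟨hm⟩
  set d := fourierInt F with hd
  -- Removing the factor q^(n²/2m) turns the recursion imposed by the τ-translation into plain
  -- periodicity modulo m.
  set c : ℤ → ℂ := fun n => d n * e (-((n : ℂ) ^ 2 / (2 * m) * τ)) with hc
  have hrec : ∀ n, d n = e (-((m / 2 + n) * τ)) * d (n + m) := by
    intro n
    rw [hd, ← fourierInt_shift hF hper τ n]
    have h2 : ∀ x : ℝ, F (x + τ) * e (-(n * (x + τ))) =
        e (-((m / 2 + n) * τ)) * (F x * e (-((n + m : ℤ) * x))) := fun x => by
      rw [hq, mul_right_comm, ← e_add, mul_left_comm, ← e_add, mul_comm (F x)]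
      congr 2
      push_cast
      ring
    simp only [h2]
    rw [intervalIntegral.integral_const_mul, ← fourierInt]
  have hcper : Function.Periodic c (m : ℤ) := by
    intro n
    simp only [hc]
    rw [hrec n, mul_right_comm, ← e_add, mul_comm]
    congr 2
    push_cast
    field_simp
    ring
  have hcmod : ∀ n : ℤ, c ((n : ZMod m).cast : ℤ) = c n := by
    intro n
    rw [ZMod.coe_intCast]
    conv_rhs => rw [← Int.emod_add_mul_ediv n m]
    rw [mul_comm]
    exact ((hcper.int_mul (n / m)) (n % m)).symm
  refine ⟨fun a => c (a.cast : ℤ), ?_⟩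
  simp only [hcmod]
  have hterm : ∀ (n : ℤ) (z : ℂ), c n * e ((n : ℂ) ^ 2 / (2 * m) * τ + n * z) = d n * e (n * z) :=
    fun n z => by
      simp only [hc]
      rw [mul_assoc, ← e_add]
      congr 2
      ring
  -- The normalised coefficients take finitely many values, so the series is dominated by a theta
  -- series.
  have hsum : ∀ z, Summable fun n : ℤ => d n * e (n * z) := by
    intro z
    obtain ⟨M, hM⟩ : ∃ M, ∀ a : ZMod m, ‖c (a.cast : ℤ)‖ ≤ M :=
      ⟨∑ a : ZMod m, ‖c (a.cast : ℤ)‖, fun a => Finset.single_le_sum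
        (f := fun a : ZMod m => ‖c (a.cast : ℤ)‖) (fun _ _ => norm_nonneg _) (Finset.mem_univ a)⟩
    have hs : Summable fun n : ℤ => jacobiTheta₂_term n z (τ / m) := by
      rw [summable_jacobiTheta₂_term_iff, show τ / m = τ * ((1 / m : ℝ) : ℂ) by push_cast; ring,
        Complex.im_mul_ofReal]
      have : (0 : ℝ) < m := by exact_mod_cast Nat.pos_of_ne_zero hm
      positivity
    refine Summable.of_norm_bounded (hs.norm.mul_left M) fun n => ?_
    rw [← hterm, norm_mul, show e ((n : ℂ) ^ 2 / (2 * m) * τ + n * z) =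
      jacobiTheta₂_term n z (τ / m) by rw [e, jacobiTheta₂_term]; congr 1; field_simp; ring]
    refine mul_le_mul_of_nonneg_right ?_ (norm_nonneg _)
    rw [← hcmod]
    exact hM _
  simp only [hterm]
  intro z
  have hfun := eq_of_eq_on_real hF (differentiable_tsum_mul_e hsum) fun x =>
    eq_tsum_fourierInt_real hF hper (by simpa using hsum 0) x
  exact congrFun hfun z

/-! ### The zeros of `θ₁₁` -/

/-- The product `∏_{n ≥ 0} (1 - q^n y)`. -/
noncomputable def qProd (q y : ℂ) : ℂ := ∏' n : ℕ, (1 + -(q ^ n * y))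

lemma summable_norm_qProd {q : ℂ} (hq : ‖q‖ < 1) (y : ℂ) :
    Summable fun n : ℕ => ‖-(q ^ n * y)‖ := by
  simp only [norm_neg, norm_mul, norm_pow]
  exact (summable_geometric_of_lt_one (norm_nonneg _) hq).mul_right _

lemma differentiable_qProd {q : ℂ} (hq : ‖q‖ < 1) : Differentiable ℂ (qProd q) := by
  intro y₀
  have h := Summable.hasProdLocallyUniformlyOn_nat_one_add (f := fun (n : ℕ) (y : ℂ) => -(q ^ n * y))
    (K := Metric.ball 0 (‖y₀‖ + 1)) (u := fun n => ‖q‖ ^ n * (‖y₀‖ + 1)) Metric.isOpen_ball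
    ((summable_geometric_of_lt_one (norm_nonneg _) hq).mul_right _)
    (Eventually.of_forall fun n y hy => ?_) (fun n => by fun_prop)
  · refine (h.differentiableOn (.of_forall fun _ => ?_) Metric.isOpen_ball).differentiableAt
      (Metric.isOpen_ball.mem_nhds (by simp))
    simpa [Finset.prod_fn] using DifferentiableOn.finsetProd (fun _ _ => by fun_prop)
  · rw [norm_neg, norm_mul, norm_pow]
    have : ‖y‖ < ‖y₀‖ + 1 := by simpa using hy
    gcongr

lemma qProd_eq_mul {q : ℂ} (hq : ‖q‖ < 1) (y : ℂ) : qProd q y = (1 - y) * qProd q (q * y) := by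
  have h : Multipliable fun n : ℕ => 1 + -(q ^ (n + 1) * y) := by
    refine multipliable_one_add_of_summable ?_
    exact (summable_nat_add_iff 1).mpr (summable_norm_qProd hq y)
  have h2 := tprod_eq_zero_mul' (f := fun n : ℕ => 1 + -(q ^ n * y)) h
  have h3 : ∏' n : ℕ, (1 + -(q ^ (n + 1) * y)) = qProd q (q * y) :=
    tprod_congr fun n => by rw [pow_succ, mul_assoc]
  rw [h3, pow_zero, one_mul, ← sub_eq_add_neg] at h2
  exact h2

lemma qProd_ne_zero {q : ℂ} (hq : ‖q‖ < 1) {y : ℂ} (hy : ∀ n : ℕ, q ^ n * y ≠ 1) :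
    qProd q y ≠ 0 := by
  refine tprod_one_add_ne_zero_of_summable (fun n h => hy n ?_) (summable_norm_qProd hq y)
  linear_combination -h

lemma norm_e_lt_one {τ : ℂ} (hτ : 0 < τ.im) : ‖e τ‖ < 1 := by
  rw [norm_e, Real.exp_lt_one_iff]
  have := Real.pi_pos
  have : 0 < 2 * Real.pi * τ.im := by positivity
  linarith

/-- The product side of the Jacobi triple product identity, up to a constant factor. -/
noncomputable def tripleProd (τ z : ℂ) : ℂ := qProd (e τ) (e z) * qProd (e τ) (e τ * e (-z))

lemma differentiable_tripleProd {τ : ℂ} (hτ : 0 < τ.im) : Differentiable ℂ (tripleProd τ) := by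
  have h := differentiable_qProd (norm_e_lt_one hτ)
  exact (h.comp differentiable_e).mul (h.comp (f := fun z => e τ * e (-z)) (by fun_prop))

lemma tripleProd_add_one (τ z : ℂ) : tripleProd τ (z + 1) = tripleProd τ z := by
  have h1 : e (z + 1) = e z := e_eq_of_eq_add_int 1 (by simp)
  have h2 : e (-(z + 1)) = e (-z) := e_eq_of_eq_add_int (-1) (by push_cast; ring)
  rw [tripleProd, h1, h2, tripleProd]

lemma tripleProd_add_period {τ : ℂ} (hτ : 0 < τ.im) (z : ℂ) :
    tripleProd τ (z + τ) = -e (-z) * tripleProd τ z := by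
  have hq := norm_e_lt_one hτ
  have h1 : e τ * e (-(z + τ)) = e (-z) := by rw [← e_add]; congr 1; ring
  rw [tripleProd, h1, qProd_eq_mul hq (e (-z)), tripleProd, qProd_eq_mul hq (e z), e_add,
    mul_comm (e z) (e τ), e_neg]
  have := e_ne_zero z
  field_simp
  ring

lemma tripleProd_ne_zero {τ : ℂ} (hτ : 0 < τ.im) {z : ℂ} (hz : ∀ a b : ℤ, z ≠ a * τ + b) :
    tripleProd τ z ≠ 0 := by
  have hq := norm_e_lt_one hτ
  refine mul_ne_zero (qProd_ne_zero hq fun n h => ?_) (qProd_ne_zero hq fun n h => ?_)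
  · rw [e_pow, ← e_add, e_eq_one_iff] at h
    obtain ⟨m, hm⟩ := h
    refine hz (-n) m ?_
    push_cast
    linear_combination hm
  · rw [e_pow, ← e_add, ← e_add, e_eq_one_iff] at h
    obtain ⟨m, hm⟩ := h
    refine hz (n + 1) (-m) ?_
    push_cast
    linear_combination -hm

/-- The Jacobi triple product identity, up to a constant factor. -/
lemma exists_mul_theta11_eq_tripleProd {τ : ℂ} (hτ : 0 < τ.im) :
    ∃ c : ℂ, ∀ z, c * theta11 τ z = e (τ / 8 + z / 2 + 1 / 4) * (e (-z) * tripleProd τ z) := by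
  -- After the translation by τ/2 + 1/2 the product obeys the law of a theta function with m = 1;
  -- `ZMod 1` has one element, so one coefficient determines it.
  obtain ⟨c, hc⟩ := exists_theta_expansion
    (F := fun z => tripleProd τ (z + (τ / 2 + 1 / 2)))
    ((differentiable_tripleProd hτ).comp (f := fun z => z + (τ / 2 + 1 / 2)) (by fun_prop))
    (fun z => by rw [add_right_comm, tripleProd_add_one]) one_ne_zero hτ (fun z => by
      rw [add_right_comm, tripleProd_add_period hτ, ← neg_one_mul, ← e_half, ← e_add]
      congr 1
      refine e_eq_of_eq_add_int 0 ?_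
      push_cast
      ring)
  -- The total translation of the product amounts to z + 1 + τ, and its law under τ contributes the
  -- sign.
  refine ⟨-c 0, fun z => ?_⟩
  have h := hc (z + τ / 2 + 1 / 2)
  have h1 : ∀ n : ℤ, c n * e ((n : ℂ) ^ 2 / (2 * (1 : ℕ)) * τ + n * (z + τ / 2 + 1 / 2)) =
      c 0 * jacobiTheta₂_term n (z + τ / 2 + 1 / 2) τ := by
    intro n
    rw [Subsingleton.elim (n : ZMod 1) 0, e, jacobiTheta₂_term]
    congr 2
    push_cast
    ring
  simp only [h1] at h
  rw [tsum_mul_left, ← jacobiTheta₂, show z + τ / 2 + 1 / 2 + (τ / 2 + 1 / 2) = z + 1 + τ by ring,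
    tripleProd_add_period hτ, tripleProd_add_one,
    show e (-(z + 1)) = e (-z) from e_eq_of_eq_add_int (-1) (by push_cast; ring)] at h
  rw [theta11_eq_jacobi]
  linear_combination e (τ / 8 + z / 2 + 1 / 4) * h

/-- The constant in the triple product need not be known: the product side is nonzero off the
lattice, which excludes a zero of θ₁₁ whatever the constant is. -/
lemma theta11_ne_zero {τ : ℂ} (hτ : 0 < τ.im) {z : ℂ} (hz : ∀ a b : ℤ, z ≠ a * τ + b) :
    theta11 τ z ≠ 0 := by
  obtain ⟨c, hc⟩ := exists_mul_theta11_eq_tripleProd hτ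
  intro h
  have := hc z
  rw [h, mul_zero] at this
  exact mul_ne_zero (e_ne_zero _) (mul_ne_zero (e_ne_zero _) (tripleProd_ne_zero hτ hz)) this.symm

/-- The n = 0 factor 1 - e(z) of the product carries a simple zero at the origin, and the cofactor
`g` does not vanish there. -/
lemma deriv_theta11_zero_ne_zero {τ : ℂ} (hτ : 0 < τ.im) : deriv (theta11 τ) 0 ≠ 0 := by
  obtain ⟨c, hc⟩ := exists_mul_theta11_eq_tripleProd hτ
  have hq := norm_e_lt_one hτ
  have hA := differentiable_qProd hq
  set g : ℂ → ℂ := fun z => e (τ / 8 + z / 2 + 1 / 4) *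
    (e (-z) * (qProd (e τ) (e τ * e z) * qProd (e τ) (e τ * e (-z)))) with hg
  have hgd : Differentiable ℂ g := by
    have h1 : Differentiable ℂ fun z => qProd (e τ) (e τ * e z) :=
      hA.comp (f := fun z => e τ * e z) (by fun_prop)
    have h2 : Differentiable ℂ fun z => qProd (e τ) (e τ * e (-z)) :=
      hA.comp (f := fun z => e τ * e (-z)) (by fun_prop)
    fun_prop
  have hg0 : g 0 ≠ 0 := by
    have : qProd (e τ) (e τ) ≠ 0 := by
      refine qProd_ne_zero hq fun n h => ?_
      have h1 := congrArg norm h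
      rw [← pow_succ, norm_pow, norm_one] at h1
      exact (pow_lt_one₀ (norm_nonneg _) hq (Nat.succ_ne_zero n)).ne h1
    simp [hg, this]
  have hfun : (fun z => c * theta11 τ z) = fun z => (1 - e z) * g z := by
    funext z
    rw [hc, tripleProd, qProd_eq_mul hq (e z)]
    simp only [hg]
    ring
  have he : HasDerivAt e (2 * Real.pi * I) 0 := by
    have := ((hasDerivAt_id (0 : ℂ)).const_mul (2 * Real.pi * I)).cexp
    simp only [id, mul_zero, Complex.exp_zero, one_mul, mul_one] at this
    exact this
  have hd1 := ((he.const_sub 1).mul (hgd 0).hasDerivAt).deriv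
  intro h
  have hd2 : deriv (fun z => c * theta11 τ z) 0 = 0 := by
    rw [deriv_const_mul _ (differentiable_theta11 hτ 0), h, mul_zero]
  rw [hfun] at hd2
  rw [show (fun z => (1 - e z) * g z) = (fun z => 1 - e z) * g from rfl, hd1] at hd2
  simp [hg0, Real.pi_ne_zero] at hd2

/-- A property of complex numbers invariant under the translations by `1` and `τ` holds on the
lattice if it holds at `0`. -/
lemma lattice_induction {p : ℂ → Prop} {τ : ℂ} (h0 : p 0) (h1 : ∀ z, p (z + 1) ↔ p z)
    (h2 : ∀ z, p (z + τ) ↔ p z) (a b : ℤ) : p (a * τ + b) := by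
  have hb : ∀ b : ℤ, p b := by
    intro b
    induction b using Int.induction_on with
    | zero => simpa using h0
    | succ n ih => push_cast at ih ⊢; exact (h1 _).mpr ih
    | pred n ih =>
      refine (h1 _).mp ?_
      push_cast at ih ⊢
      rwa [sub_add_cancel]
  induction a using Int.induction_on with
  | zero => simpa using hb b
  | succ n ih =>
    have := (h2 _).mpr ih
    convert this using 1
    push_cast
    ring
  | pred n ih =>
    refine (h2 _).mp ?_
    convert ih using 1
    push_cast
    ring

lemma theta11_lattice {τ : ℂ} (hτ : 0 < τ.im) (a b : ℤ) : theta11 τ (a * τ + b) = 0 := by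
  refine lattice_induction (p := fun z => theta11 τ z = 0) (theta11_zero hτ) (fun z => ?_)
    (fun z => ?_) a b
  · rw [theta11_add_one hτ, neg_eq_zero]
  · rw [theta11_add_period hτ, mul_eq_zero, neg_eq_zero, or_iff_right (e_ne_zero _)]

lemma theta11_eq_zero_iff {τ : ℂ} (hτ : 0 < τ.im) (z : ℂ) :
    theta11 τ z = 0 ↔ ∃ a b : ℤ, z = a * τ + b := by
  refine ⟨fun h => ?_, ?_⟩
  · by_contra! hz
    exact theta11_ne_zero hτ hz h
  · rintro ⟨a, b, rfl⟩
    exact theta11_lattice hτ a b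

/-- The zeros of `θ₁₁` are simple. -/
lemma deriv_theta11_ne_zero {τ : ℂ} (hτ : 0 < τ.im) {z : ℂ} (hz : theta11 τ z = 0) :
    deriv (theta11 τ) z ≠ 0 := by
  have hd := differentiable_theta11 hτ
  suffices h : ∀ a b : ℤ, theta11 τ (a * τ + b) = 0 ∧ deriv (theta11 τ) (a * τ + b) ≠ 0 by
    obtain ⟨a, b, rfl⟩ := (theta11_eq_zero_iff hτ z).mp hz
    exact (h a b).2
  refine lattice_induction (p := fun z => theta11 τ z = 0 ∧ deriv (theta11 τ) z ≠ 0)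
    ⟨theta11_zero hτ, deriv_theta11_zero_ne_zero hτ⟩ (fun z => ?_) (fun z => ?_)
  · have : deriv (theta11 τ) (z + 1) = -deriv (theta11 τ) z := by
      rw [← deriv_comp_add_const, show (fun z => theta11 τ (z + 1)) = -theta11 τ from
        funext fun z => theta11_add_one hτ z, deriv.neg]
    rw [theta11_add_one hτ, this, neg_eq_zero, neg_ne_zero]
  · rw [theta11_add_period hτ, mul_eq_zero, neg_eq_zero, or_iff_right (e_ne_zero _)]
    refine and_congr_right fun h0 => ?_
    have : deriv (theta11 τ) (z + τ) = -e (-(τ / 2) - z) * deriv (theta11 τ) z := by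
      have h1 : Differentiable ℂ fun z => -e (-(τ / 2) - z) := by fun_prop
      rw [← deriv_comp_add_const, show (fun z => theta11 τ (z + τ)) =
        (fun z => -e (-(τ / 2) - z)) * theta11 τ from funext fun z => theta11_add_period hτ z,
        ((h1 z).hasDerivAt.mul (hd z).hasDerivAt).deriv, h0, mul_zero, zero_add]
    rw [this, Ne, mul_eq_zero, neg_eq_zero, or_iff_right (e_ne_zero _)]

/-! ### Affine characters -/

/-- The quotient of two entire functions, extended over removable singularities by taking limits,
is entire if the denominator has simple zeros at which the numerator vanishes. -/
lemma limUnder_div_removable {f D : ℂ → ℂ} (hf : Differentiable ℂ f) (hD : Differentiable ℂ D)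
    (h : ∀ z, D z = 0 → f z = 0 ∧ deriv D z ≠ 0) (p : ℂ) :
    DifferentiableAt ℂ (fun z => limUnder (𝓝[≠] z) fun ζ => f ζ / D ζ) p ∧
      (limUnder (𝓝[≠] p) fun ζ => f ζ / D ζ) * D p = f p := by
  -- A holomorphic representative near p: the quotient of the divided differences if D vanishes at
  -- p, the plain quotient otherwise. All limits near p are then values of `g`.
  obtain ⟨g, U, hU, hpU, hg, hfD, hgp⟩ : ∃ (g : ℂ → ℂ) (U : Set ℂ), IsOpen U ∧ p ∈ U ∧
      DifferentiableOn ℂ g U ∧ (∀ z ∈ U, z ≠ p → f z / D z = g z) ∧ g p * D p = f p := by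
    by_cases hp : D p = 0
    · obtain ⟨hfp, hDp⟩ := h p hp
      have hdf : Differentiable ℂ (dslope f p) := by
        rw [← differentiableOn_univ, Complex.differentiableOn_dslope univ_mem]
        exact hf.differentiableOn
      have hdD : Differentiable ℂ (dslope D p) := by
        rw [← differentiableOn_univ, Complex.differentiableOn_dslope univ_mem]
        exact hD.differentiableOn
      refine ⟨fun z => dslope f p z / dslope D p z, {z | dslope D p z ≠ 0},
        isOpen_ne_fun hdD.continuous continuous_const, by simpa using hDp,
        hdf.differentiableOn.div hdD.differentiableOn fun z hz => hz, fun z _ hzp => ?_, ?_⟩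
      · have hzp' : z - p ≠ 0 := sub_ne_zero.mpr hzp
        simp only
        rw [dslope_of_ne _ hzp, dslope_of_ne _ hzp, slope_def_field, slope_def_field, hfp, hp,
          sub_zero, sub_zero, div_div_div_cancel_right₀ hzp']
      · rw [hp, hfp, mul_zero]
    · exact ⟨fun z => f z / D z, {z | D z ≠ 0}, isOpen_ne_fun hD.continuous continuous_const, hp,
        hf.differentiableOn.div hD.differentiableOn fun z hz => hz, fun _ _ _ => rfl,
        div_mul_cancel₀ _ hp⟩
  have hlim : ∀ z ∈ U, (limUnder (𝓝[≠] z) fun ζ => f ζ / D ζ) = g z := by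
    intro z hz
    have hcont : Tendsto g (𝓝[≠] z) (𝓝 (g z)) :=
      ((hg.differentiableAt (hU.mem_nhds hz)).continuousAt).tendsto.mono_left nhdsWithin_le_nhds
    refine (hcont.congr' ?_).limUnder_eq
    have h1 : ∀ᶠ w in 𝓝[≠] z, w ∈ U := nhdsWithin_le_nhds (hU.mem_nhds hz)
    have h2 : ∀ᶠ w in 𝓝[≠] z, w ≠ p := by
      by_cases hzp : z = p
      · rw [hzp]
        exact self_mem_nhdsWithin
      · exact nhdsWithin_le_nhds (isOpen_ne.mem_nhds hzp)
    filter_upwards [h1, h2] with w hw1 hw2 using (hfD w hw1 hw2).symm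
  refine ⟨?_, by rw [hlim p hpU, hgp]⟩
  refine (hg.differentiableAt (hU.mem_nhds hpU)).congr_of_eventuallyEq ?_
  filter_upwards [hU.mem_nhds hpU] with z hz using hlim z hz

/-- Oddness gives the zero at 0. Translation by the period changes the label r to k - r, so the
induction carries all labels at once. -/
lemma varthetaHat_lattice {k : ℕ} (hk : k ≠ 0) (r : ℤ) (τ : ℂ) (a b : ℤ) :
    varthetaHat k r τ ((a * τ + b) / 2) = 0 := by
  have h0 : ∀ r, varthetaHat k r τ 0 = 0 := fun r => by
    have := varthetaHat_neg k r τ 0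
    rw [neg_zero] at this
    exact self_eq_neg.mp this
  refine lattice_induction (p := fun z => ∀ r, varthetaHat k r τ (z / 2) = 0)
    (by simpa using h0) (fun z => ?_) (fun z => ?_) a b r
  · simp only [add_div, varthetaHat_add_half, mul_eq_zero,
      zpow_ne_zero _ (neg_ne_zero.mpr (one_ne_zero (α := ℂ))),
      false_or]
  · simp only [add_div, varthetaHat_add_half_period hk, mul_eq_zero, neg_eq_zero, e_ne_zero,
      false_or]
    exact ⟨fun h r => by simpa using h (k - r), fun h r => h _⟩

/-- The zeros of the denominator are those of θ₁₁, hence simple and on the lattice, where the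
numerator vanishes too. The product relation holds at the zeros as well, so the limit need not be
handled again. -/
lemma affineChar_spec {τ : ℂ} (hτ : 0 < τ.im) (K : ℕ) (l : ℤ) (z : ℂ) :
    DifferentiableAt ℂ (affineChar K l τ) z ∧
      affineChar K l τ z * varthetaHat 2 1 τ (z / 2) = varthetaHat (K + 2) (l + 1) τ (z / 2) := by
  have hhalf : Differentiable ℂ fun z : ℂ => z / 2 := by fun_prop
  refine limUnder_div_removable (f := fun ζ => varthetaHat (K + 2) (l + 1) τ (ζ / 2))
    (D := fun ζ => varthetaHat 2 1 τ (ζ / 2))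
    ((differentiable_varthetaHat (by omega) _ hτ).comp hhalf)
    ((differentiable_varthetaHat two_ne_zero _ hτ).comp hhalf) (fun p hp => ?_) z
  have hθ : theta11 τ = fun z => I * varthetaHat 2 1 τ (z / 2) :=
    funext (theta11_eq_varthetaHat hτ)
  have hp' : theta11 τ p = 0 := by rw [theta11_eq_varthetaHat hτ, hp, mul_zero]
  constructor
  · obtain ⟨a, b, rfl⟩ := (theta11_eq_zero_iff hτ p).mp hp'
    exact varthetaHat_lattice (by omega) _ _ a b
  · intro h0
    refine deriv_theta11_ne_zero hτ hp' ?_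
    rw [hθ, deriv_const_mul_field, h0, mul_zero]

lemma differentiable_affineChar {τ : ℂ} (hτ : 0 < τ.im) (K : ℕ) (l : ℤ) : Differentiable ℂ (affineChar K l τ) :=
  fun z => (affineChar_spec hτ K l z).1

lemma affineChar_mul_theta11 {τ : ℂ} (hτ : 0 < τ.im) (K : ℕ) (l : ℤ) (z : ℂ) :
    affineChar K l τ z * theta11 τ z = I * varthetaHat (K + 2) (l + 1) τ (z / 2) := by
  rw [theta11_eq_varthetaHat hτ, ← (affineChar_spec hτ K l z).2]
  ring

/-- The zeros of θ₁₁ are isolated, so continuity permits cancelling it everywhere. Laws for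
`varthetaHat` pass to the characters this way. -/
lemma eq_of_mul_theta11_eq {τ : ℂ} (hτ : 0 < τ.im) {F G : ℂ → ℂ} (hF : Continuous F) (hG : Continuous G)
    (h : ∀ z, F z * theta11 τ z = G z * theta11 τ z) (z : ℂ) : F z = G z := by
  by_cases hz : theta11 τ z = 0
  · have h1 : ∀ᶠ w in 𝓝[≠] z, theta11 τ w ≠ 0 :=
      (differentiable_theta11 hτ z).hasDerivAt.eventually_ne (deriv_theta11_ne_zero hτ hz)
    have h2 : Tendsto F (𝓝[≠] z) (𝓝 (F z)) := hF.continuousAt.tendsto.mono_left nhdsWithin_le_nhds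
    have h3 : Tendsto G (𝓝[≠] z) (𝓝 (G z)) := hG.continuousAt.tendsto.mono_left nhdsWithin_le_nhds
    refine tendsto_nhds_unique h2 (h3.congr' ?_)
    filter_upwards [h1] with w hw using (mul_right_cancel₀ hw (h w)).symm
  · exact mul_right_cancel₀ hz (h z)

lemma affineChar_add_one {τ : ℂ} (hτ : 0 < τ.im) (K : ℕ) (l : ℤ) (z : ℂ) :
    affineChar K l τ (z + 1) = (-1) ^ l * affineChar K l τ z := by
  have hX := (differentiable_affineChar hτ K l).continuous
  refine eq_of_mul_theta11_eq hτ (F := fun z => affineChar K l τ (z + 1))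
    (G := fun z => (-1) ^ l * affineChar K l τ z) (by fun_prop) (by fun_prop) (fun z => ?_) z
  have h1 := affineChar_mul_theta11 hτ K l (z + 1)
  have h2 := affineChar_mul_theta11 hτ K l z
  rw [theta11_add_one hτ, add_div, varthetaHat_add_half, zpow_add_one₀ (by norm_num)] at h1
  linear_combination -h1 - (-1) ^ l * h2

lemma affineChar_neg {τ : ℂ} (hτ : 0 < τ.im) (K : ℕ) (l : ℤ) (z : ℂ) : affineChar K l τ (-z) = affineChar K l τ z := by
  have hX := (differentiable_affineChar hτ K l).continuous
  refine eq_of_mul_theta11_eq hτ (F := fun z => affineChar K l τ (-z)) (by fun_prop) hX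
    (fun z => ?_) z
  have h1 := affineChar_mul_theta11 hτ K l (-z)
  have h2 := affineChar_mul_theta11 hτ K l z
  rw [theta11_neg hτ, neg_div, varthetaHat_neg] at h1
  linear_combination -h1 - h2

/-- The automorphy factors of levels K + 2 and 2 divide to level K, and the label l + 1 reflects to
(K - l) + 1. -/
lemma affineChar_add_period {τ : ℂ} (hτ : 0 < τ.im) (K : ℕ) (l : ℤ) (z : ℂ) :
    affineChar K l τ (z + τ) = e (-(K / 4 * τ) - K / 2 * z) * affineChar K (K - l) τ z := by
  have hX := (differentiable_affineChar hτ K l).continuous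
  have hY := (differentiable_affineChar hτ K (K - l)).continuous
  refine eq_of_mul_theta11_eq hτ (F := fun z => affineChar K l τ (z + τ))
    (G := fun z => e (-(K / 4 * τ) - K / 2 * z) * affineChar K (K - l) τ z)
    (by fun_prop) (by fun_prop) (fun z => ?_) z
  have h1 := affineChar_mul_theta11 hτ K l (z + τ)
  have h2 := affineChar_mul_theta11 hτ K (K - l) z
  rw [theta11_add_period hτ, add_div, varthetaHat_add_half_period (by omega),
    show ((K + 2 : ℕ) : ℤ) - (l + 1) = K - l + 1 by push_cast; ring,
    show e (-((K + 2 : ℕ) / 4 * τ) - (K + 2 : ℕ) * (z / 2)) =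
      e (-(K / 4 * τ) - K / 2 * z) * e (-(τ / 2) - z) by
        rw [← e_add]; congr 1; push_cast; ring] at h1
  have h3 := e_ne_zero (-(τ / 2) - z)
  refine mul_left_cancel₀ h3 ?_
  linear_combination -h1 - e (-(K / 4 * τ) - K / 2 * z) * e (-(τ / 2) - z) * h2

lemma affineChar_sub_period {τ : ℂ} (hτ : 0 < τ.im) (K : ℕ) (l : ℤ) (z : ℂ) :
    affineChar K l τ (z - τ) = e (-(K / 4 * τ) + K / 2 * z) * affineChar K (K - l) τ z := by
  rw [← affineChar_neg hτ, show -(z - τ) = -z + τ by ring, affineChar_add_period hτ,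
    affineChar_neg hτ]
  congr 2
  ring

/-- At level 2 the S-matrix has a single entry, with sin(π/2) = 1. -/
lemma theta11_S {τ : ℂ} (hτ : 0 < τ.im) (z : ℂ) :
    theta11 τ z = I / (-I * τ) ^ (1 / 2 : ℂ) * e (-(z ^ 2 / (2 * τ))) *
      theta11 (-1 / τ) (z / τ) := by
  have h4 : Real.sqrt (2 * (2 : ℕ)) = 2 := by
    rw [show (2 * (2 : ℕ) : ℝ) = 2 ^ 2 by norm_num, Real.sqrt_sq (by norm_num)]
  rw [theta11_eq_varthetaHat hτ, theta11_eq_varthetaHat (im_neg_one_div_pos hτ),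
    varthetaHat_S two_ne_zero _ hτ, sqrt_neg_I_mul two_ne_zero, h4,
    show ((2 : ℕ) : ℤ) - 1 = 1 by norm_num, Finset.Icc_self, Finset.sum_singleton,
    show Real.pi * ((1 : ℤ) : ℝ) * ((1 : ℤ) : ℝ) / (2 : ℕ) = Real.pi / 2 by push_cast; ring,
    Real.sin_pi_div_two, show z / 2 / τ = z / τ / 2 by ring,
    show (-((2 : ℕ) * (z / 2) ^ 2 / τ) : ℂ) = -(z ^ 2 / (2 * τ)) by push_cast; ring]
  push_cast
  ring

/-- Quotient of the transformations at levels K + 2 and 2: the square roots of -iτ cancel, leaving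
the constant 2/√(2(K+2)) = √(2/(K+2)). -/
lemma affineChar_S {τ : ℂ} (hτ : 0 < τ.im) (K : ℕ) (l : ℤ) (z : ℂ) :
    affineChar K l τ z = e (-(K * z ^ 2 / (4 * τ))) *
      ∑ p ∈ Finset.Icc (1 : ℤ) ((K + 2 : ℕ) - 1),
        SHat (K + 2) (l + 1) p * affineChar K (p - 1) (-1 / τ) (z / τ) := by
  have hτ' := im_neg_one_div_pos hτ
  have hτ0 : τ ≠ 0 := fun h => by simp [h] at hτ
  have hX := (differentiable_affineChar hτ K l).continuous
  have hY := fun p => (differentiable_affineChar hτ' K p).continuous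
  refine eq_of_mul_theta11_eq hτ hX (G := fun z => e (-(K * z ^ 2 / (4 * τ))) *
      ∑ p ∈ Finset.Icc (1 : ℤ) ((K + 2 : ℕ) - 1),
        SHat (K + 2) (l + 1) p * affineChar K (p - 1) (-1 / τ) (z / τ)) (by fun_prop)
    (fun z => ?_) z
  set R := (-I * τ) ^ (1 / 2 : ℂ) with hR
  have hkey : ∀ p : ℤ, affineChar K (p - 1) (-1 / τ) (z / τ) * theta11 τ z =
      I / R * e (-(z ^ 2 / (2 * τ))) * (I * varthetaHat (K + 2) p (-1 / τ) (z / τ / 2)) := by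
    intro p
    have := affineChar_mul_theta11 hτ' K (p - 1) (z / τ)
    rw [sub_add_cancel] at this
    rw [theta11_S hτ, ← this]
    ring
  rw [affineChar_mul_theta11 hτ, varthetaHat_S (by omega) _ hτ, sqrt_neg_I_mul (by omega),
    mul_assoc (e (-(K * z ^ 2 / (4 * τ)))),
    Finset.sum_mul, Finset.mul_sum, Finset.mul_sum, Finset.mul_sum]
  refine Finset.sum_congr rfl fun p _ => ?_
  rw [mul_assoc (SHat _ _ _), hkey, SHat]
  have hk0 : (0 : ℝ) < (K + 2 : ℕ) := by positivity
  have hs : Real.sqrt (2 / (K + 2 : ℕ)) = 2 / Real.sqrt (2 * (K + 2 : ℕ)) := by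
    rw [Real.sqrt_div (by norm_num), Real.sqrt_mul (by norm_num)]
    have h1 : Real.sqrt 2 ≠ 0 := by positivity
    have h2 : Real.sqrt (K + 2 : ℕ) ≠ 0 := by positivity
    field_simp
    rw [Real.sq_sqrt (by norm_num)]
  rw [hs, show z / 2 / τ = z / τ / 2 by ring,
    show e (-((K + 2 : ℕ) * (z / 2) ^ 2 / τ)) = e (-(K * z ^ 2 / (4 * τ))) * e (-(z ^ 2 / (2 * τ)))
      by rw [← e_add]; congr 1; push_cast; field_simp; ring]
  push_cast
  ring

/-! ### String functions -/

/-- In the variable z/2 the character has period 1, since two unit translations cancel the sign, and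
two τ-translations restore the label and give the theta law with m = 2K. -/
lemma exists_isThetaDecomposition {τ : ℂ} (hτ : 0 < τ.im) {K : ℕ} (hK : K ≠ 0) (l : ℤ) :
    ∃ c : ZMod (2 * K) → ℂ, IsThetaDecomposition K l τ c := by
  have hX := differentiable_affineChar hτ K l
  obtain ⟨c, hc⟩ := exists_theta_expansion (F := fun z => affineChar K l τ (2 * z))
    (hX.comp (f := fun z => 2 * z) (by fun_prop))
    (fun z => by
      rw [show 2 * (z + 1) = 2 * z + 1 + 1 by ring, affineChar_add_one hτ, affineChar_add_one hτ,
        ← mul_assoc, ← mul_zpow]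
      norm_num) (m := 2 * K) (by positivity) hτ (fun z => by
      rw [show 2 * (z + τ) = 2 * z + τ + τ by ring, affineChar_add_period hτ,
        affineChar_add_period hτ, ← mul_assoc, ← e_add, sub_sub_cancel]
      congr 2
      push_cast
      ring)
  refine ⟨c, fun z => ?_⟩
  rw [sum_mul_vartheta hK hτ]
  have := hc (z / 2)
  rw [show 2 * (z / 2) = z by ring] at this
  rw [this]
  refine tsum_congr fun n => ?_
  rw [thetaTerm]
  congr 3
  push_cast
  ring

/-- Only the defining property of the chosen coefficients enters; their uniqueness plays no role. -/
lemma affineChar_eq_tsum {τ : ℂ} (hτ : 0 < τ.im) {K : ℕ} (hK : K ≠ 0) (l : ℤ) (z : ℂ) :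
    affineChar K l τ z = ∑' t : ℤ, stringFunction K l t τ * thetaTerm K t τ (z / 2) := by
  have h := exists_isThetaDecomposition hτ hK l
  rw [h.choose_spec z, sum_mul_vartheta hK hτ]
  refine tsum_congr fun t => ?_
  rw [stringFunction, dif_pos h]

lemma stringFunction_congr (K : ℕ) (l : ℤ) {r s : ℤ} (n : ℤ) (h : r = s + 2 * K * n) (τ : ℂ) :
    stringFunction K l r τ = stringFunction K l s τ := by
  have : (r : ZMod (2 * K)) = (s : ZMod (2 * K)) := by
    rw [h]
    push_cast
    have h0 : (2 * K : ZMod (2 * K)) = 0 := by exact_mod_cast ZMod.natCast_self (2 * K)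
    rw [h0, zero_mul, add_zero]
  rw [stringFunction, stringFunction, this]

lemma exists_norm_stringFunction_le (K : ℕ) (hK : K ≠ 0) (l : ℤ) (τ : ℂ) :
    ∃ M, ∀ r, ‖stringFunction K l r τ‖ ≤ M := by
  have : NeZero (2 * K) := ⟨by positivity⟩
  refine ⟨∑ a ∈ Finset.range (2 * K), ‖stringFunction K l a τ‖, fun r => ?_⟩
  have h2 : (0 : ℤ) < 2 * K := by positivity
  have h0 := Int.emod_nonneg r h2.ne'
  have h1 := Int.emod_lt_of_pos r h2
  have h3 : ((r % (2 * K)).toNat : ℤ) = r % (2 * K) := Int.toNat_of_nonneg h0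
  rw [stringFunction_congr K l (s := (r % (2 * K)).toNat) (r / (2 * K))
    (by rw [h3, Int.emod_add_mul_ediv])]
  exact Finset.single_le_sum (f := fun a : ℕ => ‖stringFunction K l a τ‖)
    (fun _ _ => norm_nonneg _) (Finset.mem_range.mpr (by omega))

/-! ### Coset characters as Fourier coefficients -/

/-- The coefficients of the expansion `θ₁₁(τ;z) = ∑_b s(b) q^{b²/8} y^{b/2}`. -/
noncomputable def thetaSign (b : ℤ) : ℂ :=
  if (4 : ℤ) ∣ b - 1 then I else if (4 : ℤ) ∣ b - 3 then -I else 0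

lemma norm_thetaSign_le (b : ℤ) : ‖thetaSign b‖ ≤ 1 := by
  unfold thetaSign
  split_ifs <;> simp

lemma thetaSign_four_mul_add (m : ℤ) : thetaSign (4 * m) = 0 ∧ thetaSign (4 * m + 1) = I ∧
    thetaSign (4 * m + 2) = 0 ∧ thetaSign (4 * m + 3) = -I := by
  unfold thetaSign
  refine ⟨?_, ?_, ?_, ?_⟩
  · rw [if_neg (by omega), if_neg (by omega)]
  · rw [if_pos (by omega)]
  · rw [if_neg (by omega), if_neg (by omega)]
  · rw [if_neg (by omega), if_pos (by omega)]

lemma summable_thetaSign_mul {f : ℤ → ℂ} (hf : Summable f) :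
    Summable fun b => thetaSign b * f b := by
  refine Summable.of_norm_bounded hf.norm fun b => ?_
  rw [norm_mul]
  exact mul_le_of_le_one_left (norm_nonneg _) (norm_thetaSign_le b)

lemma tsum_thetaSign_mul {f : ℤ → ℂ} (hf : Summable f) :
    ∑' b, thetaSign b * f b = I * ∑' m : ℤ, f (4 * m + 1) - I * ∑' m : ℤ, f (4 * m + 3) := by
  rw [tsum_int_eq_sum_range (summable_thetaSign_mul hf) four_ne_zero]
  simp only [Finset.sum_range_succ, Finset.sum_range_zero]
  push_cast
  simp only [add_zero, zero_add, (thetaSign_four_mul_add _).1, (thetaSign_four_mul_add _).2.1,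
    (thetaSign_four_mul_add _).2.2.1, (thetaSign_four_mul_add _).2.2.2, zero_mul, tsum_zero]
  rw [tsum_mul_left, tsum_mul_left]
  ring

lemma theta11_eq_tsum_thetaSign {τ : ℂ} (hτ : 0 < τ.im) (z : ℂ) :
    theta11 τ z = ∑' b : ℤ, thetaSign b * thetaTerm 2 b τ (z / 2) := by
  have h3 : vartheta 2 (-1) τ (z / 2) = vartheta 2 3 τ (z / 2) :=
    vartheta_congr (-1) (by norm_num) _ _
  rw [tsum_thetaSign_mul (summable_thetaTerm two_ne_zero hτ _), theta11_eq_varthetaHat hτ,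
    varthetaHat, h3, vartheta_eq_tsum, vartheta_eq_tsum]
  norm_num
  ring

lemma susyChar_eq (k : ℕ) (l r : ℤ) (τ z : ℂ) :
    susyChar k 1 1 l r τ z = I * (cosetChar k l 1 r τ z - cosetChar k l 3 r τ z) := by
  rw [susyChar]
  push_cast
  rw [show (Real.pi * I * 1 * 1 / 2 : ℂ) = Real.pi / 2 * I by ring, Complex.exp_pi_div_two_mul_I]
  norm_num
  ring

/-- For k = 2 the coset is trivial, and the branching rule degenerates to the expansion of θ₁₁
itself. -/
lemma susyChar_two (r : ℤ) (τ z : ℂ) : susyChar 2 1 1 0 r τ z = thetaSign r := by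
  rw [susyChar_eq, cosetChar, cosetChar, thetaSign]
  simp only [if_true, true_and]
  by_cases h1 : (4 : ℤ) ∣ r - 1
  · rw [if_pos h1, if_pos h1, if_neg (by omega)]
    ring
  · rw [if_neg h1, if_neg h1]
    by_cases h3 : (4 : ℤ) ∣ r - 3
    · rw [if_pos h3, if_pos h3]
      ring
    · rw [if_neg h3, if_neg h3]
      ring

lemma affineChar_zero_zero {τ : ℂ} (hτ : 0 < τ.im) (z : ℂ) : affineChar 0 0 τ z = 1 := by
  refine eq_of_mul_theta11_eq hτ (differentiable_affineChar hτ 0 0).continuous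
    (G := fun _ => 1) continuous_const (fun z => ?_) z
  rw [affineChar_mul_theta11 hτ, theta11_eq_varthetaHat hτ, one_mul]
  rfl

/-- The summand of `susyChar` unfolded into a sum over the integers. -/
lemma summable_stringFunction_mul {K k : ℕ} (hK : K ≠ 0) (hk : k ≠ 0) {τ : ℂ} (hτ : 0 < τ.im)
    (l t : ℤ) (z : ℂ) :
    Summable fun b : ℤ => stringFunction K l (t - b) τ *
      thetaTerm (2 * k * K) (2 * t - k * b) τ z := by
  obtain ⟨M, hM⟩ := exists_norm_stringFunction_le K hK l τ
  have hs : Summable fun b : ℤ => ‖thetaTerm (2 * k * K) (2 * t - k * b) τ z‖ := by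
    refine (summable_thetaTerm (k := 2 * k * K) (by positivity) hτ z).norm.comp_injective
      (i := fun b : ℤ => 2 * t - k * b) fun a b h => ?_
    have hk' : (k : ℤ) ≠ 0 := by exact_mod_cast hk
    exact mul_left_cancel₀ hk' (by simpa using h)
  refine Summable.of_norm_bounded (hs.mul_left M) fun b => ?_
  rw [norm_mul]
  exact mul_le_mul_of_nonneg_right (hM _) (norm_nonneg _)

/-- Writing an integer as Km + n merges the sum over n modulo K with the internal sum of the theta
function; 4Km is invisible to the string function, whose period is 2K. -/
lemma cosetChar_eq_tsum {K : ℕ} (hK : K ≠ 0) {τ : ℂ} (hτ : 0 < τ.im) (l s t : ℤ) (z : ℂ) :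
    cosetChar (K + 2) l s t τ z = ∑' m : ℤ, stringFunction K l (t - (4 * m + s)) τ *
      thetaTerm (2 * (K + 2) * K) (2 * t - (K + 2) * (4 * m + s)) τ (z / (2 * (K + 2 : ℕ))) := by
  set f : ℤ → ℂ := fun m => stringFunction K l (t - (4 * m + s)) τ *
    thetaTerm (2 * (K + 2) * K) (2 * t - (K + 2) * (4 * m + s)) τ (z / (2 * (K + 2 : ℕ))) with hf
  have hsum : Summable f := by
    have h := (summable_stringFunction_mul (k := K + 2) hK (by omega) hτ l t
      (z / (2 * (K + 2 : ℕ)))).comp_injective (i := fun m : ℤ => 4 * m + s) fun a b h => by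
        simpa using h
    refine h.congr fun m => ?_
    simp only [Function.comp_apply, hf]
    push_cast
    rfl
  have hsum' : Summable fun m : ℤ => f (-m) := (Equiv.neg ℤ).summable_iff.mpr hsum
  -- The coset character has index t - s + 4n, the series t - s - 4m, hence the reversal of sign.
  rw [← (Equiv.neg ℤ).tsum_eq f]
  simp only [Equiv.neg_apply]
  rw [tsum_int_eq_sum_range hsum' hK, cosetChar, if_neg (by omega), Nat.add_sub_cancel]
  refine Finset.sum_congr rfl fun n _ => ?_
  rw [vartheta_eq_tsum, ← tsum_mul_left]
  refine tsum_congr fun m => ?_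
  simp only [hf]
  congr 1
  · refine stringFunction_congr K l (-2 * m) ?_ τ
    ring
  · congr 1
    push_cast
    ring

lemma susyChar_eq_tsum {K : ℕ} (hK : K ≠ 0) {τ : ℂ} (hτ : 0 < τ.im) (l t : ℤ) (z : ℂ) :
    susyChar (K + 2) 1 1 l t τ z = ∑' b : ℤ, thetaSign b * (stringFunction K l (t - b) τ *
      thetaTerm (2 * (K + 2) * K) (2 * t - (K + 2 : ℕ) * b) τ (z / (2 * (K + 2 : ℕ)))) := by
  rw [tsum_thetaSign_mul (summable_stringFunction_mul hK (by omega) hτ l t _), susyChar_eq,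
    cosetChar_eq_tsum hK hτ, cosetChar_eq_tsum hK hτ, mul_sub]
  push_cast
  rfl

/-- The quadratic form splits orthogonally along the total charge t: (t-b)²/4K + b²/8 = t²/4(K+2) +
(2t-(K+2)b)²/8K(K+2). -/
lemma thetaTerm_mul_thetaTerm {K : ℕ} (hK : K ≠ 0) (t b : ℤ) (τ z₁ z₂ : ℂ) :
    thetaTerm K (t - b) τ (z₁ / 2) * thetaTerm 2 b τ (z₂ / 2) =
      thetaTerm (K + 2) t τ (z₁ / 2 - (z₁ - z₂) / (K + 2 : ℕ)) *
        thetaTerm (2 * (K + 2) * K) (2 * t - (K + 2 : ℕ) * b) τ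
          ((z₁ - z₂) / (2 * (K + 2 : ℕ))) := by
  have h1 : (K : ℂ) ≠ 0 := by exact_mod_cast hK
  have h2 : (K + 2 : ℂ) ≠ 0 := by exact_mod_cast (by omega : K + 2 ≠ 0)
  simp only [thetaTerm, ← e_add]
  congr 1
  push_cast
  field_simp
  ring

/-- Branching of an affine character times `θ₁₁` into theta functions of level `k`; the branching
functions are the characters of the coset. -/
lemma hasSum_susyChar {k : ℕ} (hk : 2 ≤ k) {l : ℤ} (hl : k = 2 → l = 0) {τ : ℂ} (hτ : 0 < τ.im)
    (z₁ z₂ : ℂ) :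
    HasSum (fun t : ℤ => thetaTerm k t τ (z₁ / 2 - (z₁ - z₂) / k) *
      susyChar k 1 1 l t τ (z₁ - z₂)) (affineChar (k - 2) l τ z₁ * theta11 τ z₂) := by
  obtain ⟨K, rfl⟩ := Nat.exists_eq_add_of_le' hk
  rw [Nat.add_sub_cancel]
  rcases eq_or_ne K 0 with rfl | hK
  · obtain rfl := hl rfl
    have h := (summable_thetaSign_mul (summable_thetaTerm two_ne_zero hτ (z₂ / 2))).hasSum
    rw [← theta11_eq_tsum_thetaSign hτ] at h
    rw [affineChar_zero_zero hτ, one_mul]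
    refine (congrArg (fun f : ℤ → ℂ => HasSum f _) (funext fun t => ?_)).mpr h
    rw [susyChar_two, mul_comm]
    congr 2
    push_cast
    ring
  · have hX : Summable fun a : ℤ => stringFunction K l a τ * thetaTerm K a τ (z₁ / 2) := by
      obtain ⟨M, hM⟩ := exists_norm_stringFunction_le K hK l τ
      refine Summable.of_norm_bounded ((summable_thetaTerm hK hτ (z₁ / 2)).norm.mul_left M)
        fun a => ?_
      rw [norm_mul]
      exact mul_le_mul_of_nonneg_right (hM _) (norm_nonneg _)
    have hθ := summable_thetaSign_mul (summable_thetaTerm two_ne_zero hτ (z₂ / 2))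
    have hprod := (summable_mul_of_summable_norm hX.norm hθ.norm).hasSum
    rw [← tsum_mul_tsum_of_summable_norm hX.norm hθ.norm, ← affineChar_eq_tsum hτ hK,
      ← theta11_eq_tsum_thetaSign hτ] at hprod
    -- The double series is regrouped by the total charge t = a + b; the fibre over t sums to the
    -- coset character.
    let E : ℤ × ℤ ≃ ℤ × ℤ :=
      { toFun := fun p => (p.1 - p.2, p.2)
        invFun := fun p => (p.1 + p.2, p.2)
        left_inv := fun p => by simp
        right_inv := fun p => by simp }
    rw [← E.hasSum_iff] at hprod
    refine hprod.prod_fiberwise fun t => ?_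
    have hb : ∀ b : ℤ, ((fun p : ℤ × ℤ => stringFunction K l p.1 τ * thetaTerm K p.1 τ (z₁ / 2) *
        (thetaSign p.2 * thetaTerm 2 p.2 τ (z₂ / 2))) ∘ E) (t, b) =
        thetaTerm (K + 2) t τ (z₁ / 2 - (z₁ - z₂) / (K + 2 : ℕ)) *
        (thetaSign b * (stringFunction K l (t - b) τ * thetaTerm (2 * (K + 2) * K)
          (2 * t - (K + 2 : ℕ) * b) τ ((z₁ - z₂) / (2 * (K + 2 : ℕ))))) := by
      intro b
      have := thetaTerm_mul_thetaTerm hK t b τ z₁ z₂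
      simp only [Function.comp_apply, E, Equiv.coe_fn_mk]
      linear_combination (stringFunction K l (t - b) τ * thetaSign b) * this
    simp only [hb]
    rw [susyChar_eq_tsum hK hτ]
    exact (summable_thetaSign_mul
      (summable_stringFunction_mul hK (by omega) hτ l t _)).hasSum.mul_left _

lemma thetaTerm_add (k : ℕ) (t : ℤ) (τ z u : ℂ) :
    thetaTerm k t τ (z + u) = thetaTerm k t τ z * e (t * u) := by
  rw [thetaTerm, thetaTerm, ← e_add]
  congr 1
  ring

/-- Selection rule for the coset characters. -/
lemma susyChar_eq_zero {k : ℕ} (hk : 2 ≤ k) {l : ℤ} (hl : k = 2 → l = 0) {τ : ℂ}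
    (hτ : 0 < τ.im) {t : ℤ} (ht : ¬ t ≡ l + 1 [ZMOD 2]) (z : ℂ) :
    susyChar k 1 1 l t τ z = 0 := by
  set b : ℤ → ℂ := fun t => thetaTerm k t τ (z / 2 - z / k) * susyChar k 1 1 l t τ z with hbdef
  have hsum : ∀ u, HasSum (fun t : ℤ => b t * e (t * u))
      (affineChar (k - 2) l τ (2 * u + z) * theta11 τ (2 * u)) := by
    intro u
    have h := hasSum_susyChar hk hl hτ (2 * u + z) (2 * u)
    rw [add_sub_cancel_left, show (2 * u + z) / 2 - z / k = z / 2 - z / k + u by ring] at h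
    convert h using 2
    rw [thetaTerm_add]
    simp only [hbdef]
    ring
  -- Translation by 1/2 multiplies the t-th term by (-1)^t and the product χ·θ₁₁ by (-1)^(l+1). The
  -- weighted difference vanishes, and uniqueness of Fourier coefficients kills the terms of the
  -- wrong parity.
  have hsum2 : ∀ u, HasSum (fun t : ℤ => b t * (1 - (-1) ^ (l + 1) * (-1) ^ t) * e (t * u)) 0 := by
    intro u
    have h := (hsum u).sub ((hsum (u + 1 / 2)).mul_left ((-1) ^ (l + 1)))
    rw [show 2 * (u + 1 / 2) + z = 2 * u + z + 1 by ring, show 2 * (u + 1 / 2) = 2 * u + 1 by ring,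
      affineChar_add_one hτ, theta11_add_one hτ] at h
    have hsign : ((-1 : ℂ) ^ l) * (-1) ^ l = 1 := by
      rw [← mul_zpow]
      norm_num
    rw [zpow_add_one₀ (by norm_num), show affineChar (k - 2) l τ (2 * u + z) * theta11 τ (2 * u) -
      (-1) ^ l * -1 * ((-1) ^ l * affineChar (k - 2) l τ (2 * u + z) * -theta11 τ (2 * u)) = 0 by
        linear_combination (affineChar (k - 2) l τ (2 * u + z) * theta11 τ (2 * u)) *
          (-1 : ℂ) * hsign] at h
    refine (congrArg (fun f : ℤ → ℂ => HasSum f _) (funext fun t => ?_)).mpr h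
    rw [mul_add, e_add, show (t * (1 / 2) : ℂ) = t / 2 by ring, e_int_half,
      zpow_add_one₀ (by norm_num)]
    ring

  have h0 := fourierInt_tsum (a := fun t => b t * (1 - (-1) ^ (l + 1) * (-1) ^ t))
    (by simpa using (hsum2 0).summable) t
  simp only [fun u => (hsum2 u).tsum_eq] at h0
  rw [fourierInt] at h0
  simp only [zero_mul, intervalIntegral.integral_zero] at h0
  have hsign : (-1 : ℂ) ^ (l + 1) * (-1) ^ t = -1 := by
    rw [← zpow_add₀ (by norm_num)]
    refine Odd.neg_one_zpow ?_
    rw [Int.odd_iff]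
    unfold Int.ModEq at ht
    omega
  rw [hsign] at h0
  have h1 : b t = 0 := by linear_combination -h0 / 2
  exact (mul_eq_zero.mp h1).resolve_left (e_ne_zero _)

/-! ### Appell–Lerch sums -/

lemma tendsto_norm_e_int_mul_atTop {τ : ℂ} (hτ : 0 < τ.im) :
    Tendsto (fun n : ℤ => ‖e (n * τ)‖) atTop (𝓝 0) := by
  have h : Tendsto (fun n : ℤ => 2 * Real.pi * τ.im * (n : ℝ)) atTop atTop :=
    tendsto_intCast_atTop_atTop.const_mul_atTop (by have := Real.pi_pos; positivity)
  refine (Real.tendsto_exp_neg_atTop_nhds_zero.comp h).congr fun n => ?_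
  rw [norm_e, Function.comp_apply]
  congr 1
  simp
  ring

lemma tendsto_norm_e_int_mul_atBot {τ : ℂ} (hτ : 0 < τ.im) :
    Tendsto (fun n : ℤ => ‖e (n * τ)‖) atBot atTop := by
  have h : Tendsto (fun n : ℤ => 2 * Real.pi * τ.im * (-(n : ℝ))) atBot atTop :=
    (tendsto_neg_atBot_atTop.comp (tendsto_intCast_atBot_iff.mpr tendsto_id)).const_mul_atTop
      (by have := Real.pi_pos; positivity)
  refine (Real.tendsto_exp_atTop.comp h).congr fun n => ?_
  rw [norm_e, Function.comp_apply]
  congr 1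
  simp
  ring

lemma one_sub_e_mul_e_ne_zero {τ v : ℂ} (hv : ∀ a b : ℤ, v ≠ a * τ + b) (n : ℤ) :
    1 - e v * e (n * τ) ≠ 0 := by
  intro h
  have h1 : e (v + n * τ) = 1 := by rw [e_add]; linear_combination -h
  obtain ⟨m, hm⟩ := e_eq_one_iff.mp h1
  refine hv (-n) m ?_
  push_cast
  linear_combination hm

/-- As n → ±∞ the quantity y_v qⁿ tends to 0 or ∞, so all but finitely many denominators have
modulus at least 1/2. -/
lemma eventually_norm_inv_one_sub_le {τ : ℂ} (hτ : 0 < τ.im) (v : ℂ) :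
    ∀ᶠ n : ℤ in cofinite, ‖(1 - e v * e (n * τ))⁻¹‖ ≤ 2 := by
  have hy : 0 < ‖e v‖ := norm_pos_iff.mpr (e_ne_zero v)
  rw [Int.cofinite_eq, eventually_sup]
  have key : ∀ n : ℤ, 1 / 2 ≤ ‖1 - e v * e (n * τ)‖ → ‖(1 - e v * e (n * τ))⁻¹‖ ≤ 2 := by
    intro n h
    rw [norm_inv]
    exact inv_le_of_inv_le₀ (by norm_num) (by linarith)
  constructor
  · filter_upwards [(tendsto_norm_e_int_mul_atBot hτ).eventually_ge_atTop (2 / ‖e v‖)] with n hn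
    refine key n ?_
    have h1 := norm_sub_norm_le (e v * e (n * τ)) 1
    rw [div_le_iff₀' hy, ← norm_mul] at hn
    rw [norm_one, norm_sub_rev] at h1
    linarith
  · have hlt : 0 < 1 / (2 * ‖e v‖) := by positivity
    filter_upwards [(tendsto_norm_e_int_mul_atTop hτ).eventually_lt_const hlt] with n hn
    refine key n ?_
    have h1 := norm_sub_norm_le 1 (e v * e (n * τ))
    rw [lt_div_iff₀' (by positivity), mul_assoc, ← norm_mul] at hn
    rw [norm_one] at h1
    linarith

section AppellSeries

variable {a : ℤ → ℂ} {τ v : ℂ}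

lemma summable_appell (ha : ∀ z, Summable fun n : ℤ => a n * e (n * z)) (hτ : 0 < τ.im) (u : ℂ) :
    Summable fun n : ℤ => a n / (1 - e v * e (n * τ)) * e (n * u) := by
  refine Summable.of_norm_bounded_eventually ((ha u).norm.mul_left 2) ?_
  filter_upwards [eventually_norm_inv_one_sub_le hτ v] with n hn
  rw [div_mul_eq_mul_div, div_eq_mul_inv, norm_mul, mul_comm]
  exact mul_le_mul_of_nonneg_right hn (norm_nonneg _)

lemma differentiable_appell (ha : ∀ z, Summable fun n : ℤ => a n * e (n * z)) (hτ : 0 < τ.im) :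
    Differentiable ℂ fun u => ∑' n : ℤ, a n / (1 - e v * e (n * τ)) * e (n * u) :=
  differentiable_tsum_mul_e (summable_appell ha hτ)

lemma appell_add_one (b : ℤ → ℂ) (u : ℂ) :
    ∑' n : ℤ, b n * e (n * (u + 1)) = ∑' n : ℤ, b n * e (n * u) := by
  refine tsum_congr fun n => ?_
  congr 1
  refine e_eq_of_eq_add_int n ?_
  ring

/-- The translation supplies a factor qⁿ in the n-th term; subtracting y_v times the translate
produces 1 - y_v qⁿ, which cancels the denominator. -/
lemma appell_sub_period (ha : ∀ z, Summable fun n : ℤ => a n * e (n * z)) (hτ : 0 < τ.im)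
    (hv : ∀ a b : ℤ, v ≠ a * τ + b) (u : ℂ) :
    (∑' n : ℤ, a n / (1 - e v * e (n * τ)) * e (n * u)) -
      e v * ∑' n : ℤ, a n / (1 - e v * e (n * τ)) * e (n * (u + τ)) =
      ∑' n : ℤ, a n * e (n * u) := by
  rw [← tsum_mul_left, ← (summable_appell ha hτ u).tsum_sub
    ((summable_appell ha hτ (u + τ)).mul_left (e v))]
  refine tsum_congr fun n => ?_
  have h := one_sub_e_mul_e_ne_zero hv n
  rw [mul_add, e_add]
  field_simp

end AppellSeries

/-- The Appell–Lerch sum `μ^{k,j,j'}` multiplied by `θ₁₁(τ;u)`. -/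
noncomputable def muNum (k : ℕ) (j j' : ℤ) (τ v u w : ℂ) : ℂ :=
  e (j' / k * v) *
    ∑' n : ℤ, e ((n : ℂ) ^ 2 / k * τ) * e (j' * n / k * τ) / (1 - e v * e (n * τ)) *
      (e u * e ((1 - 2 / k) * w) / e ((1 - 2 / k) * v)) ^ n *
      susyChar k 1 1 (j - 1) (2 * n + j') τ (w - v)

lemma mu_eq_muNum_div (k : ℕ) (j j' : ℤ) (τ v u w : ℂ) :
    mu k j j' τ v u w = muNum k j j' τ v u w / theta11 τ u := by
  rw [mu, muNum]
  ring

/-- The Fourier coefficients of the numerator of the Appell–Lerch sum. -/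
noncomputable def muCoeff (k : ℕ) (j j' : ℤ) (τ v w : ℂ) (n : ℤ) : ℂ :=
  e (j' / k * v) * (e ((n : ℂ) ^ 2 / k * τ + j' * n / k * τ + n * ((1 - 2 / k) * (w - v))) *
    susyChar k 1 1 (j - 1) (2 * n + j') τ (w - v))

lemma muNum_eq_tsum (k : ℕ) (j j' : ℤ) (τ v u w : ℂ) :
    muNum k j j' τ v u w =
      ∑' n : ℤ, muCoeff k j j' τ v w n / (1 - e v * e (n * τ)) * e (n * u) := by
  rw [muNum, ← tsum_mul_left]
  refine tsum_congr fun n => ?_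
  rw [← e_add u, ← e_sub, e_zpow, muCoeff, show (n : ℂ) * (u + (1 - 2 / k) * w - (1 - 2 / k) * v) =
    n * ((1 - 2 / k) * (w - v)) + n * u by ring, e_add _ (n * u), e_add _ (n * (_ * (w - v))),
    e_add ((n : ℂ) ^ 2 / k * τ)]
  ring

/-- By the selection rule every coset character in the sum vanishes. The modular sum runs over all
pairs (p, p'), including those of unequal parity. -/
lemma muNum_eq_zero {k : ℕ} (hk : 2 ≤ k) {j j' : ℤ} (hj : k = 2 → j = 1)
    (hjj' : ¬ j ≡ j' [ZMOD 2]) {τ : ℂ} (hτ : 0 < τ.im) (v u w : ℂ) :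
    muNum k j j' τ v u w = 0 := by
  have : ∀ n : ℤ, susyChar k 1 1 (j - 1) (2 * n + j') τ (w - v) = 0 := fun n => by
    refine susyChar_eq_zero hk (fun h => by rw [hj h, sub_self]) hτ (fun h => hjj' ?_) _
    unfold Int.ModEq at h ⊢
    omega
  simp [muNum, this]

/-- This is the branching rule restricted to t = 2n + j'. The selection rule makes the other t
contribute nothing, and (2n+j')²/4k = n²/k + j'n/k + j'²/4k accounts for the prefactor. -/
lemma hasSum_muCoeff {k : ℕ} (hk : 2 ≤ k) {j j' : ℤ} (hj : k = 2 → j = 1)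
    (hjj' : j ≡ j' [ZMOD 2]) {τ : ℂ} (hτ : 0 < τ.im) (v u w : ℂ) :
    HasSum (fun n : ℤ => muCoeff k j j' τ v w n * e (n * u))
      (e (-((j' : ℂ) ^ 2 / (4 * k) * τ) - j' / 2 * (u - v + w * (1 - 2 / k))) *
        affineChar (k - 2) (j - 1) τ (u - v + w) * theta11 τ u) := by
  have hl : k = 2 → j - 1 = 0 := fun h => by rw [hj h, sub_self]
  have hk0 : (k : ℂ) ≠ 0 := by exact_mod_cast (by omega : k ≠ 0)
  have h := hasSum_susyChar hk hl hτ (u - v + w) u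
  rw [show u - v + w - u = w - v by ring] at h
  have hinj : Function.Injective fun n : ℤ => 2 * n + j' := fun a b h => by simpa using h
  rw [← hinj.hasSum_iff] at h
  · have h2 := h.mul_left (e (-((j' : ℂ) ^ 2 / (4 * k) * τ) - j' / 2 *
      (u - v + w * (1 - 2 / k))))
    rw [← mul_assoc] at h2
    refine (congrArg (fun f : ℤ → ℂ => HasSum f _) (funext fun n => ?_)).mpr h2
    rw [Function.comp_apply, ← mul_assoc, thetaTerm, ← e_add, muCoeff, ← mul_assoc, mul_right_comm,
      ← e_add, ← e_add]
    congr 2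
    push_cast
    field_simp
    ring
  · intro t ht
    rw [susyChar_eq_zero hk hl hτ, mul_zero]
    intro h3
    refine ht ⟨(t - j') / 2, ?_⟩
    unfold Int.ModEq at h3 hjj'
    simp only
    omega

lemma differentiable_muNum {k : ℕ} (hk : 2 ≤ k) {j j' : ℤ} (hj : k = 2 → j = 1) {τ : ℂ}
    (hτ : 0 < τ.im) (v w : ℂ) : Differentiable ℂ fun u => muNum k j j' τ v u w := by
  by_cases hjj' : j ≡ j' [ZMOD 2]
  · simp only [muNum_eq_tsum]
    exact differentiable_appell (fun z => (hasSum_muCoeff hk hj hjj' hτ v z w).summable) hτ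
  · simp only [muNum_eq_zero hk hj hjj' hτ]
    exact differentiable_const 0

lemma muNum_add_one (k : ℕ) (j j' : ℤ) (τ v u w : ℂ) :
    muNum k j j' τ v (u + 1) w = muNum k j j' τ v u w := by
  rw [muNum_eq_tsum, muNum_eq_tsum, appell_add_one]

/-- The inhomogeneous quasi-periodicity of the Appell–Lerch sums. -/
lemma muNum_sub_period {k : ℕ} (hk : 2 ≤ k) {j j' : ℤ} (hj : k = 2 → j = 1)
    (hjj' : j ≡ j' [ZMOD 2]) {τ : ℂ} (hτ : 0 < τ.im) {v : ℂ} (hv : ∀ a b : ℤ, v ≠ a * τ + b)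
    (u w : ℂ) :
    muNum k j j' τ v u w - e v * muNum k j j' τ v (u + τ) w =
      e (-((j' : ℂ) ^ 2 / (4 * k) * τ) - j' / 2 * (u - v + w * (1 - 2 / k))) *
        affineChar (k - 2) (j - 1) τ (u - v + w) * theta11 τ u := by
  rw [muNum_eq_tsum, muNum_eq_tsum, appell_sub_period
    (fun z => (hasSum_muCoeff hk hj hjj' hτ v z w).summable) hτ hv,
    (hasSum_muCoeff hk hj hjj' hτ v u w).tsum_eq]

/-! ### Mordell integrals -/

open MeasureTheory

/-- The Gaussian factor of the Mordell integrals. -/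
noncomputable def mordellGauss (k : ℕ) (τ U s : ℂ) : ℂ :=
  exp (2 * Real.pi * I * k * τ * s ^ 2 - 2 * Real.pi * k * U * s)

/-- The denominator of the Mordell integrals. -/
noncomputable def mordellDen (k : ℕ) (r : ℤ) (s : ℂ) : ℂ :=
  1 - exp (2 * Real.pi * s - Real.pi * I * r / k)

lemma mordell_half (k : ℕ) (r : ℤ) (τ U : ℂ) :
    mordell k r τ (U / 2) = I * ∫ x : ℝ, mordellGauss k τ U x / mordellDen k r x := by
  rw [mordell]
  congr 2
  funext x
  rw [mordellGauss, mordellDen]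
  congr 3
  ring

lemma mordellDen_congr {k : ℕ} (hk : k ≠ 0) {r s : ℤ} (n : ℤ) (h : r = s + 2 * k * n) (x : ℂ) :
    mordellDen k r x = mordellDen k s x := by
  have hk0 : (k : ℂ) ≠ 0 := by exact_mod_cast hk
  rw [mordellDen, mordellDen, h, show 2 * Real.pi * x - Real.pi * I * ((s + 2 * k * n : ℤ) : ℂ) / k =
    2 * Real.pi * x - Real.pi * I * s / k + ((-n : ℤ) : ℂ) * (2 * Real.pi * I) by
      push_cast; field_simp; ring, Complex.exp_add, Complex.exp_int_mul_two_pi_mul_I, mul_one]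

lemma mordell_congr {k : ℕ} (hk : k ≠ 0) {r s : ℤ} (n : ℤ) (h : r = s + 2 * k * n) (τ U : ℂ) :
    mordell k r τ (U / 2) = mordell k s τ (U / 2) := by
  simp only [mordell_half, mordellDen_congr hk n h]

/-- The real part of the exponent of the Gaussian factor. -/
lemma norm_mordellGauss (k : ℕ) (τ U : ℂ) (x y : ℝ) :
    ‖mordellGauss k τ U (x + y * I)‖ = Real.exp (-(2 * Real.pi * k) *
      (τ.im * x ^ 2 - τ.im * y ^ 2 + 2 * τ.re * x * y + U.re * x - U.im * y)) := by
  rw [mordellGauss, Complex.norm_exp]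
  congr 1
  simp [pow_two]
  ring

lemma norm_mordellGauss_real (k : ℕ) (τ U : ℂ) (x : ℝ) :
    ‖mordellGauss k τ U x‖ = Real.exp (-(2 * Real.pi * k) * (τ.im * x ^ 2 + U.re * x)) := by
  have := norm_mordellGauss k τ U x 0
  simpa using this

lemma differentiable_mordellGauss (k : ℕ) (τ U : ℂ) : Differentiable ℂ (mordellGauss k τ U) := by
  unfold mordellGauss
  fun_prop

lemma differentiable_mordellDen (k : ℕ) (r : ℤ) : Differentiable ℂ (mordellDen k r) := by
  unfold mordellDen
  fun_prop

lemma mordellDen_eq_zero_iff {k : ℕ} (hk : k ≠ 0) {r : ℤ} {s : ℂ} :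
    mordellDen k r s = 0 ↔ ∃ m : ℤ, s = (r / (2 * k) + m) * I := by
  have hk0 : (k : ℂ) ≠ 0 := by exact_mod_cast hk
  have hpi : (Real.pi : ℂ) ≠ 0 := by exact_mod_cast Real.pi_ne_zero
  rw [mordellDen, sub_eq_zero, eq_comm, Complex.exp_eq_one_iff]
  refine exists_congr fun m => ⟨fun h => ?_, fun h => ?_⟩
  · refine mul_left_cancel₀ (mul_ne_zero two_ne_zero hpi) ?_
    have : 2 * Real.pi * s = m * (2 * Real.pi * I) + Real.pi * I * r / k := by
      linear_combination h
    rw [this]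
    field_simp
    ring
  · rw [h]
    field_simp
    ring

/-- Multiplication by the phase e^(πir/k) makes the exponential real, so the imaginary part is
sin(πr/k), independent of x. -/
lemma mordellDen_im {k : ℕ} (r : ℤ) (x : ℝ) :
    |Real.sin (Real.pi * r / k)| ≤ ‖mordellDen k r x‖ := by
  have h1 : mordellDen k r x = exp (-((Real.pi * r / k : ℝ) : ℂ) * I) *
      (exp (((Real.pi * r / k : ℝ) : ℂ) * I) - (Real.exp (2 * Real.pi * x) : ℝ)) := by
    rw [mordellDen, mul_sub, ← Complex.exp_add, Complex.ofReal_exp, ← Complex.exp_add]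
    rw [neg_mul, neg_add_cancel, Complex.exp_zero]
    congr 2
    push_cast
    ring
  rw [h1, norm_mul, show -((Real.pi * r / k : ℝ) : ℂ) * I = ((-(Real.pi * r / k) : ℝ) : ℂ) * I by
    push_cast; ring, Complex.norm_exp_ofReal_mul_I, one_mul]
  refine le_trans (le_of_eq ?_) (Complex.abs_im_le_norm _)
  rw [Complex.sub_im, Complex.exp_ofReal_mul_I_im, Complex.ofReal_im, sub_zero]

lemma sin_pi_mul_div_ne_zero {k : ℕ} (hk : k ≠ 0) {r : ℤ} (hr : ¬ (k : ℤ) ∣ r) :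
    Real.sin (Real.pi * r / k) ≠ 0 := by
  have hk0 : (k : ℝ) ≠ 0 := by exact_mod_cast hk
  rw [Real.sin_ne_zero_iff]
  intro n h
  refine hr ⟨n, ?_⟩
  have h2 : Real.pi * (r : ℝ) = Real.pi * (k * n : ℝ) := by
    field_simp at h
    linear_combination Real.pi * -h
  exact_mod_cast mul_left_cancel₀ Real.pi_ne_zero h2

lemma mordellDen_ne_zero {k : ℕ} (hk : k ≠ 0) {r : ℤ} (hr : ¬ (k : ℤ) ∣ r) (x : ℝ) :
    mordellDen k r x ≠ 0 := by
  rw [← norm_pos_iff]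
  exact lt_of_lt_of_le (abs_pos.mpr (sin_pi_mul_div_ne_zero hk hr)) (mordellDen_im r x)

lemma re_mordell_quadratic_neg {k : ℕ} (hk : k ≠ 0) {τ : ℂ} (hτ : 0 < τ.im) :
    (2 * Real.pi * I * k * τ).re < 0 := by
  have h : 2 * Real.pi * I * k * τ = ((2 * Real.pi * k : ℝ) : ℂ) * (I * τ) := by push_cast; ring
  have hk0 : (0 : ℝ) < k := by exact_mod_cast Nat.pos_of_ne_zero hk
  have hp := Real.pi_pos
  rw [h, Complex.re_ofReal_mul]
  have : 0 < 2 * Real.pi * k * τ.im := by positivity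
  simpa using this

lemma integrable_mordellGauss {k : ℕ} (hk : k ≠ 0) {τ : ℂ} (hτ : 0 < τ.im) (U : ℂ) :
    Integrable fun x : ℝ => mordellGauss k τ U x := by
  refine (integrable_cexp_quadratic' (re_mordell_quadratic_neg hk hτ) (-(2 * Real.pi * k * U))
    0).congr (Eventually.of_forall fun x => ?_)
  simp only [mordellGauss]
  congr 1
  ring

lemma continuous_mordell_integrand {k : ℕ} (hk : k ≠ 0) {r : ℤ} (hr : ¬ (k : ℤ) ∣ r) (τ U : ℂ) :
    Continuous fun x : ℝ => mordellGauss k τ U x / mordellDen k r x :=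
  ((differentiable_mordellGauss k τ U).continuous.comp Complex.continuous_ofReal).div
    ((differentiable_mordellDen k r).continuous.comp Complex.continuous_ofReal)
    (mordellDen_ne_zero hk hr)

lemma norm_mordell_integrand_le {k : ℕ} (hk : k ≠ 0) {r : ℤ} (hr : ¬ (k : ℤ) ∣ r) (τ U : ℂ)
    (x : ℝ) : ‖mordellGauss k τ U x / mordellDen k r x‖ ≤
      ‖mordellGauss k τ U x‖ * |Real.sin (Real.pi * r / k)|⁻¹ := by
  rw [norm_div, div_eq_mul_inv]
  have := abs_pos.mpr (sin_pi_mul_div_ne_zero hk hr)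
  have := mordellDen_im (k := k) r x
  gcongr

lemma integrable_mordell {k : ℕ} (hk : k ≠ 0) {r : ℤ} (hr : ¬ (k : ℤ) ∣ r) {τ : ℂ}
    (hτ : 0 < τ.im) (U : ℂ) :
    Integrable fun x : ℝ => mordellGauss k τ U x / mordellDen k r x :=
  ((integrable_mordellGauss hk hτ U).norm.mul_const _).mono'
    (continuous_mordell_integrand hk hr τ U).aestronglyMeasurable
    (Eventually.of_forall (norm_mordell_integrand_le hk hr τ U))

/-- The Mordell integrals are entire functions. -/
lemma differentiable_mordell {k : ℕ} (hk : k ≠ 0) {r : ℤ} (hr : ¬ (k : ℤ) ∣ r) {τ : ℂ}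
    (hτ : 0 < τ.im) : Differentiable ℂ fun U => mordell k r τ (U / 2) := by
  simp only [mordell_half]
  refine Differentiable.const_mul (fun U₀ => ?_) I
  set S := |Real.sin (Real.pi * r / k)|⁻¹ with hS
  -- Moving U in the unit ball changes its real part by less than 1, and the factor 2πk|x| ≤
  -- e^(2πk|x|) costs 1 more. Hence the shifts by ±2, one for each sign of x.
  set bound : ℝ → ℝ := fun x => (‖mordellGauss k τ (U₀.re - 2 : ℝ) x‖ +
    ‖mordellGauss k τ (U₀.re + 2 : ℝ) x‖) * S with hbound
  have hp := Real.pi_pos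
  have hk0 : (0 : ℝ) < k := by exact_mod_cast Nat.pos_of_ne_zero hk
  have hDc : Continuous fun x : ℝ => mordellDen k r x :=
    (differentiable_mordellDen k r).continuous.comp Complex.continuous_ofReal
  have hGc : ∀ U, Continuous fun x : ℝ => mordellGauss k τ U x := fun U =>
    (differentiable_mordellGauss k τ U).continuous.comp Complex.continuous_ofReal
  refine (hasDerivAt_integral_of_dominated_loc_of_deriv_le (𝕜 := ℂ) (μ := volume)
    (F := fun U (x : ℝ) => mordellGauss k τ U x / mordellDen k r x)
    (F' := fun U (x : ℝ) => mordellGauss k τ U x * (-(2 * Real.pi * k * x)) / mordellDen k r x)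
    (s := Metric.ball U₀ 1) (bound := bound) (x₀ := U₀)
    (Metric.ball_mem_nhds U₀ one_pos)
    (Eventually.of_forall fun U => (continuous_mordell_integrand hk hr τ U).aestronglyMeasurable)
    (integrable_mordell hk hr hτ U₀)
    ?_ ?_ ?_ ?_).2.differentiableAt
  · exact Continuous.aestronglyMeasurable
      (((hGc U₀).mul (by fun_prop)).div hDc (mordellDen_ne_zero hk hr))
  · refine Eventually.of_forall fun x U hU => ?_
    have hre : |U.re - U₀.re| < 1 := by
      rw [← Complex.sub_re]
      exact (Complex.abs_re_le_norm _).trans_lt (by simpa [dist_eq_norm] using hU)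
    rw [abs_lt] at hre
    rw [mul_div_right_comm, norm_mul]
    have h1 : ‖(-(2 * Real.pi * k * x) : ℂ)‖ ≤ Real.exp (2 * Real.pi * k * |x|) := by
      have h2 : ‖(-(2 * Real.pi * k * x) : ℂ)‖ = 2 * Real.pi * k * |x| := by
        simp [abs_of_pos hp]
      rw [h2]
      linarith [Real.add_one_le_exp (2 * Real.pi * k * |x|)]
    calc ‖mordellGauss k τ U x / mordellDen k r x‖ * ‖(-(2 * Real.pi * k * x) : ℂ)‖
        ≤ (‖mordellGauss k τ U x‖ * S) * Real.exp (2 * Real.pi * k * |x|) := by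
          gcongr
          exact norm_mordell_integrand_le hk hr τ U x
      _ = (‖mordellGauss k τ U x‖ * Real.exp (2 * Real.pi * k * |x|)) * S := by ring
      _ ≤ bound x := by
          simp only [hbound]
          gcongr
          simp only [norm_mordellGauss_real, Complex.ofReal_re, ← Real.exp_add]
          rcases le_total 0 x with hx | hx
          · have : Real.exp (-(2 * Real.pi * k) * (τ.im * x ^ 2 + U.re * x) +
                2 * Real.pi * k * |x|) ≤
                Real.exp (-(2 * Real.pi * k) * (τ.im * x ^ 2 + (U₀.re - 2) * x)) := by
              rw [Real.exp_le_exp, abs_of_nonneg hx]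
              have : 0 ≤ (2 * Real.pi * k) * (x * (U.re - U₀.re + 1)) := by
                have : 0 ≤ U.re - U₀.re + 1 := by linarith
                positivity
              linarith
            linarith [Real.exp_pos (-(2 * Real.pi * k) * (τ.im * x ^ 2 + (U₀.re + 2) * x))]
          · have : Real.exp (-(2 * Real.pi * k) * (τ.im * x ^ 2 + U.re * x) +
                2 * Real.pi * k * |x|) ≤
                Real.exp (-(2 * Real.pi * k) * (τ.im * x ^ 2 + (U₀.re + 2) * x)) := by
              rw [Real.exp_le_exp, abs_of_nonpos hx]
              have : 0 ≤ (2 * Real.pi * k) * ((-x) * (U₀.re - U.re + 1)) := by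
                have : 0 ≤ U₀.re - U.re + 1 := by linarith
                have : 0 ≤ -x := by linarith
                positivity
              linarith
            linarith [Real.exp_pos (-(2 * Real.pi * k) * (τ.im * x ^ 2 + (U₀.re - 2) * x))]
  · exact (((integrable_mordellGauss hk hτ _).norm).add
      ((integrable_mordellGauss hk hτ _).norm)).mul_const S
  · refine Eventually.of_forall fun x U _ => ?_
    have h1 : HasDerivAt (fun V : ℂ => 2 * Real.pi * I * k * τ * (x : ℂ) ^ 2 -
        2 * Real.pi * k * V * (x : ℂ)) (-(2 * Real.pi * k * (x : ℂ))) U := by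
      have h2 : HasDerivAt (fun V : ℂ => 2 * Real.pi * k * V * (x : ℂ))
          (2 * Real.pi * k * (x : ℂ)) U := by
        have h3 := ((hasDerivAt_id U).const_mul (2 * Real.pi * k : ℂ)).mul_const (x : ℂ)
        rwa [mul_one] at h3
      exact h2.const_sub _
    exact h1.cexp.div_const _

/-! #### The translation `U ↦ U + 1` -/

lemma integral_mordellGauss {k : ℕ} (hk : k ≠ 0) {τ : ℂ} (hτ : 0 < τ.im) (U : ℂ) :
    ∫ x : ℝ, mordellGauss k τ U x =
      1 / (-I * (2 * k * τ)) ^ (1 / 2 : ℂ) * e (k * U ^ 2 / (4 * τ)) := by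
  have hk0 : (k : ℂ) ≠ 0 := by exact_mod_cast hk
  have hτ0 : τ ≠ 0 := fun h => by simp [h] at hτ
  have hpi : (Real.pi : ℂ) ≠ 0 := by exact_mod_cast Real.pi_ne_zero
  have h := integral_cexp_quadratic (re_mordell_quadratic_neg hk hτ) (-(2 * Real.pi * k * U)) 0
  have h1 : ∀ x : ℝ, mordellGauss k τ U x =
      cexp (2 * Real.pi * I * k * τ * x ^ 2 + -(2 * Real.pi * k * U) * x + 0) := fun x => by
    rw [mordellGauss]
    congr 1
    ring
  simp only [h1]
  rw [h]
  congr 1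
  · have h2 : (Real.pi : ℂ) / -(2 * Real.pi * I * k * τ) = (-I * (2 * k * τ))⁻¹ := by
      field_simp
    -- The real part is 2k·Im τ > 0, so inversion stays away from the branch cut.
    have harg : (-I * (2 * k * τ)).arg ≠ Real.pi := by
      intro harg
      have h3 := (Complex.arg_eq_pi_iff.mp harg).1
      have h4 := im_two_mul_nat_mul hk hτ
      have h5 : (-I * (2 * k * τ)).re = (2 * k * τ).im := by simp
      rw [h5] at h3
      linarith
    rw [h2, Complex.inv_cpow _ _ harg, one_div (_ ^ _)]
  · rw [e]
    congr 1
    field_simp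
    rw [Complex.I_sq]
    ring

/-- With Y = e^(-2πx+πir/k) the translation, corrected by (-1)^r, multiplies the Gaussian by Y^k,
and (Y^k - 1)/(1 - Y⁻¹) = Y + ⋯ + Y^k has no denominator. -/
lemma mordell_add_one {k : ℕ} (hk : k ≠ 0) {r : ℤ} (hr : ¬ (k : ℤ) ∣ r) {τ : ℂ}
    (hτ : 0 < τ.im) (U : ℂ) :
    (-1) ^ r * mordell k r τ ((U + 1) / 2) - mordell k r τ (U / 2) =
      I * ∑ p ∈ Finset.range k, e (r * (p + 1) / (2 * k)) *
        ∫ x : ℝ, mordellGauss k τ (U + (p + 1) / k) x := by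
  have hk0 : (k : ℂ) ≠ 0 := by exact_mod_cast hk
  rw [mordell_half, mordell_half, mul_left_comm, ← mul_sub, ← integral_const_mul, ← integral_sub
    ((integrable_mordell hk hr hτ (U + 1)).const_mul _) (integrable_mordell hk hr hτ U)]
  congr 1
  simp only [← integral_const_mul]
  rw [← integral_finsetSum _ fun p _ => (integrable_mordellGauss hk hτ _).const_mul _]
  congr 1
  funext x
  have hD := mordellDen_ne_zero hk hr x
  set Y : ℂ := exp (-(2 * Real.pi * x - Real.pi * I * r / k)) with hY
  have hY0 : Y ≠ 0 := Complex.exp_ne_zero _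
  have hDY : mordellDen k r x = 1 - Y⁻¹ := by
    rw [mordellDen, hY, ← Complex.exp_neg, neg_neg]
  have hterm : ∀ p ∈ Finset.range k, e (r * (p + 1) / (2 * k)) *
      mordellGauss k τ (U + (p + 1) / k) x = mordellGauss k τ U x * (Y * Y ^ p) := by
    intro p _
    rw [← pow_succ', hY, ← Complex.exp_nat_mul, mordellGauss, mordellGauss, e, ← Complex.exp_add,
      ← Complex.exp_add]
    congr 1
    push_cast
    field_simp
    ring
  have hone : (-1) ^ r * mordellGauss k τ (U + 1) x = mordellGauss k τ U x * Y ^ k := by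
    rw [← e_int_half, hY, ← Complex.exp_nat_mul, mordellGauss, mordellGauss, e, ← Complex.exp_add,
      ← Complex.exp_add]
    congr 1
    field_simp
    ring
  rw [Finset.sum_congr rfl hterm, ← Finset.mul_sum, ← Finset.mul_sum, ← mul_div_assoc, hone,
    ← sub_div, div_eq_iff hD, hDY]
  have hg := geom_sum_mul Y k
  field_simp
  linear_combination -mordellGauss k τ U x * hg

lemma mordellHat_add_one {k : ℕ} (hk : k ≠ 0) {r : ℤ} (hr : ¬ (k : ℤ) ∣ r) {τ : ℂ}
    (hτ : 0 < τ.im) (U : ℂ) :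
    (-1) ^ r * mordellHat k r τ (U + 1) - mordellHat k r τ U =
      -4 / (-I * (2 * k * τ)) ^ (1 / 2 : ℂ) * ∑ p ∈ Finset.Icc (1 : ℤ) (k - 1),
        (Real.sin (Real.pi * r * p / k) : ℝ) * e ((k * U + p) ^ 2 / (4 * k * τ)) := by
  have hk0 : (k : ℂ) ≠ 0 := by exact_mod_cast hk
  have hkr : (k : ℝ) ≠ 0 := by exact_mod_cast hk
  have hτ0 : τ ≠ 0 := fun h => by simp [h] at hτ
  have h1 := mordell_add_one hk hr hτ U
  have h2 := mordell_add_one hk (r := -r) (by rwa [dvd_neg]) hτ U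
  have hsign : (-1 : ℂ) ^ (-r) = (-1) ^ r := by
    rw [zpow_neg, ← inv_zpow, inv_neg_one]
  rw [hsign] at h2
  have h3 : (-1) ^ r * mordellHat k r τ (U + 1) - mordellHat k r τ U = 2 *
      (I * ∑ p ∈ Finset.range k, (e (r * (p + 1) / (2 * k)) - e ((-r : ℤ) * (p + 1) / (2 * k))) *
        ∫ x : ℝ, mordellGauss k τ (U + (p + 1) / k) x) := by
    simp only [sub_mul, Finset.sum_sub_distrib, mul_sub]
    rw [← h1, ← h2, mordellHat, mordellHat]
    ring
  have h4 : ∀ p : ℕ, e (r * (p + 1) / (2 * k)) - e ((-r : ℤ) * (p + 1) / (2 * k)) =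
      2 * I * (Real.sin (Real.pi * r * (p + 1) / k) : ℝ) := fun p => by
    have := e_sub_e_neg (r * (p + 1) / k)
    rw [show Real.pi * (r * (p + 1) / k) = Real.pi * r * (p + 1) / k by ring] at this
    rw [← this]
    congr 2
    · push_cast
      field_simp
    · push_cast
      field_simp
  obtain ⟨n, hn⟩ := Nat.exists_eq_succ_of_ne_zero hk
  -- The last term of the geometric sum, Y^k, carries sin(πr) = 0; hence the sum over 1, …, k - 1.
  have h5 : Real.sin (Real.pi * r * ((n : ℕ) + 1) / k) = 0 := by
    rw [show Real.pi * r * ((n : ℕ) + 1) / k = r * Real.pi by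
      rw [hn]; push_cast; field_simp, Real.sin_int_mul_pi]
  rw [h3, show ((k : ℕ) : ℤ) - 1 = n by rw [hn]; push_cast; ring, sum_Icc_int_eq_sum_range]
  conv_lhs => rw [show Finset.range k = Finset.range (n + 1) by rw [hn], Finset.sum_range_succ]
  rw [h4 n, h5]
  simp only [h4, integral_mordellGauss hk hτ, Finset.mul_sum, Complex.ofReal_zero, mul_zero,
    zero_mul, add_zero]
  refine Finset.sum_congr rfl fun p _ => ?_
  rw [show (k * (U + (p + 1) / k) ^ 2 / (4 * τ) : ℂ) = (k * U + ((p + 1 : ℤ) : ℂ)) ^ 2 /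
    (4 * k * τ) by push_cast; field_simp, show Real.pi * r * ((p : ℝ) + 1) / k =
    Real.pi * r * ((p + 1 : ℤ) : ℝ) / k by push_cast; ring]
  linear_combination (4 * (1 / (-I * (2 * k * τ)) ^ (1 / 2 : ℂ)) *
    (Real.sin (Real.pi * r * ((p + 1 : ℤ) : ℝ) / k) : ℝ) *
    e ((k * U + ((p + 1 : ℤ) : ℂ)) ^ 2 / (4 * k * τ))) * I_sq

/-! #### The translation `U ↦ U + τ` -/

/-- Cauchy's theorem for the strip `0 ≤ Im s ≤ 1/2`. -/
lemma tendsto_integral_strip {R : ℂ → ℂ}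
    (hR : ∀ s : ℂ, 0 ≤ s.im → s.im ≤ 1 / 2 → DifferentiableAt ℂ R s) {B : ℝ → ℝ}
    (hB : Tendsto B atTop (𝓝 0))
    (hb : ∀ᶠ T : ℝ in atTop, ∀ y : ℝ, 0 ≤ y → y ≤ 1 / 2 →
      ‖R (T + y * I)‖ ≤ B T ∧ ‖R ((-T : ℝ) + y * I)‖ ≤ B T) :
    Tendsto (fun T : ℝ => (∫ x in (-T)..T, R x) - ∫ x in (-T)..T, R (x + ((1 / 2 : ℝ) : ℂ) * I))
      atTop (𝓝 0) := by
  refine squeeze_zero_norm' (a := fun T => B T) ?_ hB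
  filter_upwards [hb] with T hT
  have h := Complex.integral_boundary_rect_eq_zero_of_differentiableOn R
    ((-T : ℝ) : ℂ) (T + ((1 / 2 : ℝ) : ℂ) * I) (fun s hs => by
      have hs2 := hs.2
      simp only [Set.mem_preimage, Complex.ofReal_im, Complex.add_im, Complex.mul_im,
        Complex.ofReal_re, Complex.I_im, mul_one, Complex.I_re, mul_zero, add_zero, zero_add] at hs2
      rw [Set.uIcc_of_le (by norm_num)] at hs2
      exact (hR s hs2.1 hs2.2).differentiableWithinAt)
  simp only [Complex.ofReal_re, Complex.ofReal_im, Complex.add_re, Complex.add_im, Complex.mul_re,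
    Complex.mul_im, Complex.I_re, Complex.I_im, mul_one, mul_zero, add_zero, zero_add, sub_zero,
    Complex.ofReal_zero, zero_mul, smul_eq_mul] at h
  have h1 : ∀ {c : ℝ}, (∀ y : ℝ, 0 ≤ y → y ≤ 1 / 2 → ‖R (c + y * I)‖ ≤ B T) →
      ‖∫ y in (0 : ℝ)..(1 / 2), R (c + y * I)‖ ≤ B T / 2 := by
    intro c hc
    have := intervalIntegral.norm_integral_le_of_norm_le_const (a := (0 : ℝ)) (b := 1 / 2)
      (f := fun y : ℝ => R (c + y * I)) (C := B T) (fun y hy => by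
        rw [Set.uIoc_of_le (by norm_num)] at hy
        exact hc y hy.1.le hy.2)
    rw [sub_zero, abs_of_pos (by norm_num)] at this
    linarith
  have h2 := h1 (c := T) fun y h0 h1 => (hT y h0 h1).1
  have h3 := h1 (c := -T) fun y h0 h1 => (hT y h0 h1).2
  have h4 : (∫ x in (-T)..T, R x) - ∫ x in (-T)..T, R (x + ((1 / 2 : ℝ) : ℂ) * I) =
      I * (∫ y in (0 : ℝ)..(1 / 2), R ((-T : ℝ) + y * I)) -
        I * ∫ y in (0 : ℝ)..(1 / 2), R (T + y * I) := by
    linear_combination h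
  rw [h4]
  refine (norm_sub_le _ _).trans ?_
  rw [norm_mul, norm_mul, Complex.norm_I, one_mul, one_mul]
  linarith

/-- A primitive is ½ log(x²+a²) + i arctan(x/a). The logarithm is even and cancels between the
endpoints. -/
lemma integral_inv_sub_mul_I {a : ℝ} (ha : a ≠ 0) (T : ℝ) :
    ∫ x in (-T)..T, ((x : ℂ) - a * I)⁻¹ = 2 * I * (Real.arctan (T / a) : ℝ) := by
  have hpos : ∀ x : ℝ, 0 < x ^ 2 + a ^ 2 := fun x => by positivity
  have hne : ∀ x : ℝ, (x : ℂ) - a * I ≠ 0 := fun x h => ha (by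
    have := congrArg Complex.im h
    simpa using this)
  have hd : ∀ x : ℝ, HasDerivAt (fun x : ℝ => ((1 / 2 * Real.log (x ^ 2 + a ^ 2) : ℝ) : ℂ) +
      I * ((Real.arctan (x / a) : ℝ) : ℂ)) (((x : ℂ) - a * I)⁻¹) x := by
    intro x
    have h1 : HasDerivAt (fun x : ℝ => 1 / 2 * Real.log (x ^ 2 + a ^ 2))
        (x / (x ^ 2 + a ^ 2)) x := by
      have := ((((hasDerivAt_id' x).pow 2).add_const (a ^ 2)).log (hpos x).ne').const_mul (1 / 2)
      refine this.congr_deriv ?_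
      have := (hpos x).ne'
      simp only [Pi.pow_apply]
      field_simp
      norm_num
    have h2 : HasDerivAt (fun x : ℝ => Real.arctan (x / a)) (a / (x ^ 2 + a ^ 2)) x := by
      have := ((hasDerivAt_id' x).div_const a).arctan
      refine this.congr_deriv ?_
      have := (hpos x).ne'
      have h3 : 1 + (x / a) ^ 2 ≠ 0 := by positivity
      field_simp
      ring
    have h3 := h1.ofReal_comp.add (h2.ofReal_comp.const_mul I)
    refine h3.congr_deriv ?_
    have h4 : ((x : ℂ) ^ 2 + (a : ℂ) ^ 2) ≠ 0 := by exact_mod_cast (hpos x).ne'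
    symm
    refine inv_eq_of_mul_eq_one_right ?_
    push_cast
    field_simp
    linear_combination -(a : ℂ) ^ 2 * I_sq
  rw [intervalIntegral.integral_eq_sub_of_hasDerivAt (fun x _ => hd x)
    (Continuous.intervalIntegrable (Continuous.inv₀ (by fun_prop) hne) _ _)]
  rw [neg_sq, neg_div, Real.arctan_neg]
  push_cast
  ring

/-- Together with the case a < 0, this shows a jump of 2πi between lines below and above the pole,
which does the work of the residue theorem. -/
lemma tendsto_integral_inv_sub_of_pos {a : ℝ} (ha : 0 < a) :
    Tendsto (fun T : ℝ => ∫ x in (-T)..T, ((x : ℂ) - a * I)⁻¹) atTop (𝓝 (Real.pi * I)) := by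
  simp only [integral_inv_sub_mul_I ha.ne']
  have h := (Real.tendsto_arctan_atTop.mono_right nhdsWithin_le_nhds).comp
    (tendsto_id.atTop_div_const ha)
  have h2 : Tendsto (fun T : ℝ => 2 * I * ((Real.arctan (T / a) : ℝ) : ℂ)) atTop
      (𝓝 (2 * I * ((Real.pi / 2 : ℝ) : ℂ))) :=
    ((Complex.continuous_ofReal.tendsto _).comp h).const_mul (2 * I)
  rwa [show Real.pi * I = 2 * I * ((Real.pi / 2 : ℝ) : ℂ) by push_cast; ring]

lemma tendsto_integral_inv_sub_of_neg {a : ℝ} (ha : a < 0) :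
    Tendsto (fun T : ℝ => ∫ x in (-T)..T, ((x : ℂ) - a * I)⁻¹) atTop (𝓝 (-(Real.pi * I))) := by
  have h := (tendsto_integral_inv_sub_of_pos (neg_pos.mpr ha)).neg
  refine h.congr fun T => ?_
  rw [integral_inv_sub_mul_I ha.ne, integral_inv_sub_mul_I (neg_pos.mpr ha).ne', div_neg,
    Real.arctan_neg]
  push_cast
  ring

lemma half_le_norm_mordellDen (k : ℕ) (r : ℤ) {x : ℝ} (hx : 1 ≤ |x|) (y : ℝ) :
    1 / 2 ≤ ‖mordellDen k r (x + y * I)‖ := by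
  have h1 : ‖exp (2 * Real.pi * (x + y * I) - Real.pi * I * r / k)‖ =
      Real.exp (2 * Real.pi * x) := by
    rw [Complex.norm_exp]
    congr 1
    rw [show (2 * Real.pi * (x + y * I) - Real.pi * I * r / k : ℂ) =
      ((2 * Real.pi * x : ℝ) : ℂ) + ((2 * Real.pi * y - Real.pi * r / k : ℝ) : ℂ) * I by
        push_cast; ring]
    simp
  have hp := Real.pi_gt_three
  rw [mordellDen]
  rcases le_total 0 x with h0 | h0
  · rw [abs_of_nonneg h0] at hx
    have h2 := norm_sub_norm_le (exp (2 * Real.pi * (x + y * I) - Real.pi * I * r / k)) 1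
    rw [norm_sub_rev, norm_one, h1] at h2
    have h3 := Real.add_one_le_exp (2 * Real.pi * x)
    nlinarith
  · rw [abs_of_nonpos h0] at hx
    have h2 := norm_sub_norm_le 1 (exp (2 * Real.pi * (x + y * I) - Real.pi * I * r / k))
    rw [norm_one, h1] at h2
    have h3 := Real.add_one_le_exp (-(2 * Real.pi * x))
    have h4 : Real.exp (2 * Real.pi * x) ≤ 1 / 2 := by
      rw [show 2 * Real.pi * x = -(-(2 * Real.pi * x)) by ring, Real.exp_neg,
        inv_le_comm₀ (Real.exp_pos _) (by norm_num)]
      nlinarith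
    linarith

/-- Decay of the integrand of the Mordell integrals along vertical segments. -/
lemma exists_mordell_vertical_bound {k : ℕ} (hk : k ≠ 0) (r : ℤ) {τ : ℂ} (hτ : 0 < τ.im) (U : ℂ) :
    ∃ B : ℝ → ℝ, Tendsto B atTop (𝓝 0) ∧ ∀ x y : ℝ, 1 ≤ |x| → 0 ≤ y → y ≤ 1 / 2 →
      ‖mordellGauss k τ U (x + y * I) / mordellDen k r (x + y * I)‖ ≤ B |x| := by
  have hp := Real.pi_pos
  have hk0 : (0 : ℝ) < k := by exact_mod_cast Nat.pos_of_ne_zero hk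
  -- For 0 ≤ y ≤ 1/2, `M` bounds the terms linear in |x| and `N` those independent of x.
  set M := |τ.re| + |U.re| with hM
  set N := τ.im / 4 + |U.im| / 2 with hN
  refine ⟨fun T => 2 * Real.exp (-((2 * Real.pi * k) * (T * (τ.im * T + -M) + -N))), ?_, ?_⟩
  · have h1 : Tendsto (fun T : ℝ => τ.im * T + -M) atTop atTop :=
      tendsto_atTop_add_const_right _ _ (tendsto_id.const_mul_atTop hτ)
    have h2 : Tendsto (fun T : ℝ => T * (τ.im * T + -M) + -N) atTop atTop :=
      tendsto_atTop_add_const_right _ _ (tendsto_id.atTop_mul_atTop₀ h1)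
    have h3 := (Real.tendsto_exp_neg_atTop_nhds_zero.comp
      (h2.const_mul_atTop (show 0 < 2 * Real.pi * k by positivity))).const_mul 2
    rw [mul_zero] at h3
    exact h3
  · intro x y hx hy0 hy1
    have hD := half_le_norm_mordellDen k r hx y
    rw [norm_div, div_le_iff₀ (by linarith)]
    have hG : ‖mordellGauss k τ U (x + y * I)‖ ≤
        Real.exp (-((2 * Real.pi * k) * (|x| * (τ.im * |x| + -M) + -N))) := by
      rw [norm_mordellGauss, Real.exp_le_exp, neg_mul, neg_le_neg_iff]
      refine mul_le_mul_of_nonneg_left ?_ (by positivity)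
      have h1 : |x| * |x| = x ^ 2 := by rw [← sq, sq_abs]
      have h2 : -(|τ.re| * |x|) ≤ 2 * τ.re * x * y := by
        have h3 := neg_abs_le (τ.re * x)
        rw [abs_mul] at h3
        have h4 : 0 ≤ |τ.re| * |x| := by positivity
        nlinarith [abs_mul τ.re x, le_abs_self (τ.re * x)]
      have h3 : -(|U.re| * |x|) ≤ U.re * x := by
        rw [← abs_mul]
        exact neg_abs_le _
      have h4 : U.im * y ≤ |U.im| / 2 := by
        nlinarith [le_abs_self U.im, abs_nonneg U.im]
      have h5 : τ.im * y ^ 2 ≤ τ.im / 4 := by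
        have : y ^ 2 ≤ 1 / 4 := by nlinarith
        nlinarith
      have h6 : |x| * (τ.im * |x| + -M) + -N =
          τ.im * x ^ 2 - |τ.re| * |x| - |U.re| * |x| - τ.im / 4 - |U.im| / 2 := by
        rw [← h1, hM, hN]
        ring
      rw [h6]
      linarith
    have hE := Real.exp_pos (-((2 * Real.pi * k) * (|x| * (τ.im * |x| + -M) + -N)))
    nlinarith

/-- The shift by i/2 turns U into U + τ in the Gaussian, and its factor e^(πi) in the denominator
undoes the change r ↦ r + k. -/
lemma mordell_integrand_add_half_I {k : ℕ} (hk : k ≠ 0) (r : ℤ) (τ U : ℂ) (x : ℝ) :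
    mordellGauss k τ U (x + ((1 / 2 : ℝ) : ℂ) * I) /
      mordellDen k (r + k) (x + ((1 / 2 : ℝ) : ℂ) * I) =
      e (-(k / 4 * τ) - k / 2 * U) * (mordellGauss k τ (U + τ) x / mordellDen k r x) := by
  have hk0 : (k : ℂ) ≠ 0 := by exact_mod_cast hk
  rw [← mul_div_assoc]
  congr 1
  · rw [mordellGauss, mordellGauss, e, ← Complex.exp_add]
    congr 1
    push_cast
    linear_combination (2 * Real.pi * I * k * τ / 4 + 2 * Real.pi * k * τ * x) * I_sq
  · rw [mordellDen, mordellDen]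
    congr 2
    push_cast
    field_simp
    ring

lemma tendsto_integral_mordell_add_half_I {k : ℕ} (hk : k ≠ 0) {r : ℤ} (hr : ¬ (k : ℤ) ∣ r) {τ : ℂ}
    (hτ : 0 < τ.im) (U : ℂ) :
    Tendsto (fun T : ℝ => ∫ x in (-T)..T, mordellGauss k τ U (x + ((1 / 2 : ℝ) : ℂ) * I) /
      mordellDen k (r + k) (x + ((1 / 2 : ℝ) : ℂ) * I)) atTop
      (𝓝 (e (-(k / 4 * τ) - k / 2 * U) *
        ∫ x : ℝ, mordellGauss k τ (U + τ) x / mordellDen k r x)) := by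
  simp only [mordell_integrand_add_half_I hk]
  rw [← integral_const_mul]
  exact intervalIntegral_tendsto_integral ((integrable_mordell hk hr hτ _).const_mul _)
    tendsto_neg_atTop_atBot tendsto_id

lemma tendsto_integral_mordell {k : ℕ} (hk : k ≠ 0) {r : ℤ} (hr : ¬ (k : ℤ) ∣ r) {τ : ℂ}
    (hτ : 0 < τ.im) (U : ℂ) :
    Tendsto (fun T : ℝ => ∫ x in (-T)..T, mordellGauss k τ U x / mordellDen k r x) atTop
      (𝓝 (∫ x : ℝ, mordellGauss k τ U x / mordellDen k r x)) :=
  intervalIntegral_tendsto_integral (integrable_mordell hk hr hτ _)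
    tendsto_neg_atTop_atBot tendsto_id

lemma not_dvd_of_pos_lt {k r : ℤ} (h0 : 0 < r) (h1 : r < k) : ¬ k ∣ r :=
  fun h => absurd (Int.le_of_dvd h0 h) (not_le.mpr h1)

lemma mordellDen_zero_strip {k : ℕ} (hk : k ≠ 0) {r : ℤ} {s : ℂ} (hD : mordellDen k r s = 0)
    (hs0 : 0 ≤ s.im) (hs1 : s.im ≤ 1 / 2) :
    ∃ m : ℤ, s = ((r + 2 * k * m : ℤ) : ℂ) / (2 * k) * I ∧ 0 ≤ r + 2 * k * m ∧
      r + 2 * k * m ≤ k := by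
  have hk0 : (0 : ℝ) < k := by exact_mod_cast Nat.pos_of_ne_zero hk
  have hkc : (k : ℂ) ≠ 0 := by exact_mod_cast hk
  obtain ⟨m, rfl⟩ := (mordellDen_eq_zero_iff hk).mp hD
  have h1 : (((r : ℂ) / (2 * k) + m) * I).im = ((r + 2 * k * m : ℤ) : ℝ) / (2 * k) := by
    rw [show (((r : ℂ) / (2 * k) + m) * I) =
      ((((r + 2 * k * m : ℤ) : ℝ) / (2 * k) : ℝ) : ℂ) * I by push_cast; field_simp]
    simp only [Complex.mul_im, Complex.ofReal_re, Complex.ofReal_im, Complex.I_im, Complex.I_re,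
      mul_one, mul_zero, add_zero]
  rw [h1] at hs0 hs1
  refine ⟨m, by push_cast; field_simp, ?_, ?_⟩
  · rw [le_div_iff₀ (by positivity), zero_mul] at hs0
    exact_mod_cast hs0
  · rw [div_le_iff₀ (by positivity)] at hs1
    have : ((r + 2 * k * m : ℤ) : ℝ) ≤ (k : ℤ) := by push_cast at hs1 ⊢; linarith
    exact_mod_cast this

/-- The contour moves by i/2 without meeting a pole: poles in the strip correspond to
representatives of r + k modulo 2k in [0, k], and r + k lies strictly between k and 2k. -/
lemma mordell_add_period_of_pos {k : ℕ} {r : ℤ} (h0 : 0 < r) (h1 : r < k) {τ : ℂ}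
    (hτ : 0 < τ.im) (U : ℂ) :
    mordell k r τ ((U + τ) / 2) = e (k / 4 * τ + k / 2 * U) * mordell k (r + k) τ (U / 2) := by
  have hk : k ≠ 0 := by omega
  have hk0 : (0 : ℝ) < k := by exact_mod_cast Nat.pos_of_ne_zero hk
  have hr := not_dvd_of_pos_lt h0 h1
  have hr' : ¬ (k : ℤ) ∣ r + k := by rwa [dvd_add_self_right]
  obtain ⟨B, hB, hb⟩ := exists_mordell_vertical_bound hk (r + k) hτ U
  have h := tendsto_integral_strip
    (R := fun s => mordellGauss k τ U s / mordellDen k (r + k) s) (fun s hs0 hs1 => ?_) hB ?_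
  · have h2 := tendsto_nhds_unique h ((tendsto_integral_mordell hk hr' hτ U).sub
      (tendsto_integral_mordell_add_half_I hk hr hτ U))
    rw [show -(k / 4 * τ) - k / 2 * U = -(k / 4 * τ + k / 2 * U) by ring, e_neg] at h2
    rw [mordell_half, mordell_half, sub_eq_zero.mp h2.symm]
    have := e_ne_zero (k / 4 * τ + k / 2 * U)
    field_simp
  · refine (differentiable_mordellGauss k τ U s).div (differentiable_mordellDen k _ s) fun hD => ?_
    obtain ⟨m, -, hm0, hm1⟩ := mordellDen_zero_strip hk hD hs0 hs1
    have hm : m < 0 := by nlinarith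
    nlinarith
  · filter_upwards [eventually_ge_atTop 1] with T hT y hy0 hy1
    have hT' : |T| = T := abs_of_nonneg (by linarith)
    have h3 := hb T y (by rwa [hT']) hy0 hy1
    have h4 := hb (-T) y (by rwa [abs_neg, hT']) hy0 hy1
    rw [abs_neg] at h4
    rw [hT'] at h3 h4
    exact ⟨h3, h4⟩

/-- Here k - r lies strictly between 0 and k, so exactly one pole, i(k-r)/2k, is crossed; its
residue is the extra exponential. -/
lemma mordell_add_period_of_neg {k : ℕ} {r : ℤ} (h0 : 0 < r) (h1 : r < k) {τ : ℂ}
    (hτ : 0 < τ.im) (U : ℂ) :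
    mordell k (-r) τ ((U + τ) / 2) = e (k / 4 * τ + k / 2 * U) * (mordell k (k - r) τ (U / 2) -
      e (-((k - r) ^ 2 / (4 * k) * τ) - (k - r) / 2 * U)) := by
  have hk : k ≠ 0 := by omega
  have hk0 : (0 : ℝ) < k := by exact_mod_cast Nat.pos_of_ne_zero hk
  have hkc : (k : ℂ) ≠ 0 := by exact_mod_cast hk
  have hr : ¬ (k : ℤ) ∣ -r := by
    rw [dvd_neg]
    exact not_dvd_of_pos_lt h0 h1
  have hr' : ¬ (k : ℤ) ∣ -r + k := by rwa [dvd_add_self_right]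
  obtain ⟨B, hB, hb⟩ := exists_mordell_vertical_bound hk (-r + k) hτ U
  set β : ℝ := (-r + k : ℤ) / (2 * k) with hβ
  have hβ0 : 0 < β := by
    have : (0 : ℝ) < (-r + k : ℤ) := by exact_mod_cast (by omega : 0 < -r + (k : ℤ))
    positivity
  have hβ1 : β - 1 / 2 < 0 := by
    have : ((-r + k : ℤ) : ℝ) < (k : ℤ) := by exact_mod_cast (by omega : -r + (k : ℤ) < k)
    rw [sub_neg, hβ, div_lt_iff₀ (by positivity)]
    push_cast at this ⊢
    linarith
  set s₀ : ℂ := β * I with hs₀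
  set D := mordellDen k (-r + k) with hDdef
  set G := mordellGauss k τ U with hGdef
  have hD := differentiable_mordellDen k (-r + k)
  have hG := differentiable_mordellGauss k τ U
  have hDs₀ : D s₀ = 0 := by
    rw [hDdef, mordellDen_eq_zero_iff hk]
    exact ⟨0, by rw [hs₀, hβ]; push_cast; ring⟩
  have hD' : deriv D s₀ = -(2 * Real.pi) := by
    have h2 : HasDerivAt (fun s : ℂ => 2 * Real.pi * s - Real.pi * I * ((-r + k : ℤ) : ℂ) / k)
        (2 * Real.pi) s₀ := by
      have := ((hasDerivAt_id' s₀).const_mul (2 * Real.pi : ℂ)).sub_const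
        (Real.pi * I * ((-r + k : ℤ) : ℂ) / k)
      rwa [mul_one] at this
    have h3 := (h2.cexp.const_sub 1).deriv
    have h4 : D s₀ = 1 - exp (2 * Real.pi * s₀ - Real.pi * I * ((-r + k : ℤ) : ℂ) / k) := rfl
    rw [hDs₀] at h4
    rw [show exp (2 * Real.pi * s₀ - Real.pi * I * ((-r + k : ℤ) : ℂ) / k) = 1 by
      linear_combination h4, one_mul] at h3
    exact h3
  set D₁ := dslope D s₀ with hD₁
  have hD₁d : Differentiable ℂ D₁ := by
    rw [← differentiableOn_univ, hD₁, Complex.differentiableOn_dslope univ_mem]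
    exact hD.differentiableOn
  have hD₁s₀ : D₁ s₀ = -(2 * Real.pi) := by rw [hD₁, dslope_same, hD']
  have hpi : (Real.pi : ℂ) ≠ 0 := by exact_mod_cast Real.pi_ne_zero
  have hDfac : ∀ s, D s = (s - s₀) * D₁ s := fun s => by
    have := sub_smul_dslope D s₀ s
    rw [hDs₀, sub_zero, smul_eq_mul] at this
    exact this.symm
  set O : Set ℂ := {s | D₁ s ≠ 0} with hO
  have hOo : IsOpen O := isOpen_ne_fun hD₁d.continuous continuous_const
  have hs₀O : s₀ ∈ O := by
    rw [hO, Set.mem_ofPred_eq, hD₁s₀]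
    simp [Real.pi_ne_zero]
  set g : ℂ → ℂ := fun s => G s / D₁ s with hg
  have hgd : DifferentiableOn ℂ g O := hG.differentiableOn.div hD₁d.differentiableOn fun _ h => h
  set c : ℂ := g s₀ with hc
  -- Off the pole this is G/D - c/(s - s₀), with c the residue. It is holomorphic on the strip, so
  -- Cauchy's theorem applies and the subtracted term is integrated separately.
  set R := dslope g s₀ with hRdef
  have hRd : DifferentiableOn ℂ R O :=
    (Complex.differentiableOn_dslope (hOo.mem_nhds hs₀O)).mpr hgd
  have hRval : ∀ s, s ≠ s₀ → R s = G s / D s - c * (s - s₀)⁻¹ := by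
    intro s hs
    have hs' : s - s₀ ≠ 0 := sub_ne_zero.mpr hs
    rw [hRdef, dslope_of_ne _ hs, slope_def_field, hDfac, hg, hc, sub_div, div_div,
      mul_comm (D₁ s), div_eq_mul_inv (g s₀)]
  have hne0 : ∀ x : ℝ, (x : ℂ) ≠ s₀ := fun x h => hβ0.ne (by
    have := congrArg Complex.im h
    simpa [hs₀] using this)
  have hne1 : ∀ x : ℝ, (x : ℂ) + ((1 / 2 : ℝ) : ℂ) * I ≠ s₀ := fun x h => hβ1.ne (by
    have := congrArg Complex.im h
    rw [hs₀] at this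
    simp at this
    linarith)
  have h := tendsto_integral_strip (R := R) (fun s hs0 hs1 => ?_)
    -- The integrand has Gaussian decay; the subtracted principal part decays only like 1/T.
    (B := fun T => B T + ‖c‖ * T⁻¹) ?_ ?_
  · have hval0 : Tendsto (fun T : ℝ => ∫ x in (-T)..T, R x) atTop
        (𝓝 ((∫ x : ℝ, G x / D x) - c * (Real.pi * I))) := by
      refine ((tendsto_integral_mordell hk hr' hτ U).sub
        ((tendsto_integral_inv_sub_of_pos hβ0).const_mul c)).congr fun T => ?_
      rw [← intervalIntegral.integral_const_mul, ← intervalIntegral.integral_sub]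
      · refine intervalIntegral.integral_congr fun x _ => ?_
        exact (hRval x (hne0 x)).symm
      · exact (integrable_mordell hk hr' hτ U).intervalIntegrable
      · refine Continuous.intervalIntegrable ?_ _ _
        exact continuous_const.mul (Continuous.inv₀ (by fun_prop)
          fun x => sub_ne_zero.mpr (hne0 x))
    have hval1 : Tendsto (fun T : ℝ => ∫ x in (-T)..T, R (x + ((1 / 2 : ℝ) : ℂ) * I)) atTop
        (𝓝 (e (-(k / 4 * τ) - k / 2 * U) *
          (∫ x : ℝ, mordellGauss k τ (U + τ) x / mordellDen k (-r) x) -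
          c * (-(Real.pi * I)))) := by
      refine ((tendsto_integral_mordell_add_half_I hk hr hτ U).sub
        ((tendsto_integral_inv_sub_of_neg hβ1).const_mul c)).congr fun T => ?_
      rw [← intervalIntegral.integral_const_mul, ← intervalIntegral.integral_sub]
      · refine intervalIntegral.integral_congr fun x _ => ?_
        rw [hRval _ (hne1 x)]
        congr 3
        rw [hs₀]
        push_cast
        ring
      · simp only [mordell_integrand_add_half_I hk]
        exact ((integrable_mordell hk hr hτ _).const_mul _).intervalIntegrable
      · refine Continuous.intervalIntegrable ?_ _ _
        refine continuous_const.mul (Continuous.inv₀ (by fun_prop) fun x h => hne1 x ?_)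
        rw [hs₀]
        push_cast at h ⊢
        linear_combination h
    have h2 := tendsto_nhds_unique h (hval0.sub hval1)
    have hcval : c = -(G s₀ / (2 * Real.pi)) := by
      rw [hc, hg]
      simp only
      rw [hD₁s₀, div_neg]
    have hGs₀ : G s₀ = e (-((k - r) ^ 2 / (4 * k) * τ) - (k - r) / 2 * U) := by
      rw [hGdef, mordellGauss, e, hs₀, hβ]
      congr 1
      push_cast
      field_simp
      linear_combination (4 * (k - r) ^ 2 * τ) * I_sq
    rw [hcval, hGs₀, show -(k / 4 * τ) - k / 2 * U = -(k / 4 * τ + k / 2 * U) by ring, e_neg] at h2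
    rw [mordell_half, mordell_half, show (k : ℤ) - r = -r + k by ring]
    have h3 := e_ne_zero (k / 4 * τ + k / 2 * U)
    set J₁ := ∫ x : ℝ, mordellGauss k τ (U + τ) x / mordellDen k (-r) x
    set J₀ := ∫ x : ℝ, mordellGauss k τ U x / mordellDen k (-r + k) x
    set Eg := e (-((k - r) ^ 2 / (4 * k) * τ) - (k - r) / 2 * U)
    set P := e (k / 4 * τ + k / 2 * U)
    have h4 : P⁻¹ * J₁ = J₀ + I * Eg := by
      have h5 : -(Eg / (2 * Real.pi)) * (Real.pi * I) * 2 = -(I * Eg) := by field_simp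
      linear_combination h2 - h5
    have h6 : J₁ = P * (J₀ + I * Eg) := by rw [← h4]; field_simp
    rw [h6]
    linear_combination P * Eg * I_sq
  · refine hRd.differentiableAt (hOo.mem_nhds fun hz => ?_)
    have hDs : D s = 0 := by rw [hDfac, hz, mul_zero]
    obtain ⟨m, hm, hm0, hm1⟩ := mordellDen_zero_strip hk hDs hs0 hs1
    have hm2 : m = 0 := by
      rcases lt_trichotomy m 0 with h2 | h2 | h2
      · nlinarith
      · exact h2
      · nlinarith
    have : s = s₀ := by
      rw [hm, hm2, hs₀, hβ]
      push_cast
      ring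
    exact hs₀O (this ▸ hz)
  · simpa using hB.add (tendsto_inv_atTop_zero.const_mul ‖c‖)
  · filter_upwards [eventually_ge_atTop 1] with T hT y hy0 hy1
    have hT0 : 0 < T := by linarith
    have key : ∀ x : ℝ, |x| = T → ‖R (x + y * I)‖ ≤ B T + ‖c‖ * T⁻¹ := by
      intro x hx
      have h2 := hb x y (by rwa [hx]) hy0 hy1
      have h3 : T ≤ ‖(x : ℂ) + y * I - s₀‖ := by
        refine le_trans (le_of_eq ?_) (Complex.abs_re_le_norm _)
        rw [← hx, hs₀]
        simp
      have hne : (x : ℂ) + y * I ≠ s₀ := fun h => by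
        rw [h, sub_self, norm_zero] at h3
        linarith
      rw [hRval _ hne]
      refine (norm_sub_le _ _).trans ?_
      rw [hx] at h2
      rw [norm_mul, norm_inv]
      gcongr
    exact ⟨key T (abs_of_pos hT0), key (-T) (by rw [abs_neg, abs_of_pos hT0])⟩

/-- The behaviour of the Mordell integrals under `U ↦ U + τ`. -/
lemma mordellHat_add_period {k : ℕ} {r : ℤ} (h0 : 0 < r) (h1 : r < k) {τ : ℂ}
    (hτ : 0 < τ.im) (U : ℂ) :
    mordellHat k r τ (U + τ) = e (k / 4 * τ + k / 2 * U) * (-mordellHat k (k - r) τ U +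
      2 * e (-((k - r) ^ 2 / (4 * k) * τ) - (k - r) / 2 * U)) := by
  rw [mordellHat, mordell_add_period_of_pos h0 h1 hτ, mordell_add_period_of_neg h0 h1 hτ,
    mordell_congr (by omega) (r := r + k) (s := -(k - r)) 1 (by ring), mordellHat]
  ring

/-! ### The modular transformation -/

lemma affineChar_add_period_level {k : ℕ} (hk : 2 ≤ k) (l : ℤ) {τ : ℂ} (hτ : 0 < τ.im) (z : ℂ) :
    affineChar (k - 2) l τ (z + τ) =
      e (-((k - 2) / 4 * τ) - (k - 2) / 2 * z) * affineChar (k - 2) (k - 2 - l) τ z := by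
  rw [affineChar_add_period hτ, Nat.cast_sub hk, Nat.cast_sub hk]
  rfl

lemma affineChar_sub_period_level {k : ℕ} (hk : 2 ≤ k) (l : ℤ) {τ : ℂ} (hτ : 0 < τ.im) (z : ℂ) :
    affineChar (k - 2) l τ (z - τ) =
      e (-((k - 2) / 4 * τ) + (k - 2) / 2 * z) * affineChar (k - 2) (k - 2 - l) τ z := by
  rw [affineChar_sub_period hτ, Nat.cast_sub hk, Nat.cast_sub hk]
  rfl

lemma affineChar_S_level {k : ℕ} (hk : 2 ≤ k) (l : ℤ) {τ : ℂ} (hτ : 0 < τ.im) (z : ℂ) :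
    affineChar (k - 2) (l - 1) τ z = e (-((k - 2) * z ^ 2 / (4 * τ))) *
      ∑ p ∈ Finset.Icc (1 : ℤ) (k - 1),
        SHat k l p * affineChar (k - 2) (p - 1) (-1 / τ) (z / τ) := by
  rw [affineChar_S hτ, Nat.cast_sub hk, Nat.sub_add_cancel hk, sub_add_cancel]
  rfl

/-! ### Signs and reflections of the S-matrix. -/

lemma neg_one_zpow_sq (n : ℤ) : (-1 : ℂ) ^ n * (-1) ^ n = 1 := by
  rw [← mul_zpow]
  norm_num

lemma neg_one_zpow_congr {a b : ℤ} (h : a ≡ b [ZMOD 2]) : (-1 : ℂ) ^ a = (-1) ^ b := by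
  obtain ⟨m, hm⟩ := h.dvd
  rw [show b = a + 2 * m by linarith, zpow_add₀ (by norm_num), zpow_mul]
  norm_num

lemma neg_one_zpow_of_not_congr {a b : ℤ} (h : ¬ a ≡ b [ZMOD 2]) :
    (-1 : ℂ) ^ a = -(-1) ^ b := by
  have h1 : a ≡ b + 1 [ZMOD 2] := by
    unfold Int.ModEq at h ⊢
    omega
  rw [neg_one_zpow_congr h1, zpow_add_one₀ (by norm_num)]
  ring

lemma SHat_comm (k : ℕ) (l l' : ℤ) : SHat k l l' = SHat k l' l := by
  rw [SHat, SHat, mul_right_comm]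

lemma SHat_sub_left {k : ℕ} (hk : k ≠ 0) (l p : ℤ) :
    SHat k (k - l) p = -(-1) ^ p * SHat k l p := by
  have hk0 : (k : ℝ) ≠ 0 := by exact_mod_cast hk
  have h : Real.sin (Real.pi * ((k - l : ℤ) : ℝ) * p / k) =
      -(-1) ^ p * Real.sin (Real.pi * l * p / k) := by
    rw [show Real.pi * ((k - l : ℤ) : ℝ) * p / k = p * Real.pi - Real.pi * l * p / k by
      push_cast; field_simp, Real.sin_int_mul_pi_sub]
    ring
  rw [SHat, SHat, h]
  push_cast
  ring

lemma SHat_sub_right {k : ℕ} (hk : k ≠ 0) (l p : ℤ) :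
    SHat k l (k - p) = -(-1) ^ l * SHat k l p := by
  rw [SHat_comm, SHat_sub_left hk, SHat_comm]

lemma sum_Icc_reflect {M : Type*} [AddCommMonoid M] (k : ℕ) (f : ℤ → M) :
    ∑ p ∈ Finset.Icc (1 : ℤ) (k - 1), f (k - p) = ∑ p ∈ Finset.Icc (1 : ℤ) (k - 1), f p := by
  refine Finset.sum_nbij' (fun p => k - p) (fun p => k - p) ?_ ?_ ?_ ?_ ?_ <;>
    simp only [Finset.mem_Icc] <;> intros <;> first | trivial | omega

/-- Reflection of both indices in a sum against a product of two entries of the `S`-matrix. -/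
lemma sum_SHat_reflect {k : ℕ} (hk : k ≠ 0) {j j' : ℤ} (hjj' : j ≡ j' [ZMOD 2]) (f : ℤ → ℤ → ℂ) :
    ∑ p ∈ Finset.Icc (1 : ℤ) (k - 1), ∑ p' ∈ Finset.Icc (1 : ℤ) (k - 1),
        SHat k j p * SHat k j' p' * f (k - p) (k - p') =
      ∑ p ∈ Finset.Icc (1 : ℤ) (k - 1), ∑ p' ∈ Finset.Icc (1 : ℤ) (k - 1),
        SHat k j p * SHat k j' p' * f p p' := by
  rw [← sum_Icc_reflect]
  refine Finset.sum_congr rfl fun p _ => ?_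
  rw [← sum_Icc_reflect]
  refine Finset.sum_congr rfl fun p' _ => ?_
  rw [sub_sub_cancel, sub_sub_cancel, SHat_sub_right hk, SHat_sub_right hk, neg_one_zpow_congr hjj']
  linear_combination SHat k j p * SHat k j' p' * f p p' * neg_one_zpow_sq j'

/-- The inhomogeneous term in the quasi-periodicity of `μ^{k,j,j'}` in `u`. -/
noncomputable def muShift (k : ℕ) (j j' : ℤ) (τ v w u : ℂ) : ℂ :=
  e (-((j' : ℂ) ^ 2 / (4 * k) * τ) - j' / 2 * (u - v + w * (1 - 2 / k))) *
    affineChar (k - 2) (j - 1) τ (u - v + w)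

/-- The right-hand side of the transformation formula. -/
noncomputable def mordellSide (k : ℕ) (j j' : ℤ) (τ v w u : ℂ) : ℂ :=
  (1 / 4) * (affineChar (k - 2) (j - 1) τ (u - v + w) *
      mordellHat k j' τ (u - v + w * (1 - 2 / k)) +
    affineChar (k - 2) (k - j - 1) τ (u - v + w) *
      mordellHat k (k - j') τ (u - v + w * (1 - 2 / k)))

/-- The automorphy factor in the transformation formula. -/
noncomputable def muFactor (k : ℕ) (τ v w u : ℂ) : ℂ :=
  e ((u - v) ^ 2 / (2 * τ)) * e (-(w ^ 2 * (1 - 2 / k) / (2 * τ))) / (-I * τ) ^ (1 / 2 : ℂ)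

lemma differentiable_mordellHat {k : ℕ} {r : ℤ} (h0 : 0 < r) (h1 : r < k) {τ : ℂ}
    (hτ : 0 < τ.im) : Differentiable ℂ (mordellHat k r τ) := by
  have hr := not_dvd_of_pos_lt h0 h1
  exact ((differentiable_mordell (by omega) hr hτ).sub
    (differentiable_mordell (by omega) (by rwa [dvd_neg]) hτ)).const_mul 2

lemma differentiable_mordellSide {k : ℕ} {j j' : ℤ} (h0 : 0 < j') (h1 : j' < k) {τ : ℂ}
    (hτ : 0 < τ.im) (v w : ℂ) : Differentiable ℂ (mordellSide k j j' τ v w) := by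
  have hx : Differentiable ℂ fun u : ℂ => u - v + w := by fun_prop
  have hU : Differentiable ℂ fun u : ℂ => u - v + w * (1 - 2 / k) := by fun_prop
  have hX (l : ℤ) : Differentiable ℂ fun u => affineChar (k - 2) l τ (u - v + w) :=
    (differentiable_affineChar hτ (k - 2) l).comp hx
  have hH {r : ℤ} (h0 : 0 < r) (h1 : r < k) :
      Differentiable ℂ fun u => mordellHat k r τ (u - v + w * (1 - 2 / k)) :=
    (differentiable_mordellHat h0 h1 hτ).comp hU
  have h2 := ((hX (j - 1)).fun_mul (hH h0 h1)).fun_add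
    ((hX (k - j - 1)).fun_mul (hH (r := k - j') (by omega) (by omega)))
  exact h2.const_mul (1 / 4)

/-- The translation exchanges the two summands with a sign, in the character and in the Mordell
integral together. The homogeneous parts cancel, and only the residue terms survive; symmetrisation
is what makes this possible. -/
lemma mordellSide_add_period {k : ℕ} (hk : 2 ≤ k) (j : ℤ) {j' : ℤ} (h0 : 0 < j') (h1 : j' < k)
    {τ : ℂ} (hτ : 0 < τ.im) (v w u : ℂ) :
    mordellSide k j j' τ v w u + e v * e (-(τ / 2) - u) * mordellSide k j j' τ v w (u + τ) =
      1 / 2 * (muShift k j j' τ v w u + muShift k (k - j) (k - j') τ v w u) := by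
  have hk0 : (k : ℂ) ≠ 0 := by exact_mod_cast (by omega : k ≠ 0)
  have hH := mordellHat_add_period h0 h1 hτ (u - v + w * (1 - 2 / k))
  have hH' := mordellHat_add_period (k := k) (r := k - j') (by omega) (by omega) hτ (u - v + w * (1 - 2 / k))
  have hX := affineChar_add_period_level hk (j - 1) hτ (u - v + w)
  have hX' := affineChar_add_period_level hk (k - j - 1) hτ (u - v + w)
  rw [sub_sub_cancel] at hH'
  rw [show (k : ℤ) - 2 - (j - 1) = k - j - 1 by ring] at hX
  rw [show (k : ℤ) - 2 - (k - j - 1) = j - 1 by ring] at hX'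
  -- The level k - 2 factor of the character, the level k factor of the integral and the factor of
  -- θ₁₁ balance.
  have hfac : e v * e (-(τ / 2) - u) * (e (-((k - 2) / 4 * τ) - (k - 2) / 2 * (u - v + w)) *
      e (k / 4 * τ + k / 2 * (u - v + w * (1 - 2 / k)))) = 1 := by
    rw [← e_add, ← e_add, ← e_add]
    convert e_zero using 2
    field_simp
    ring
  simp only [mordellSide, muShift]
  rw [show u + τ - v + w = u - v + w + τ by ring,
    show u + τ - v + w * (1 - 2 / k) = u - v + w * (1 - 2 / k) + τ by ring, hH, hH', hX, hX']
  push_cast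
  rw [sub_sub_cancel]
  set E1 := e v * e (-(τ / 2) - u)
  set E2 := e (-((k - 2) / 4 * τ) - (k - 2) / 2 * (u - v + w))
  set E3 := e (k / 4 * τ + k / 2 * (u - v + w * (1 - 2 / k)))
  set X := affineChar (k - 2) (j - 1) τ (u - v + w)
  set X' := affineChar (k - 2) (k - j - 1) τ (u - v + w)
  set H := mordellHat k j' τ (u - v + w * (1 - 2 / k))
  set H' := mordellHat k (k - j') τ (u - v + w * (1 - 2 / k))
  set g := e (-((j' : ℂ) ^ 2 / (4 * k) * τ) - j' / 2 * (u - v + w * (1 - 2 / k)))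
  set g' := e (-(((k : ℂ) - j') ^ 2 / (4 * k) * τ) - (k - j') / 2 * (u - v + w * (1 - 2 / k)))
  linear_combination (1 / 4) * (X' * (-H' + 2 * g') + X * (-H + 2 * g)) * hfac

lemma mordellHat_add_one_sin {k : ℕ} (hk : k ≠ 0) {r : ℤ} (hr : ¬ (k : ℤ) ∣ r) {τ : ℂ}
    (hτ : 0 < τ.im) (U : ℂ) :
    (-1) ^ r * mordellHat k r τ (U + 1) - mordellHat k r τ U =
      -2 / (-I * τ) ^ (1 / 2 : ℂ) * ∑ p ∈ Finset.Icc (1 : ℤ) (k - 1),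
        SHat k r p * e ((k * U + p) ^ 2 / (4 * k * τ)) := by
  have hkr : (0 : ℝ) < k := by exact_mod_cast Nat.pos_of_ne_zero hk
  have hs : Real.sqrt (2 / k) = 2 / Real.sqrt (2 * k) := by
    rw [Real.sqrt_div (by norm_num), Real.sqrt_mul (by norm_num)]
    have h1 : Real.sqrt 2 ≠ 0 := by positivity
    have h2 : Real.sqrt k ≠ 0 := by positivity
    field_simp
    rw [Real.sq_sqrt (by norm_num)]
  rw [mordellHat_add_one hk hr hτ, sqrt_neg_I_mul hk, Finset.mul_sum, Finset.mul_sum]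
  refine Finset.sum_congr rfl fun p _ => ?_
  rw [SHat, hs]
  push_cast
  ring

/-- The inhomogeneous term is transformed into the modular images of those of the summands. -/
lemma mordellSide_add_one {k : ℕ} (hk : 2 ≤ k) {j j' : ℤ} (hjj' : j ≡ j' [ZMOD 2]) (h0 : 0 < j')
    (h1 : j' < k) {τ : ℂ} (hτ : 0 < τ.im) (v w u : ℂ) :
    mordellSide k j j' τ v w (u + 1) + mordellSide k j j' τ v w u =
      muFactor k τ v w (u + 1) * ∑ p ∈ Finset.Icc (1 : ℤ) (k - 1),
        ∑ p' ∈ Finset.Icc (1 : ℤ) (k - 1), SHat k j p * SHat k j' p' *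
          (if p ≡ p' [ZMOD 2] then
            muShift k p p' (-1 / τ) (v / τ) (w / τ) (u / τ - -1 / τ) else 0) := by
  have hk' : k ≠ 0 := by omega
  have hk0 : (k : ℂ) ≠ 0 := by exact_mod_cast hk'
  have hτ0 : τ ≠ 0 := fun h => by simp [h] at hτ
  have hτ' := im_neg_one_div_pos hτ
  set x := u - v + w with hx
  set U := u - v + w * (1 - 2 / k) with hU
  have hH := mordellHat_add_one_sin hk' (not_dvd_of_pos_lt h0 h1) hτ U
  have hH' := mordellHat_add_one_sin hk' (not_dvd_of_pos_lt (k := k) (r := k - j') (by omega)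
    (by omega)) hτ U
  have hX := affineChar_add_one hτ (k - 2) (j - 1) x
  have hX' := affineChar_add_one hτ (k - 2) (k - j - 1) x
  have hs1 : (-1 : ℂ) ^ (j - 1) = -(-1) ^ j' := by
    rw [zpow_sub_one₀ (by norm_num), neg_one_zpow_congr hjj']
    norm_num
  have hs2 : (-1 : ℂ) ^ (k - j - 1 : ℤ) = -(-1) ^ (k - j' : ℤ) := by
    have : (k : ℤ) - j ≡ k - j' [ZMOD 2] := Int.ModEq.sub_left _ hjj'
    rw [zpow_sub_one₀ (by norm_num), neg_one_zpow_congr this]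
    norm_num
  rw [hs1] at hX
  rw [hs2] at hX'
  have hLHS : mordellSide k j j' τ v w (u + 1) + mordellSide k j j' τ v w u =
      -(1 / 4) * (affineChar (k - 2) (j - 1) τ x *
          ((-1) ^ j' * mordellHat k j' τ (U + 1) - mordellHat k j' τ U) +
        affineChar (k - 2) (k - j - 1) τ x *
          ((-1) ^ (k - j') * mordellHat k (k - j') τ (U + 1) - mordellHat k (k - j') τ U)) := by
    simp only [mordellSide]
    rw [show u + 1 - v + w = x + 1 by rw [hx]; ring,
      show u + 1 - v + w * (1 - 2 / k) = U + 1 by rw [hU]; ring, hX, hX', ← hx, ← hU]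
    ring
  -- Translating back by the period -1/τ reflects k - p to p in the character, and completing the
  -- square yields the Gaussians produced by the Mordell integral.
  have hterm : ∀ p p' : ℤ, muFactor k τ v w (u + 1) * (if (k - p : ℤ) ≡ k - p' [ZMOD 2] then
      muShift k (k - p) (k - p') (-1 / τ) (v / τ) (w / τ) (u / τ - -1 / τ) else 0) =
      if p ≡ p' [ZMOD 2] then 1 / (-I * τ) ^ (1 / 2 : ℂ) * e (-((k - 2) * x ^ 2 / (4 * τ))) *
        (affineChar (k - 2) (p - 1) (-1 / τ) (x / τ) * e ((k * U + p') ^ 2 / (4 * k * τ)))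
        else 0 := by
    intro p p'
    have hiff : (k - p : ℤ) ≡ k - p' [ZMOD 2] ↔ p ≡ p' [ZMOD 2] := by
      unfold Int.ModEq
      omega
    simp only [hiff]
    split_ifs
    · have hq := affineChar_sub_period_level hk (k - p - 1) hτ' (x / τ)
      rw [show (k : ℤ) - 2 - (k - p - 1) = p - 1 by ring] at hq
      rw [muShift, show u / τ - -1 / τ - v / τ + w / τ = x / τ - -1 / τ by rw [hx]; ring, hq,
        muFactor, show e ((k * U + p') ^ 2 / (4 * k * τ)) = e (-(-((k - 2) * x ^ 2 / (4 * τ)))) *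
        (e ((u + 1 - v) ^ 2 / (2 * τ)) * e (-(w ^ 2 * (1 - 2 / k) / (2 * τ))) *
        (e (-(((k - p' : ℤ) : ℂ) ^ 2 / (4 * k) * (-1 / τ)) -
          ((k - p' : ℤ) : ℂ) / 2 * (u / τ - -1 / τ - v / τ + w / τ * (1 - 2 / k))) *
          e (-((k - 2) / 4 * (-1 / τ)) + (k - 2) / 2 * (x / τ)))) by
            simp only [← e_add]
            congr 1
            rw [hx, hU]
            push_cast
            field_simp
            ring, e_neg (-_)]
      have := e_ne_zero (-((k - 2) * x ^ 2 / (4 * τ)))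
      field_simp
    · rw [mul_zero]
  rw [hLHS, hH, hH', affineChar_S_level hk j hτ, affineChar_S_level hk (k - j) hτ,
    ← sum_SHat_reflect hk' hjj', Finset.mul_sum]
  -- The parity condition is the projector ½(1 + (-1)^(p+p')), and the sign is what reflecting both
  -- j and j' produces in the S-matrix entries. So the constrained sum is the average of two
  -- unconstrained products.
  have hRHS : ∀ p p' : ℤ, muFactor k τ v w (u + 1) * (SHat k j p * SHat k j' p' *
      (if (k - p : ℤ) ≡ k - p' [ZMOD 2] then
      muShift k (k - p) (k - p') (-1 / τ) (v / τ) (w / τ) (u / τ - -1 / τ) else 0)) =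
      1 / 2 * (1 / (-I * τ) ^ (1 / 2 : ℂ) * e (-((k - 2) * x ^ 2 / (4 * τ)))) *
        ((SHat k j p * affineChar (k - 2) (p - 1) (-1 / τ) (x / τ)) *
          (SHat k j' p' * e ((k * U + p') ^ 2 / (4 * k * τ))) +
        (SHat k (k - j) p * affineChar (k - 2) (p - 1) (-1 / τ) (x / τ)) *
          (SHat k (k - j') p' * e ((k * U + p') ^ 2 / (4 * k * τ)))) := by
    intro p p'
    rw [mul_left_comm, hterm, SHat_sub_left hk', SHat_sub_left hk']
    split_ifs with hpp
    · rw [neg_one_zpow_congr hpp]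
      linear_combination (-(1 / 2) * (1 / (-I * τ) ^ (1 / 2 : ℂ) *
        e (-((k - 2) * x ^ 2 / (4 * τ)))) * (SHat k j p * SHat k j' p') *
        (affineChar (k - 2) (p - 1) (-1 / τ) (x / τ) * e ((k * U + p') ^ 2 / (4 * k * τ)))) *
        neg_one_zpow_sq p'
    · rw [neg_one_zpow_of_not_congr hpp]
      linear_combination ((1 / 2) * (1 / (-I * τ) ^ (1 / 2 : ℂ) *
        e (-((k - 2) * x ^ 2 / (4 * τ)))) * (SHat k j p * SHat k j' p') *
        (affineChar (k - 2) (p - 1) (-1 / τ) (x / τ) * e ((k * U + p') ^ 2 / (4 * k * τ)))) *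
        neg_one_zpow_sq p'
  simp only [Finset.mul_sum (Finset.Icc (1 : ℤ) (k - 1)) _ (muFactor k τ v w (u + 1)), hRHS]
  simp only [← Finset.mul_sum, Finset.sum_add_distrib, ← Finset.sum_mul]
  ring

/-- The sum over the modular images of the numerators of `μ^{k,p,p'}`. -/
noncomputable def muNumSum (k : ℕ) (j j' : ℤ) (τ v w u : ℂ) : ℂ :=
  ∑ p ∈ Finset.Icc (1 : ℤ) (k - 1), ∑ p' ∈ Finset.Icc (1 : ℤ) (k - 1),
    SHat k j p * SHat k j' p' * muNum k p p' (-1 / τ) (v / τ) (u / τ) (w / τ)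

/-- The difference of the two sides of the transformation formula, multiplied by `θ₁₁(τ;u)`. -/
noncomputable def muDefect (k : ℕ) (j j' : ℤ) (τ v w u : ℂ) : ℂ :=
  1 / 2 * (muNum k j j' τ v u w + muNum k (k - j) (k - j') τ v u w) +
    e ((u - v) ^ 2 / (2 * τ) - u ^ 2 / (2 * τ)) *
      (e (-(w ^ 2 * (1 - 2 / k) / (2 * τ))) / (-I * τ) ^ (1 / 2 : ℂ) *
        (I / (-I * τ) ^ (1 / 2 : ℂ))) * muNumSum k j j' τ v w u -
    theta11 τ u * mordellSide k j j' τ v w u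

/-! ### The defect is entire, quasi-periodic and hence zero. -/

lemma eq_one_of_mem_Icc {k : ℕ} {p : ℤ} (hp : p ∈ Finset.Icc (1 : ℤ) (k - 1)) (h : k = 2) :
    p = 1 := by
  rw [Finset.mem_Icc] at hp
  omega

lemma div_ne_lattice_of_ne {τ v : ℂ} (hτ : τ ≠ 0) (hv : ∀ a b : ℤ, v ≠ a * τ + b) (a b : ℤ) :
    v / τ ≠ a * (-1 / τ) + b := fun h => by
  refine hv b (-a) ?_
  field_simp at h
  push_cast
  linear_combination h

lemma differentiable_muNumSum {k : ℕ} (hk : 2 ≤ k) (j j' : ℤ) {τ : ℂ} (hτ : 0 < τ.im) (v w : ℂ) :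
    Differentiable ℂ (muNumSum k j j' τ v w) := by
  have hd : Differentiable ℂ fun u : ℂ => u / τ := by fun_prop
  refine Differentiable.fun_sum fun p hp => Differentiable.fun_sum fun p' _ => ?_
  have h := (differentiable_muNum hk (j' := p') (eq_one_of_mem_Icc hp) (im_neg_one_div_pos hτ)
    (v / τ) (w / τ)).comp hd
  exact Differentiable.const_mul h (SHat k j p * SHat k j' p')

lemma differentiable_muDefect {k : ℕ} (hk : 2 ≤ k) {j j' : ℤ} (hj0 : 0 < j) (hj1 : j < k)
    (h0 : 0 < j') (h1 : j' < k) {τ : ℂ} (hτ : 0 < τ.im) (v w : ℂ) :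
    Differentiable ℂ (muDefect k j j' τ v w) := by
  have hE : Differentiable ℂ fun u : ℂ => e ((u - v) ^ 2 / (2 * τ) - u ^ 2 / (2 * τ)) := by
    unfold e
    fun_prop
  have h2 := differentiable_muNum hk (j := j) (j' := j') (by omega) hτ v w
  have h3 := differentiable_muNum hk (j := k - j) (j' := k - j') (by omega) hτ v w
  have h4 := differentiable_theta11 hτ
  have h5 := differentiable_mordellSide (j := j) h0 h1 hτ v w
  have h6 := differentiable_muNumSum hk j j' hτ v w
  exact (((h2.fun_add h3).const_mul (1 / 2)).fun_add ((hE.mul_const _).fun_mul h6)).fun_sub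
    (h4.fun_mul h5)

/-- The translation u ↦ u + 1 moves u/τ by minus the period -1/τ, so `muNum_sub_period` applies at
that modulus; pairs of unequal parity contribute zero. -/
lemma muNumSum_add_one {k : ℕ} (hk : 2 ≤ k) (j j' : ℤ) {τ : ℂ} (hτ : 0 < τ.im) {v : ℂ}
    (hv : ∀ a b : ℤ, v ≠ a * τ + b) (w u : ℂ) :
    muNumSum k j j' τ v w (u + 1) = e (v / τ) * muNumSum k j j' τ v w u +
      theta11 (-1 / τ) (u / τ - -1 / τ) * ∑ p ∈ Finset.Icc (1 : ℤ) (k - 1),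
        ∑ p' ∈ Finset.Icc (1 : ℤ) (k - 1), SHat k j p * SHat k j' p' *
          (if p ≡ p' [ZMOD 2] then
            muShift k p p' (-1 / τ) (v / τ) (w / τ) (u / τ - -1 / τ) else 0) := by
  have hτ0 : τ ≠ 0 := fun h => by simp [h] at hτ
  have hτ' := im_neg_one_div_pos hτ
  have hv' := div_ne_lattice_of_ne hτ0 hv
  have hshift : ∀ p ∈ Finset.Icc (1 : ℤ) (k - 1), ∀ p' ∈ Finset.Icc (1 : ℤ) (k - 1),
      SHat k j p * SHat k j' p' *
        muNum k p p' (-1 / τ) (v / τ) (u / τ - -1 / τ) (w / τ) =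
      e (v / τ) * (SHat k j p * SHat k j' p' *
        muNum k p p' (-1 / τ) (v / τ) (u / τ) (w / τ)) +
      theta11 (-1 / τ) (u / τ - -1 / τ) * (SHat k j p * SHat k j' p' *
        (if p ≡ p' [ZMOD 2] then
          muShift k p p' (-1 / τ) (v / τ) (w / τ) (u / τ - -1 / τ) else 0)) := by
    intro p hp p' _
    split_ifs with hpp
    · have h := muNum_sub_period hk (eq_one_of_mem_Icc hp) hpp hτ' hv' (u / τ - -1 / τ) (w / τ)
      rw [sub_add_cancel] at h
      rw [muShift]
      linear_combination SHat k j p * SHat k j' p' * h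
    · rw [muNum_eq_zero hk (eq_one_of_mem_Icc hp) hpp hτ',
        muNum_eq_zero hk (eq_one_of_mem_Icc hp) hpp hτ']
      ring
  rw [muNumSum, show (u + 1) / τ = u / τ - -1 / τ by ring,
    Finset.sum_congr rfl fun p hp => Finset.sum_congr rfl (hshift p hp)]
  simp only [Finset.sum_add_distrib, ← Finset.mul_sum]
  rfl

lemma muDefect_add_one {k : ℕ} (hk : 2 ≤ k) {j j' : ℤ} (h0 : 0 < j')
    (h1 : j' < k) (hjj' : j ≡ j' [ZMOD 2]) {τ : ℂ} (hτ : 0 < τ.im) {v : ℂ}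
    (hv : ∀ a b : ℤ, v ≠ a * τ + b) (w u : ℂ) :
    muDefect k j j' τ v w (u + 1) = muDefect k j j' τ v w u := by
  have hτ0 : τ ≠ 0 := fun h => by simp [h] at hτ
  have hR := mordellSide_add_one hk hjj' h0 h1 hτ v w u
  have hS := muNumSum_add_one hk j j' hτ hv w u
  have hθ := theta11_S hτ (u + 1)
  rw [show (u + 1) / τ = u / τ - -1 / τ by ring] at hθ
  have hθ1 := theta11_add_one hτ u
  -- The exponent ((u-v)² - u²)/2τ is affine in u, so the translation gives a constant e(-v/τ),
  -- which cancels the multiplier of the numerators.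
  have hE : e ((u + 1 - v) ^ 2 / (2 * τ) - (u + 1) ^ 2 / (2 * τ)) * e (v / τ) =
      e ((u - v) ^ 2 / (2 * τ) - u ^ 2 / (2 * τ)) := by
    rw [← e_add]
    congr 1
    field_simp
    ring
  have hE2 : e ((u + 1 - v) ^ 2 / (2 * τ) - (u + 1) ^ 2 / (2 * τ)) =
      e ((u + 1 - v) ^ 2 / (2 * τ)) * e (-((u + 1) ^ 2 / (2 * τ))) := by
    rw [← e_add, sub_eq_add_neg]
  rw [muFactor] at hR
  simp only [muDefect, muNum_add_one, hS]
  generalize muNumSum k j j' τ v w u = S₀ at *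
  generalize (∑ p ∈ Finset.Icc (1 : ℤ) (k - 1), ∑ p' ∈ Finset.Icc (1 : ℤ) (k - 1),
      SHat k j p * SHat k j' p' * (if p ≡ p' [ZMOD 2] then
          muShift k p p' (-1 / τ) (v / τ) (w / τ) (u / τ - -1 / τ) else 0)) = S₁ at *
  set C := e (-(w ^ 2 * (1 - 2 / k) / (2 * τ))) / (-I * τ) ^ (1 / 2 : ℂ) *
    (I / (-I * τ) ^ (1 / 2 : ℂ)) with hC
  have hCθ : e ((u + 1 - v) ^ 2 / (2 * τ) - (u + 1) ^ 2 / (2 * τ)) * C *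
      theta11 (-1 / τ) (u / τ - -1 / τ) = e ((u + 1 - v) ^ 2 / (2 * τ)) *
        e (-(w ^ 2 * (1 - 2 / k) / (2 * τ))) / (-I * τ) ^ (1 / 2 : ℂ) * theta11 τ (u + 1) := by
    rw [hE2, hθ, hC]
    ring
  linear_combination C * S₀ * hE + S₁ * hCθ - theta11 τ (u + 1) * hR +
    mordellSide k j j' τ v w u * hθ1

lemma muNumSum_add_period (k : ℕ) (j j' : ℤ) {τ : ℂ} (hτ : τ ≠ 0) (v w u : ℂ) :
    muNumSum k j j' τ v w (u + τ) = muNumSum k j j' τ v w u := by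
  simp only [muNumSum, add_div, div_self hτ, muNum_add_one]

/-- The numerators at -1/τ do not change, since u/τ moves by 1. The exponential prefactor gives
e(-v), and the residue terms of the Mordell side cancel the defects of the two numerators at τ. -/
lemma muDefect_add_period {k : ℕ} (hk : 2 ≤ k) {j j' : ℤ} (hj0 : 0 < j) (hj1 : j < k)
    (h0 : 0 < j') (h1 : j' < k) (hjj' : j ≡ j' [ZMOD 2]) {τ : ℂ} (hτ : 0 < τ.im) {v : ℂ}
    (hv : ∀ a b : ℤ, v ≠ a * τ + b) (w u : ℂ) :
    muDefect k j j' τ v w (u + τ) = e (-v) * muDefect k j j' τ v w u := by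
  have hτ0 : τ ≠ 0 := fun h => by simp [h] at hτ
  have hN1 := muNum_sub_period hk (j := j) (j' := j') (by omega) hjj' hτ hv u w
  have hN2 := muNum_sub_period hk (j := k - j) (j' := k - j') (by omega)
    (Int.ModEq.sub_left _ hjj') hτ hv u w
  have hR := mordellSide_add_period hk j h0 h1 hτ v w u
  have hθ := theta11_add_period hτ u
  have hE : e ((u + τ - v) ^ 2 / (2 * τ) - (u + τ) ^ 2 / (2 * τ)) =
      e (-v) * e ((u - v) ^ 2 / (2 * τ) - u ^ 2 / (2 * τ)) := by
    rw [← e_add]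
    congr 1
    field_simp
    ring
  have hev : e (-v) * e v = 1 := by rw [← e_add, neg_add_cancel, e_zero]
  rw [muDefect, muDefect, muNumSum_add_period k j j' hτ0, hE, hθ]
  simp only [muShift] at hR
  generalize muNumSum k j j' τ v w u = S₀ at *
  linear_combination (-(1 / 2) * e (-v)) * (hN1 + hN2) + e (-v) * theta11 τ u * hR +
    (1 / 2 * (-muNum k j j' τ v (u + τ) w - muNum k (k - j) (k - j') τ v (u + τ) w)
      - theta11 τ u * e (-(τ / 2) - u) * mordellSide k j j' τ v w (u + τ)) * hev

lemma muDefect_eq_zero {k : ℕ} (hk : 2 ≤ k) {j j' : ℤ} (hj0 : 0 < j) (hj1 : j < k) (h0 : 0 < j')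
    (h1 : j' < k) (hjj' : j ≡ j' [ZMOD 2]) {τ : ℂ} (hτ : 0 < τ.im) {v : ℂ}
    (hv : ∀ a b : ℤ, v ≠ a * τ + b) (w u : ℂ) : muDefect k j j' τ v w u = 0 := by
  refine eq_zero_of_quasiperiodic (σ := τ) (β := e (-v))
    (differentiable_muDefect hk hj0 hj1 h0 h1 hτ v w)
    (muDefect_add_one hk h0 h1 hjj' hτ hv w)
    (muDefect_add_period hk hj0 hj1 h0 h1 hjj' hτ hv w) (fun n h => ?_) u
  have h2 : e (v + n * τ) = 1 := by
    rw [e_add, ← h, ← e_add, add_neg_cancel, e_zero]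
  obtain ⟨m, hm⟩ := e_eq_one_iff.mp h2
  refine hv (-n) m ?_
  push_cast
  linear_combination hm

end AppellLerch

open AppellLerch

theorem mainTheorem4 (k : ℕ) (hk : 2 ≤ k) (j j' : ℤ)
    (hj : j ∈ Finset.Icc (1 : ℤ) (k - 1)) (hj' : j' ∈ Finset.Icc (1 : ℤ) (k - 1))
    (hjj' : j ≡ j' [ZMOD 2])
    (τ v u w : ℂ) (hτ : 0 < τ.im)
    (hv : ∀ a b : ℤ, v ≠ a * τ + b) (hu : ∀ a b : ℤ, u ≠ a * τ + b) :
    (muSym k j j' τ v u w +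
        Complex.exp (Real.pi * Complex.I * (u - v) ^ 2 / τ) *
          Complex.exp (-(Real.pi * Complex.I * w ^ 2 * (1 - 2 / k) / τ)) /
          (-Complex.I * τ) ^ (1 / 2 : ℂ) *
        ∑ p ∈ Finset.Icc (1 : ℤ) (k - 1), ∑ p' ∈ Finset.Icc (1 : ℤ) (k - 1),
          SHat k j p * SHat k j' p' * mu k p p' (-1 / τ) (v / τ) (u / τ) (w / τ)
      = (1 / 4) *
        (affineChar (k - 2) (j - 1) τ (u - v + w) *
            mordellHat k j' τ (u - v + w * (1 - 2 / k)) +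
          affineChar (k - 2) (k - j - 1) τ (u - v + w) *
            mordellHat k (k - j') τ (u - v + w * (1 - 2 / k)))) ∧
    (muSym k j j' τ v u w +
        Complex.exp (Real.pi * Complex.I * (u - v) ^ 2 / τ) *
          Complex.exp (-(Real.pi * Complex.I * w ^ 2 * (1 - 2 / k) / τ)) /
          (-Complex.I * τ) ^ (1 / 2 : ℂ) *
        ∑ p ∈ Finset.Icc (1 : ℤ) (k - 1), ∑ p' ∈ Finset.Icc (1 : ℤ) (k - 1),
          SHat k j p * SHat k j' p' * muSym k p p' (-1 / τ) (v / τ) (u / τ) (w / τ)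
      = (1 / 4) *
        (affineChar (k - 2) (j - 1) τ (u - v + w) *
            mordellHat k j' τ (u - v + w * (1 - 2 / k)) +
          affineChar (k - 2) (k - j - 1) τ (u - v + w) *
            mordellHat k (k - j') τ (u - v + w * (1 - 2 / k)))) := by
  rw [Finset.mem_Icc] at hj hj'
  have hk' : k ≠ 0 := by omega
  have hτ0 : τ ≠ 0 := fun h => by simp [h] at hτ
  have hτ' := im_neg_one_div_pos hτ
  have hu' := div_ne_lattice_of_ne hτ0 hu
  have hθ := theta11_ne_zero hτ hu
  have hθ' := theta11_ne_zero hτ' hu'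
  have hS := theta11_S hτ u
  have hmain := muDefect_eq_zero hk (by omega) (by omega) (by omega) (by omega) hjj' hτ hv w u
  -- Reflecting both summation indices shows that the two halves of the symmetrised sum are equal,
  -- so both identities reduce to one.
  have hsym : ∑ p ∈ Finset.Icc (1 : ℤ) (k - 1), ∑ p' ∈ Finset.Icc (1 : ℤ) (k - 1),
      SHat k j p * SHat k j' p' * muSym k p p' (-1 / τ) (v / τ) (u / τ) (w / τ) =
      ∑ p ∈ Finset.Icc (1 : ℤ) (k - 1), ∑ p' ∈ Finset.Icc (1 : ℤ) (k - 1),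
      SHat k j p * SHat k j' p' * mu k p p' (-1 / τ) (v / τ) (u / τ) (w / τ) := by
    have h := sum_SHat_reflect hk' hjj' fun p p' => mu k p p' (-1 / τ) (v / τ) (u / τ) (w / τ)
    simp only [muSym, mul_add, mul_left_comm _ (1 / 2 : ℂ), Finset.sum_add_distrib,
      ← Finset.mul_sum, h]
    ring
  rw [hsym, and_self_iff]
  have hsum : ∑ p ∈ Finset.Icc (1 : ℤ) (k - 1), ∑ p' ∈ Finset.Icc (1 : ℤ) (k - 1),
      SHat k j p * SHat k j' p' * mu k p p' (-1 / τ) (v / τ) (u / τ) (w / τ) =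
      (∑ p ∈ Finset.Icc (1 : ℤ) (k - 1), ∑ p' ∈ Finset.Icc (1 : ℤ) (k - 1),
        SHat k j p * SHat k j' p' * muNum k p p' (-1 / τ) (v / τ) (u / τ) (w / τ)) /
        theta11 (-1 / τ) (u / τ) := by
    simp only [mu_eq_muNum_div, Finset.sum_div, mul_div_assoc]
  have he1 : Complex.exp (Real.pi * Complex.I * (u - v) ^ 2 / τ) = e ((u - v) ^ 2 / (2 * τ)) := by
    rw [e]
    congr 1
    field_simp
  have he2 : Complex.exp (-(Real.pi * Complex.I * w ^ 2 * (1 - 2 / k) / τ)) =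
      e (-(w ^ 2 * (1 - 2 / k) / (2 * τ))) := by
    rw [e]
    congr 1
    field_simp
  rw [hsum, he1, he2, muSym, mu_eq_muNum_div, mu_eq_muNum_div, ← mordellSide]
  rw [muDefect, muNumSum, sub_eq_add_neg ((u - v) ^ 2 / (2 * τ)), e_add] at hmain
  -- As `u` is off the lattice, it suffices to compare after multiplication by θ₁₁(τ;u), which is
  -- the vanishing of the defect.
  refine mul_left_cancel₀ hθ ?_
  set N' := ∑ p ∈ Finset.Icc (1 : ℤ) (k - 1), ∑ p' ∈ Finset.Icc (1 : ℤ) (k - 1),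
        SHat k j p * SHat k j' p' * muNum k p p' (-1 / τ) (v / τ) (u / τ) (w / τ)
  have h1 : ∀ x, theta11 τ u * (x / theta11 τ u) = x := fun x => mul_div_cancel₀ x hθ
  have h2 : theta11 τ u * (N' / theta11 (-1 / τ) (u / τ)) =
      I / (-I * τ) ^ (1 / 2 : ℂ) * e (-(u ^ 2 / (2 * τ))) * N' := by
    rw [hS, mul_assoc, mul_div_cancel₀ _ hθ']
  linear_combination hmain + (1 / 2) * h1 (muNum k j j' τ v u w) +
    (1 / 2) * h1 (muNum k (k - j) (k - j') τ v u w) +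
    (e ((u - v) ^ 2 / (2 * τ)) * e (-(w ^ 2 * (1 - 2 / k) / (2 * τ))) /
      (-I * τ) ^ (1 / 2 : ℂ)) * h2
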